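/- Let $R$ be an algebraically closed field of characteristic $0$, $\mathcal S$ a smooth connected affine curve over $R$ with coordinate ring $\mathcal R$, and $\Omega=\Omega^1_{\mathcal R/R}$. Let $A$ be a small strictly unital $\mathbb Z$-graded $A_\infty$-category over $R$ which is proper (each $H(\hom_A(X,Y))$ has finite total dimension), and let $\mathcal A=\mathcal R\otimes A$. Fix a Hochschild cocycle $\gamma\in CC^1(\mathcal A,\Omega\otimes\mathcal A)$ representing a deformation field $[\gamma]\in HH^1(\mathcal A,\Omega\otimes\mathcal A)$, and two points $s,s'\in\mathcal S$. *Conventions.* $A^{mod}$ is the $A_\infty$-category of strictly unital right $A_\infty$-modules over $A$ with bounded cohomology that is finite-dimensional in each degree, and $\mathcal A^{mod}$ that of families of such modules over $\mathcal S$: each $\mathcal M(X)$ is a graded projective $\mathcal R$-module, with bounded cohomology that is finitely generated in each degree. $A^{perf}\subset A^{mod}$ and $\mathcal A^{perf}\subset\mathcal A^{mod}$ consist of the objects quasi-isomorphic (that is, isomorphic in $H^0$) to a direct summand of the Yoneda image of a twisted complex, respectively of a family of twisted complexes $\bigoplus_i\mathcal F_i\otimes X_i[-\sigma_i]$ with $\mathcal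 F_i$ finitely generated projective over $\mathcal R$. $\mathcal M_s$ denotes the fibre of a family $\mathcal M$ at $s$. A *pre-connection* $\nabla_{\mathcal M}$ on $\mathcal M$ is a sequence of maps $\nabla^d_{\mathcal M}:\mathcal M(X_{d-1})\otimes\hom_A(X_{d-2},X_{d-1})\otimes\cdots\otimes\hom_A(X_0,X_1)\to\Omega\otimes\mathcal M(X_0)[1-d]$ ($d\ge1$) such that the maps $m\mapsto(-1)^{|m|}\nabla^1_{\mathcal M}(m)$ are connections and the $\nabla^d_{\mathcal M}$ with $d>1$ are $\mathcal R$-linear. It is a *relative connection* if $\mu^1_{\mathcal A^{mod}}(\nabla_{\mathcal M})=\gamma^{mod,0}$, where $\gamma^{mod}$ is the Hochschild cochain on $\mathcal A^{mod}$ induced by $\gamma$; $\mathcal M$ *follows* $[\gamma]$ if $[\mu^1_{\mathcal A^{mod}}(\nabla_{\mathcal M})]=[\gamma^{mod,0}]$ for some pre-connection, which is equivalent to the existence of a relative connection. Relative connections on $\mathcal M_0,\mathcal M_1$ induce on $\hom_{\mathcal A^{mod}}(\mathcal M_0,\mathcal M_1)$, and hence on its cohomology, the connection $$b\longmapsto(-1)^{|b|}\mu^2_{\mathcal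 A^{mod}}(\nabla_{\mathcal M_1},b)-\mu^2_{\mathcal A^{mod}}(\mathrm{id}_\Omega\otimes b,\nabla_{\mathcal M_0})+\gamma^{mod,1}(b).$$ *Parallel transport.* Let $M_0,M_1$ be objects of $A^{perf}$ and $B\subset\mathrm{Hom}_{H^0(A^{perf})}(M_0,M_1)$ a one-dimensional subspace. A triple $(M_0',M_1',B')$ is obtained from $(M_0,M_1,B)$ by parallel transport from $s$ to $s'$ if there are perfect families $\mathcal M_0,\mathcal M_1$ following $[\gamma]$, relative connections on them, and a line bundle $\mathcal B\subset\mathrm{Hom}_{H^0(\mathcal A^{perf})}(\mathcal M_0,\mathcal M_1)$ invariant under the induced connection, such that $(\mathcal M_{0,s},\mathcal M_{1,s},\mathcal B_s)\cong(M_0,M_1,B)$ and $(\mathcal M_{0,s'},\mathcal M_{1,s'},\mathcal B_{s'})\cong(M'_0,M'_1,B')$. Here $\mathcal B_s$ is the subspace spanned by the restrictions of elements of $\mathcal B$ to the fibre at $s$, and $\cong$ means that there are isomorphisms in $H^0(A^{perf})$ between the respective objects which carry one subspace of morphisms to the other. **Proposition 1.24.** Suppose that, for $k=0,1$, the ring $\mathrm{Hom}_{H^0(A^{perf})}(M_k,M_k)$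 is commutative and its ideal of nilpotent elements has codimension $1$, and that the two multiplication maps $$B\otimes\mathrm{Hom}_{H^0(A^{perf})}(M_0,M_0)\to\mathrm{Hom}_{H^0(A^{perf})}(M_0,M_1),\qquad \mathrm{Hom}_{H^0(A^{perf})}(M_1,M_1)\otimes B\to\mathrm{Hom}_{H^0(A^{perf})}(M_0,M_1)$$ have the same image. If $(M'_0,M'_1,B')$ and $(M''_0,M''_1,B'')$ are both obtained from $(M_0,M_1,B)$ by parallel transport from $s$ to $s'$ (for possibly different choices of families, relative connections and line bundles), then there are isomorphisms $M'_0\cong M''_0$ and $M'_1\cong M''_1$ in $H^0(A^{perf})$ which carry $B'$ to $B''$. -/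

import Mathlib

open scoped TensorProduct KaehlerDifferential
universe u v
set_option linter.style.haveILetI false
set_option linter.unusedSectionVars false
noncomputable section
namespace AInf

/-- The sign `(-1)^n`, as an integer. -/
def sgn (n : ℤ) : ℤ := (n.negOnePow : ℤˣ)

theorem sgn_add (m n : ℤ) : sgn (m + n) = sgn m * sgn n := by
  simp [sgn, Int.negOnePow_add]

theorem sgn_zero : sgn 0 = 1 := by simp [sgn]

theorem sgn_one : sgn 1 = -1 := by simp [sgn]

theorem sgn_neg (n : ℤ) : sgn (-n) = sgn n := by simp [sgn]

theorem sgn_mul_self (n : ℤ) : sgn n * sgn n = 1 := by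
  rw [← sgn_add]; simp [sgn, Int.negOnePow_even (n + n) ⟨n, rfl⟩]

/-- A chain of composable homogeneous elements `a_d, …, a_1`, with `a_i ∈ H X_{i-1} X_i` of degree
`n_i`, from `X = X_0` to `X_d`. It is read from left to right in this order, so that `cons a c` puts
`a` on the left (it is applied last). -/
inductive Chain {Ob : Type u} (H : Ob → Ob → ℤ → Type u) : Ob → Ob → Type u
  | nil (X : Ob) : Chain H X X
  | cons {X Y Z : Ob} {n : ℤ} (a : H Y Z n) (c : Chain H X Y) : Chain H X Z

namespace Chain

variable {Ob : Type u} {H : Ob → Ob → ℤ → Type u}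

/-- The reduced degree `∑ (|a_i| - 1)` of a chain. -/
def deg {X Y : Ob} : Chain H X Y → ℤ
  | nil _ => 0
  | cons (n := n) _ c => (n - 1) + c.deg

/-- The number of elements of a chain. -/
def length {X Y : Ob} : Chain H X Y → ℕ
  | nil _ => 0
  | cons _ c => c.length + 1

/-- Concatenation: the left factor is applied last. -/
def append {X Y Z : Ob} : Chain H Y Z → Chain H X Y → Chain H X Z
  | nil _, d => d
  | cons a c, d => cons a (c.append d)

/-- The sum of `G l r` over all ways of cutting a chain in two, `c = l · r`, where `l` or `r` may be
empty. -/
def splitSum {E : Type v} [AddCommMonoid E] {X Z : Ob} :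
    Chain H X Z → (∀ Y, Chain H Y Z → Chain H X Y → E) → E
  | nil X, G => G X (nil X) (nil X)
  | cons a c, G => G _ (nil _) (cons a c) + c.splitSum fun Y l r => G Y (cons a l) r

theorem deg_append {X Y Z : Ob} (c : Chain H Y Z) (d : Chain H X Y) :
    (c.append d).deg = c.deg + d.deg := by
  induction c with
  | nil => simp [append, deg]
  | cons a c ih => simp [append, deg, ih, add_assoc]

theorem append_assoc {W X Y Z : Ob} (c : Chain H Y Z) (d : Chain H X Y) (e : Chain H W X) :
    (c.append d).append e = c.append (d.append e) := by
  induction c with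
  | nil => rfl
  | cons a c ih => simp [append, ih]

section sums
variable {E E' : Type*} [AddCommMonoid E] [AddCommMonoid E']

theorem splitSum_congr {X Z : Ob} (c : Chain H X Z) (G G' : ∀ Y, Chain H Y Z → Chain H X Y → E)
    (h : ∀ Y l r, l.deg + r.deg = c.deg → G Y l r = G' Y l r) : c.splitSum G = c.splitSum G' := by
  induction c with
  | nil => exact h _ _ _ (by simp [deg])
  | cons a c ih =>
    simp only [splitSum]
    rw [h _ _ _ (by simp [deg]), ih]
    intro Y l r hlr
    exact h _ _ _ (by simp only [deg]; omega)

theorem splitSum_add {X Z : Ob} (c : Chain H X Z) (G G' : ∀ Y, Chain H Y Z → Chain H X Y → E) :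
    c.splitSum (fun Y l r => G Y l r + G' Y l r) = c.splitSum G + c.splitSum G' := by
  induction c with
  | nil => rfl
  | cons a c ih =>
    simp only [splitSum]
    rw [ih]; abel

theorem map_splitSum {X Z : Ob} (f : E →+ E') (c : Chain H X Z)
    (G : ∀ Y, Chain H Y Z → Chain H X Y → E) :
    f (c.splitSum G) = c.splitSum (fun Y l r => f (G Y l r)) := by
  induction c with
  | nil => rfl
  | cons a c ih =>
    simp only [splitSum, map_add]
    rw [ih]

theorem splitSum_zero {X Z : Ob} (c : Chain H X Z) :
    c.splitSum (fun _ _ _ => (0 : E)) = 0 := by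
  induction c with
  | nil => rfl
  | cons a c ih => simp [splitSum, ih]

theorem splitSum_append_cons {X Y W Z : Ob} {n : ℤ} (p : Chain H Y Z) (a : H W Y n)
    (q : Chain H X W) (G : ∀ V, Chain H V Z → Chain H X V → E) :
    (p.append (cons a q)).splitSum G =
      p.splitSum (fun V l r => G V l (r.append (cons a q))) +
        q.splitSum (fun V l r => G V (p.append (cons a l)) r) := by
  induction p with
  | nil => simp [append, splitSum]
  | cons b p ih =>
    simp only [append, splitSum]
    rw [ih, add_assoc]

theorem splitSum_comm {X Z X' Z' : Ob} (c : Chain H X Z) (c' : Chain H X' Z')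
    (G : ∀ Y, Chain H Y Z → Chain H X Y → ∀ Y', Chain H Y' Z' → Chain H X' Y' → E) :
    c.splitSum (fun Y l r => c'.splitSum (G Y l r)) =
      c'.splitSum (fun Y' l' r' => c.splitSum fun Y l r => G Y l r Y' l' r') := by
  induction c with
  | nil => rfl
  | cons a c ih =>
    simp only [splitSum]
    rw [splitSum_add, ih]

theorem splitSum_assoc {X Z : Ob} (c : Chain H X Z)
    (G : ∀ U V, Chain H V Z → Chain H U V → Chain H X U → E) :
    c.splitSum (fun U w r => w.splitSum (fun V l q => G U V l q r)) =
      c.splitSum (fun V l w => w.splitSum (fun U q r => G U V l q r)) := by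
  induction c with
  | nil => rfl
  | cons a c ih =>
    simp only [splitSum]
    rw [splitSum_add, ih, add_assoc]

theorem splitSum_nil_left {X Z : Ob} (c : Chain H X Z)
    (G : ∀ Y, Chain H Y Z → Chain H X Y → E)
    (h : ∀ Y l r, 0 < l.length → G Y l r = 0) : c.splitSum G = G Z (nil Z) c := by
  cases c with
  | nil => rfl
  | cons a c =>
    simp only [splitSum]
    rw [splitSum_congr c _ (fun _ _ _ => 0), splitSum_zero, add_zero]
    intro Y l r _
    exact h _ _ _ (by simp [length])

theorem splitSum_nil_right {X Z : Ob} (c : Chain H X Z)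
    (G : ∀ Y, Chain H Y Z → Chain H X Y → E)
    (h : ∀ Y l r, 0 < r.length → G Y l r = 0) : c.splitSum G = G X c (nil X) := by
  induction c with
  | nil => rfl
  | cons a c ih =>
    simp only [splitSum]
    rw [h _ _ _ (by simp [length]), zero_add, ih]
    intro Y l r hr
    exact h _ _ _ hr

end sums
end Chain

/-- `f` is `k`-linear in each entry of the chain (the target being a module over the
`k`-algebra `K`). -/
structure IsMultilinear (k K : Type u) [CommRing k] [CommRing K] [Algebra k K] {Ob : Type u}
    {H : Ob → Ob → ℤ → Type u} [∀ X Y n, AddCommGroup (H X Y n)] [∀ X Y n, Module k (H X Y n)]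
    {X Y : Ob} {E : Type u} [AddCommGroup E] [Module K E] (f : Chain H X Y → E) : Prop where
  map_add : ∀ {V W : Ob} {n : ℤ} (p : Chain H W Y) (a b : H V W n) (q : Chain H X V),
    f (p.append (.cons (a + b) q)) = f (p.append (.cons a q)) + f (p.append (.cons b q))
  map_smul : ∀ {V W : Ob} {n : ℤ} (p : Chain H W Y) (t : k) (a : H V W n) (q : Chain H X V),
    f (p.append (.cons (t • a) q)) = algebraMap k K t • f (p.append (.cons a q))

/-- The degree `n` cohomology `ker d^n / im d^{n-1}` of a graded module with a differential. -/
abbrev Cohomology {K : Type u} [CommRing K] {C : ℤ → Type u} [∀ n, AddCommGroup (C n)]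
    [∀ n, Module K (C n)] (d : ∀ m n, C m →ₗ[K] C n) (n : ℤ) : Type u :=
  LinearMap.ker (d n (n + 1)) ⧸
    (LinearMap.range (d (n - 1) n)).submoduleOf (LinearMap.ker (d n (n + 1)))

/-- A (small) strictly unital `ℤ`-graded `A_∞`-category over the field `k`. Elements of
`hom X Y n` are the morphisms of degree `n`; an `A_∞`-operation `μ^d(a_d, …, a_1)` is written as
`μ c n`, the degree `n` component of the value at the chain `c = (a_d, …, a_1)`. -/
structure AInfCat (k : Type u) [Field k] where
  Ob : Type u
  hom : Ob → Ob → ℤ → Type u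
  [homGroup : ∀ X Y n, AddCommGroup (hom X Y n)]
  [homModule : ∀ X Y n, Module k (hom X Y n)]
  μ : ∀ {X Y : Ob}, Chain hom X Y → ∀ n : ℤ, hom X Y n
  μ_nil : ∀ (X : Ob) (n : ℤ), μ (.nil X) n = 0
  μ_multilinear : ∀ (X Y : Ob) (n : ℤ), IsMultilinear k k fun c : Chain hom X Y => μ c n
  /-- `μ^d` has degree `2 - d`. -/
  μ_deg : ∀ {X Y : Ob} (c : Chain hom X Y) (n : ℤ), n ≠ c.deg + 2 → μ c n = 0
  /-- The `A_∞`-relations `∑ (-1)^{|a_1|+…+|a_i|-i} μ(a_d, …, μ(a_{i+j}, …, a_{i+1}), a_i, …, a_1) = 0`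
  (empty inner operations contribute zero). -/
  relation : ∀ {X Y : Ob} (c : Chain hom X Y) (n : ℤ),
    (c.splitSum fun _ l w => w.splitSum fun _ q r =>
      sgn r.deg • μ (l.append (.cons (μ q (q.deg + 2)) r)) n) = 0
  /-- Strict identity elements. -/
  e : ∀ X : Ob, hom X X 0
  μ_e : ∀ (X : Ob) (n : ℤ), μ (.cons (e X) (.nil X)) n = 0
  μ_right_e : ∀ {X Y : Ob} {n : ℤ} (a : hom X Y n), μ (.cons a (.cons (e X) (.nil X))) n = a
  μ_left_e : ∀ {X Y : Ob} {n : ℤ} (a : hom X Y n),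
    μ (.cons (e Y) (.cons a (.nil X))) n = sgn n • a
  μ_higher_e : ∀ {X Y Z : Ob} (p : Chain hom Y Z) (q : Chain hom X Y) (n : ℤ),
    2 ≤ p.length + q.length → μ (p.append (.cons (e Y) q)) n = 0

attribute [instance] AInfCat.homGroup AInfCat.homModule

namespace AInfCat
variable {k : Type u} [Field k] (A : AInfCat k)

/-- The differential `μ^1` on `hom X Y`. -/
def dHom (X Y : A.Ob) (m n : ℤ) : A.hom X Y m →ₗ[k] A.hom X Y n where
  toFun a := A.μ (.cons a (.nil X)) n
  map_add' a b := (A.μ_multilinear X Y n).map_add (.nil Y) a b (.nil X)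
  map_smul' t a := (A.μ_multilinear X Y n).map_smul (.nil Y) t a (.nil X)

/-- All the cohomologies `H(hom X Y)` are of finite total dimension. -/
structure IsProper : Prop where
  finite : ∀ (X Y : A.Ob) (n : ℤ), Module.Finite k (Cohomology (A.dHom X Y) n)
  bounded : ∀ X Y : A.Ob, ∃ N : ℤ, ∀ n, N < |n| → Subsingleton (Cohomology (A.dHom X Y) n)

end AInfCat

/-- The data underlying a family of right `A_∞`-modules over `A` with base ring `K`:
graded `K`-modules `obj X`, and `K`-linear operations `μ^d : obj X_{d-1} ⊗ hom ⊗ ⋯ ⊗ hom → obj X_0`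
of degree `2 - d`. Here `μ c i j m` is the degree `j` component of `μ^d(m, a_{d-1}, …, a_1)`, where
`c = (a_{d-1}, …, a_1)` and `m` has degree `i`. The `A_∞`-module equations are imposed in `IsModule`
below. -/
structure PreMod {k : Type u} [Field k] (A : AInfCat k) (K : Type u) [CommRing K]
    [Algebra k K] where
  obj : A.Ob → ℤ → Type u
  [objGroup : ∀ X n, AddCommGroup (obj X n)]
  [objModule : ∀ X n, Module K (obj X n)]
  μ : ∀ {X Y : A.Ob}, Chain A.hom X Y → ∀ i j : ℤ, obj Y i →ₗ[K] obj X j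
  μ_multilinear : ∀ (X Y : A.Ob) (i j : ℤ), IsMultilinear k K fun c : Chain A.hom X Y => μ c i j
  μ_deg : ∀ {X Y : A.Ob} (c : Chain A.hom X Y) (i j : ℤ), j ≠ i + c.deg + 1 → μ c i j = 0

attribute [instance] PreMod.objGroup PreMod.objModule

variable {k : Type u} [Field k] {A : AInfCat k} {K : Type u} [CommRing K] [Algebra k K]

/-- Sequences of additive maps `M(X_{d-1}) ⊗ hom ⊗ ⋯ ⊗ hom → N(X_0)`, without any linearity or
degree conditions (those are imposed in `IsHom`; connections are not linear over `K`). -/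
abbrev Maps (M N : PreMod A K) : Type u :=
  ∀ (X Y : A.Ob) (_ : Chain A.hom X Y) (i j : ℤ), M.obj Y i →+ N.obj X j

namespace Maps
variable {M N P Q : PreMod A K}

/-- The composition `μ²(b₂, b₁)` of the `A_∞`-category of modules, for `b₁` of degree `n`:
`(m, a_{d-1}, …, a_1) ↦ ∑ (-1)^{|m| + |l|'} b₂(b₁(m, l), r)`, summed over `(a_{d-1}, …, a_1) = l · r`,
with `|l|'` the reduced degree of `l`. -/
def comp (n : ℤ) (b₂ : Maps N P) (b₁ : Maps M N) : Maps M P := fun X _ c i j =>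
  c.splitSum fun Z l r =>
    sgn (i + l.deg) • (b₂ X Z r (i + l.deg + n) j).comp (b₁ Z _ l i (i + l.deg + n))

/-- The structure maps of a module, as a sequence of additive maps. -/
def μMaps (M : PreMod A K) : Maps M M := fun _ _ c i j => (M.μ c i j).toAddMonoidHom

/-- The differential `μ¹` of the `A_∞`-category of modules, for `t` of degree `n`. The three terms
are `∑ ± μ_N(t(m, l), r)`, `∑ ± t(μ_M(m, l), r)` and `∑ ± t(m, l, μ_A(q), r)`. -/
def dFun (n : ℤ) (t : Maps M N) : Maps M N := fun X _ c i j =>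
  (c.splitSum fun Z l r =>
    sgn (i + l.deg) • (N.μ r (i + l.deg + n) j).toAddMonoidHom.comp (t Z _ l i (i + l.deg + n))) +
  (c.splitSum fun Z l r =>
    sgn (i + l.deg) • (t X Z r (i + l.deg + 1) j).comp (M.μ l i (i + l.deg + 1)).toAddMonoidHom) +
  (c.splitSum fun _ l w => w.splitSum fun _ q r =>
    sgn (i + l.deg + q.deg) • t _ _ (l.append (.cons (A.μ q (q.deg + 2)) r)) i j)

theorem splitSum_apply {F E : Type*} [AddCommMonoid F] [AddCommMonoid E] {X Z : A.Ob}
    (c : Chain A.hom X Z) (G : ∀ Y, Chain A.hom Y Z → Chain A.hom X Y → F →+ E) (m : F) :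
    c.splitSum G m = c.splitSum fun Y l r => G Y l r m :=
  Chain.map_splitSum (AddMonoidHom.eval m) c G

theorem splitSum_smul {E : Type*} [AddCommGroup E] [Module K E] {X Z : A.Ob} (f : K)
    (c : Chain A.hom X Z) (G : ∀ Y, Chain A.hom Y Z → Chain A.hom X Y → E) :
    (c.splitSum fun Y l r => f • G Y l r) = f • c.splitSum G :=
  (Chain.map_splitSum (DistribSMul.toAddMonoidHom E f) c G).symm

theorem zsmul_splitSum {E : Type*} [AddCommGroup E] {X Z : A.Ob} (f : ℤ)
    (c : Chain A.hom X Z) (G : ∀ Y, Chain A.hom Y Z → Chain A.hom X Y → E) :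
    f • c.splitSum G = (c.splitSum fun Y l r => f • G Y l r) :=
  (Chain.map_splitSum (DistribSMul.toAddMonoidHom E f) c G)

/-- The differential `μ¹` of the `A_∞`-category of modules, as a `K`-linear map. -/
def d (n : ℤ) : Maps M N →ₗ[K] Maps M N where
  toFun := dFun n
  map_add' s t := by
    funext X Y c i j
    ext m
    simp [dFun, splitSum_apply, Chain.splitSum_add]
    abel
  map_smul' f t := by
    funext X Y c i j
    ext m
    simp only [dFun, splitSum_apply, AddMonoidHom.add_apply, AddMonoidHom.smul_apply, Pi.smul_apply,
      AddMonoidHom.comp_apply, LinearMap.toAddMonoidHom_coe, map_smul, smul_comm _ f, splitSum_smul,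
      RingHom.id_apply, smul_add]

theorem mid (b₂ : Maps N P) (b₁ : Maps M N) {X Y Z : A.Ob} (l : Chain A.hom Z Y)
    (r : Chain A.hom X Z) {i j x y : ℤ} (h : x = y) (m : M.obj Y i) :
    b₂ X Z r x j (b₁ Z Y l i x m) = b₂ X Z r y j (b₁ Z Y l i y m) := by
  subst h; rfl

theorem mid₂ (b₃ : Maps P Q) (b₂ : Maps N P) (b₁ : Maps M N) {X Y Z W : A.Ob}
    (l : Chain A.hom Z Y) (q : Chain A.hom W Z) (r : Chain A.hom X W) {i j x y x' y' : ℤ}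
    (h : x = y) (h' : x' = y') (m : M.obj Y i) :
    b₃ X W r x' j (b₂ W Z q x x' (b₁ Z Y l i x m)) =
      b₃ X W r y' j (b₂ W Z q y y' (b₁ Z Y l i y m)) := by
  subst h h'; rfl

theorem d_apply (n : ℤ) (t : Maps M N) {X Y : A.Ob} (c : Chain A.hom X Y) (i j : ℤ)
    (m : M.obj Y i) :
    d n t X Y c i j m =
      (c.splitSum fun Z l r => sgn (i + l.deg) • μMaps N X Z r (i + l.deg + n) j
        (t Z Y l i (i + l.deg + n) m)) +
      (c.splitSum fun Z l r => sgn (i + l.deg) • t X Z r (i + l.deg + 1) j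
        (μMaps M Z Y l i (i + l.deg + 1) m)) +
      (c.splitSum fun _ l w => w.splitSum fun _ q r =>
        sgn (i + l.deg + q.deg) • t X Y (l.append (.cons (A.μ q (q.deg + 2)) r)) i j m) := by
  simp only [d, LinearMap.coe_mk, AddHom.coe_mk, dFun, AddMonoidHom.add_apply, splitSum_apply]
  rfl

theorem comp_apply (n : ℤ) (b₂ : Maps N P) (b₁ : Maps M N) {X Y : A.Ob} (c : Chain A.hom X Y)
    (i j : ℤ) (m : M.obj Y i) :
    comp n b₂ b₁ X Y c i j m = c.splitSum fun Z l r => sgn (i + l.deg) •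
      b₂ X Z r (i + l.deg + n) j (b₁ Z Y l i (i + l.deg + n) m) := by
  simp only [comp, splitSum_apply]
  rfl

theorem map_splitSum_apply {E F : Type*} [AddCommGroup E] [AddCommGroup F] {X Z : A.Ob}
    (f : E →+ F) (s : ℤ) (c : Chain A.hom X Z)
    (G : ∀ Y, Chain A.hom Y Z → Chain A.hom X Y → E) :
    s • f (c.splitSum G) = c.splitSum fun Y l r => s • f (G Y l r) := by
  rw [Chain.map_splitSum, zsmul_splitSum]

theorem sgn_congr {m n : ℤ} (h : Even (m - n)) : sgn m = sgn n := by
  have : m = n + (m - n) := by ring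
  rw [this, sgn_add, sgn, sgn, Int.negOnePow_even _ h]; simp

theorem d_comp (n₁ n₂ : ℤ) (b₂ : Maps N P) (b₁ : Maps M N) :
    d (n₁ + n₂) (comp n₁ b₂ b₁) = sgn n₁ • comp n₁ (d n₂ b₂) b₁ - comp (n₁ + 1) b₂ (d n₁ b₁) := by
  funext X Y c i j
  ext m
  have L1 : (c.splitSum fun Z l r => sgn (i + l.deg) • μMaps P X Z r (i + l.deg + (n₁ + n₂)) j
        (comp n₁ b₂ b₁ Z Y l i (i + l.deg + (n₁ + n₂)) m)) =
      c.splitSum fun Z l r => sgn n₁ • sgn (i + l.deg) • r.splitSum fun W q r =>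
        sgn (i + l.deg + n₁ + q.deg) • μMaps P X W r (i + l.deg + n₁ + q.deg + n₂) j
        (b₂ W Z q (i + l.deg + n₁) (i + l.deg + n₁ + q.deg + n₂)
          (b₁ Z Y l i (i + l.deg + n₁) m)) := by
    simp only [comp_apply, map_splitSum_apply, zsmul_splitSum]
    rw [← Chain.splitSum_assoc]
    refine Chain.splitSum_congr _ _ _ fun W w r h => Chain.splitSum_congr _ _ _ fun Z l q h' => ?_
    rw [map_zsmul, smul_smul, smul_smul, smul_smul,
      mid₂ _ _ _ l q r rfl (show i + w.deg + (n₁ + n₂) = i + l.deg + n₁ + q.deg + n₂ by omega)]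
    congr 1
    rw [← sgn_add, ← sgn_add, ← sgn_add]
    exact sgn_congr ⟨-n₁, by omega⟩
  have L2 : (c.splitSum fun Z l r => sgn (i + l.deg) • comp n₁ b₂ b₁ X Z r (i + l.deg + 1) j
        (μMaps M Z Y l i (i + l.deg + 1) m)) =
      - c.splitSum fun Z w r => sgn (i + w.deg) • b₂ X Z r (i + w.deg + (n₁ + 1)) j
        (w.splitSum fun W l q => sgn (i + l.deg) • b₁ Z W q (i + l.deg + 1) (i + w.deg + (n₁ + 1))
          (μMaps M W Y l i (i + l.deg + 1) m)) := by
    simp only [comp_apply, map_splitSum_apply, zsmul_splitSum]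
    rw [← neg_one_smul ℤ, zsmul_splitSum, ← Chain.splitSum_assoc]
    refine Chain.splitSum_congr _ _ _ fun W w r h => ?_
    rw [zsmul_splitSum]
    refine Chain.splitSum_congr _ _ _ fun Z l q h' => ?_
    rw [map_zsmul, smul_smul, smul_smul, smul_smul,
      mid₂ _ _ _ l q r rfl (show i + l.deg + 1 + q.deg + n₁ = i + w.deg + (n₁ + 1) by omega)]
    congr 1
    rw [← sgn_one, ← sgn_add, ← sgn_add, ← sgn_add]
    exact sgn_congr ⟨0, by omega⟩
  have L3 : (c.splitSum fun _ l w => w.splitSum fun _ q r =>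
        sgn (i + l.deg + q.deg) •
          comp n₁ b₂ b₁ X Y (l.append (.cons (A.μ q (q.deg + 2)) r)) i j m) =
      (c.splitSum fun Z l r => sgn n₁ • sgn (i + l.deg) • r.splitSum fun _ l₂ w =>
        w.splitSum fun _ q r => sgn (i + l.deg + n₁ + l₂.deg + q.deg) •
          b₂ X Z (l₂.append (.cons (A.μ q (q.deg + 2)) r)) (i + l.deg + n₁) j
            (b₁ Z Y l i (i + l.deg + n₁) m)) -
      (c.splitSum fun Z u r => sgn (i + u.deg) • b₂ X Z r (i + u.deg + (n₁ + 1)) j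
        (u.splitSum fun _ l w => w.splitSum fun _ q r =>
          sgn (i + l.deg + q.deg) • b₁ Z Y (l.append (.cons (A.μ q (q.deg + 2)) r)) i
            (i + u.deg + (n₁ + 1)) m)) := by
    simp only [comp_apply, Chain.splitSum_append_cons, smul_add, Chain.splitSum_add]
    rw [sub_eq_add_neg, ← neg_one_smul ℤ]
    congr 1
    · simp only [zsmul_splitSum]
      have hc : ∀ (Z : A.Ob) (u : Chain A.hom Z Y) (w : Chain A.hom X Z),
          (w.splitSum fun _ q r => u.splitSum fun V l l₂ => sgn (i + u.deg + q.deg) •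
            sgn (i + l.deg) • b₂ X V (l₂.append (.cons (A.μ q (q.deg + 2)) r))
              (i + l.deg + n₁) j (b₁ V Y l i (i + l.deg + n₁) m)) =
          u.splitSum fun V l l₂ => w.splitSum fun _ q r => sgn (i + (l.deg + l₂.deg) + q.deg) •
            sgn (i + l.deg) • b₂ X V (l₂.append (.cons (A.μ q (q.deg + 2)) r))
              (i + l.deg + n₁) j (b₁ V Y l i (i + l.deg + n₁) m) := by
        intro Z u w
        rw [Chain.splitSum_comm w u (fun _ q r V l l₂ => sgn (i + u.deg + q.deg) •
            sgn (i + l.deg) • b₂ X V (l₂.append (.cons (A.μ q (q.deg + 2)) r))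
              (i + l.deg + n₁) j (b₁ V Y l i (i + l.deg + n₁) m))]
        refine Chain.splitSum_congr _ _ _ fun V l l₂ h => ?_
        rw [h]
      rw [Chain.splitSum_congr c _ _ fun Z u w _ => hc Z u w]
      rw [Chain.splitSum_assoc]
      refine Chain.splitSum_congr _ _ _ fun Z l w' h => ?_
      refine Chain.splitSum_congr _ _ _ fun V l₂ w h₁ => ?_
      refine Chain.splitSum_congr _ _ _ fun W q r h₂ => ?_
      rw [smul_smul, smul_smul, smul_smul]
      congr 1
      rw [← sgn_add, ← sgn_add, ← sgn_add]
      exact sgn_congr ⟨- n₁, by omega⟩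
    · simp only [map_splitSum_apply, zsmul_splitSum]
      rw [Chain.splitSum_congr c _ _ (fun Z l w _ => (Chain.splitSum_assoc w
        (fun U V q r₁ r₂ => sgn (i + l.deg + q.deg) •
          sgn (i + (l.append (.cons (A.μ q (q.deg + 2)) r₁)).deg) •
          b₂ X U r₂ (i + (l.append (.cons (A.μ q (q.deg + 2)) r₁)).deg + n₁) j
            (b₁ U Y (l.append (.cons (A.μ q (q.deg + 2)) r₁)) i
              (i + (l.append (.cons (A.μ q (q.deg + 2)) r₁)).deg + n₁) m))).symm)]
      rw [← Chain.splitSum_assoc]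
      refine Chain.splitSum_congr _ _ _ fun W u r₂ h => ?_
      refine Chain.splitSum_congr _ _ _ fun Z l w h₁ => ?_
      refine Chain.splitSum_congr _ _ _ fun V q r₁ h₂ => ?_
      have hd : (l.append (.cons (A.μ q (q.deg + 2)) r₁)).deg = u.deg + 1 := by
        rw [Chain.deg_append, Chain.deg]; omega
      rw [mid _ _ _ r₂ (show i + (l.append (.cons (A.μ q (q.deg + 2)) r₁)).deg + n₁ =
        i + u.deg + (n₁ + 1) by omega), map_zsmul, smul_smul, smul_smul, smul_smul, hd]
      congr 1
      rw [← sgn_one, ← sgn_add, ← sgn_add, ← sgn_add]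
      exact sgn_congr ⟨0, by omega⟩
  have R1 : (sgn n₁ • comp n₁ (d n₂ b₂) b₁) X Y c i j m =
      c.splitSum fun Z l r => sgn n₁ • sgn (i + l.deg) •
        d n₂ b₂ X Z r (i + l.deg + n₁) j (b₁ Z Y l i (i + l.deg + n₁) m) := by
    rw [← zsmul_splitSum, ← comp_apply]; rfl
  rw [d_apply, L1, L2, L3]
  change _ = (sgn n₁ • comp n₁ (d n₂ b₂) b₁) X Y c i j m - comp (n₁ + 1) b₂ (d n₁ b₁) X Y c i j m
  rw [R1, comp_apply]
  simp only [d_apply, map_add, smul_add, Chain.splitSum_add]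
  have R3 : (c.splitSum fun Z l r => sgn n₁ • sgn (i + l.deg) • r.splitSum fun W q r =>
        sgn (i + l.deg + n₁ + q.deg) • b₂ X W r (i + l.deg + n₁ + q.deg + 1) j
        (μMaps N W Z q (i + l.deg + n₁) (i + l.deg + n₁ + q.deg + 1)
          (b₁ Z Y l i (i + l.deg + n₁) m))) =
      c.splitSum fun Z w r => sgn (i + w.deg) • b₂ X Z r (i + w.deg + (n₁ + 1)) j
        (w.splitSum fun W l q => sgn (i + l.deg) • μMaps N Z W q (i + l.deg + n₁)
          (i + w.deg + (n₁ + 1)) (b₁ W Y l i (i + l.deg + n₁) m)) := by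
    simp only [map_splitSum_apply, zsmul_splitSum]
    rw [← Chain.splitSum_assoc]
    refine Chain.splitSum_congr _ _ _ fun W w r h => Chain.splitSum_congr _ _ _ fun Z l q h' => ?_
    rw [map_zsmul, smul_smul, smul_smul, smul_smul,
      mid₂ _ _ _ l q r rfl (show i + l.deg + n₁ + q.deg + 1 = i + w.deg + (n₁ + 1) by omega)]
    congr 1
    rw [← sgn_add, ← sgn_add, ← sgn_add]
    exact sgn_congr ⟨n₁, by omega⟩
  rw [R3]
  abel

theorem comp_assoc (b₃ : Maps P Q) (b₂ : Maps N P) (b₁ : Maps M N) :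
    comp 0 (comp 0 b₃ b₂) b₁ = comp 0 b₃ (comp 0 b₂ b₁) := by
  funext X Y c i j
  ext m
  simp only [comp_apply, map_splitSum_apply, zsmul_splitSum]
  rw [← Chain.splitSum_assoc]
  refine Chain.splitSum_congr _ _ _ fun W w r h => Chain.splitSum_congr _ _ _ fun Z l q h' => ?_
  rw [map_zsmul, smul_smul, smul_smul,
    mid₂ _ _ _ l q r rfl (show i + l.deg + 0 + q.deg + 0 = i + w.deg + 0 by omega)]
  congr 1
  rw [← sgn_add, ← sgn_add]
  exact sgn_congr ⟨0, by omega⟩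

theorem comp_add (n : ℤ) (b₂ : Maps N P) (b b' : Maps M N) :
    comp n b₂ (b + b') = comp n b₂ b + comp n b₂ b' := by
  funext X Y c i j
  ext m
  simp [comp_apply, Chain.splitSum_add]

theorem add_comp (n : ℤ) (b b' : Maps N P) (b₁ : Maps M N) :
    comp n (b + b') b₁ = comp n b b₁ + comp n b' b₁ := by
  funext X Y c i j
  ext m
  simp [comp_apply, Chain.splitSum_add]

theorem smul_comp (n : ℤ) (f : K) (b : Maps N P) (b₁ : Maps M N) :
    comp n (f • b) b₁ = f • comp n b b₁ := by
  funext X Y c i j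
  ext m
  simp only [comp_apply, Pi.smul_apply, AddMonoidHom.smul_apply, smul_comm _ f, splitSum_smul]

theorem zero_comp (n : ℤ) (b₁ : Maps M N) : comp n (0 : Maps N P) b₁ = 0 := by
  simpa using smul_comp n (0 : K) (0 : Maps N P) b₁

theorem comp_zero (n : ℤ) (b₂ : Maps N P) : comp n b₂ (0 : Maps M N) = 0 := by
  have := comp_add n b₂ (0 : Maps M N) 0
  simpa using this

/-- `b` is a degree `n` element of the morphism space from `M` to `N` in the (strictly unital)
`A_∞`-category of families of modules: `K`-linear, multilinear, of degree `n`, and zero whenever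
one of its entries is an identity element. -/
structure IsHom (n : ℤ) (b : Maps M N) : Prop where
  smul : ∀ (X Y : A.Ob) (c : Chain A.hom X Y) (i j : ℤ) (f : K) (m : M.obj Y i),
    b X Y c i j (f • m) = f • b X Y c i j m
  deg : ∀ (X Y : A.Ob) (c : Chain A.hom X Y) (i j : ℤ), j ≠ i + c.deg + n → b X Y c i j = 0
  multilinear : ∀ (X Y : A.Ob) (i j : ℤ),
    IsMultilinear k K fun c : Chain A.hom X Y => b X Y c i j
  unital : ∀ (X Y Z : A.Ob) (p : Chain A.hom Y Z) (q : Chain A.hom X Y) (i j : ℤ),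
    b X Z (p.append (.cons (A.e Y) q)) i j = 0

/-- The degree `n` part of the morphism complex from `M` to `N`. -/
def homDeg (M N : PreMod A K) (n : ℤ) : Submodule K (Maps M N) where
  carrier := {b | IsHom n b}
  add_mem' {a b} ha hb :=
    { smul := fun X Y c i j f m => by simp [ha.smul, hb.smul]
      deg := fun X Y c i j h => by simp [ha.deg X Y c i j h, hb.deg X Y c i j h]
      multilinear := fun X Y i j =>
        { map_add := fun p x y q => by
            simp only [Pi.add_apply, (ha.multilinear X Y i j).map_add,
              (hb.multilinear X Y i j).map_add]
            abel
          map_smul := fun p t x q => by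
            simp only [Pi.add_apply, (ha.multilinear X Y i j).map_smul,
              (hb.multilinear X Y i j).map_smul, smul_add] }
      unital := fun X Y Z p q i j => by simp [ha.unital, hb.unital] }
  zero_mem' :=
    { smul := fun X Y c i j f m => by simp
      deg := fun X Y c i j h => rfl
      multilinear := fun X Y i j =>
        { map_add := fun p x y q => by simp
          map_smul := fun p t x q => by simp }
      unital := fun X Y Z p q i j => rfl }
  smul_mem' f b hb :=
    { smul := fun X Y c i j g m => by
        simp only [Pi.smul_apply, AddMonoidHom.smul_apply, hb.smul]
        rw [smul_comm]
      deg := fun X Y c i j h => by simp [hb.deg X Y c i j h]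
      multilinear := fun X Y i j =>
        { map_add := fun p x y q => by
            simp only [Pi.smul_apply, (hb.multilinear X Y i j).map_add, smul_add]
          map_smul := fun p t x q => by
            simp only [Pi.smul_apply, (hb.multilinear X Y i j).map_smul]
            rw [smul_comm] }
      unital := fun X Y Z p q i j => by simp [hb.unital] }

theorem comp_aux (b₂ : Maps N P) (b₁ : Maps M N) {X Y V W : A.Ob} {n : ℤ}
    (p : Chain A.hom W Y) (x z : A.hom V W n) (q : Chain A.hom X V) (n₁ i j : ℤ) (m : M.obj Y i) :
    (q.splitSum fun U l r => sgn (i + (p.append (.cons x l)).deg) •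
      b₂ X U r (i + (p.append (.cons x l)).deg + n₁) j
        (b₁ U Y (p.append (.cons z l)) i (i + (p.append (.cons x l)).deg + n₁) m)) =
    q.splitSum fun U l r => sgn (i + (p.append (.cons z l)).deg) •
      b₂ X U r (i + (p.append (.cons z l)).deg + n₁) j
        (b₁ U Y (p.append (.cons z l)) i (i + (p.append (.cons z l)).deg + n₁) m) := by
  refine Chain.splitSum_congr _ _ _ fun U l r _ => ?_
  have h : (p.append (.cons x l)).deg = (p.append (.cons z l)).deg := by
    simp only [Chain.deg_append, Chain.deg]
  rw [mid b₂ b₁ (p.append (.cons z l)) r (show i + (p.append (.cons x l)).deg + n₁ =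
    i + (p.append (.cons z l)).deg + n₁ by rw [h]), h]

theorem IsHom.comp {n₁ n₂ : ℤ} {b₂ : Maps N P} {b₁ : Maps M N} (h₂ : IsHom n₂ b₂)
    (h₁ : IsHom n₁ b₁) : IsHom (n₁ + n₂) (comp n₁ b₂ b₁) where
  smul X Y c i j f m := by
    simp only [comp_apply, h₁.smul, h₂.smul, smul_comm _ f, splitSum_smul]
  deg X Y c i j h := by
    ext m
    rw [comp_apply, Chain.splitSum_congr c _ (fun _ _ _ => 0), Chain.splitSum_zero]
    · rfl
    intro Z l r hlr
    rw [h₂.deg X Z r (i + l.deg + n₁) j (by omega)]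
    simp
  multilinear X Y i j :=
    { map_add := fun {V W n} p x y q => by
        ext m
        simp only [comp_apply, AddMonoidHom.add_apply, Chain.splitSum_append_cons,
          (h₂.multilinear _ _ _ _).map_add, (h₁.multilinear _ _ _ _).map_add, smul_add, map_add,
          Chain.splitSum_add]
        rw [comp_aux b₂ b₁ p (x + y) x, comp_aux b₂ b₁ p (x + y) y]
        abel
      map_smul := fun {V W n} p t x q => by
        ext m
        simp only [comp_apply, AddMonoidHom.smul_apply, Chain.splitSum_append_cons,
          (h₂.multilinear _ _ _ _).map_smul, (h₁.multilinear _ _ _ _).map_smul, smul_add,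
          h₂.smul, smul_comm _ (algebraMap k K t), splitSum_smul]
        rw [comp_aux b₂ b₁ p (t • x) x] }
  unital X Y Z p q i j := by
    ext m
    simp [comp_apply, Chain.splitSum_append_cons, h₂.unital, h₁.unital, Chain.splitSum_zero]

/-- The identity endomorphism `m ↦ (-1)^{|m|} m` of a module. -/
def one (M : PreMod A K) : Maps M M
  | _, _, .nil _, i, j => if h : i = j then h ▸ (sgn i • AddMonoidHom.id _) else 0
  | _, _, .cons _ _, _, _ => 0

theorem one_nil (M : PreMod A K) (X : A.Ob) (i : ℤ) (m : M.obj X i) :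
    one M X X (.nil X) i i m = sgn i • m := by
  simp [one]

theorem one_nil_ne (M : PreMod A K) (X : A.Ob) {i j : ℤ} (h : i ≠ j) :
    one M X X (.nil X) i j = 0 := by
  simp [one, h]

theorem one_of_pos (M : PreMod A K) {X Y : A.Ob} (c : Chain A.hom X Y) (h : 0 < c.length)
    (i j : ℤ) : one M X Y c i j = 0 := by
  cases c with
  | nil => simp [Chain.length] at h
  | cons a c => rfl

theorem length_append_cons {X Y Z W : A.Ob} {n : ℤ} (p : Chain A.hom Z W) (a : A.hom Y Z n)
    (q : Chain A.hom X Y) : 0 < (p.append (.cons a q)).length := by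
  cases p <;> simp [Chain.append, Chain.length]

theorem isHom_one (M : PreMod A K) : IsHom 0 (one M) where
  smul X Y c i j f m := by
    cases c with
    | nil =>
      by_cases h : i = j
      · subst h
        rw [one_nil, one_nil, smul_comm]
      · rw [one_nil_ne _ _ h]; simp
    | cons a c => simp [one]
  deg X Y c i j h := by
    cases c with
    | nil => exact one_nil_ne _ _ (by simp only [Chain.deg] at h; omega)
    | cons a c => rfl
  multilinear X Y i j :=
    { map_add := fun p x y q => by simp [one_of_pos, length_append_cons]
      map_smul := fun p t x q => by simp [one_of_pos, length_append_cons] }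
  unital X Y Z p q i j := one_of_pos _ _ (length_append_cons _ _ _) _ _

theorem comp_one (b : Maps M N) : comp 0 b (one M) = b := by
  funext X Y c i j
  ext m
  rw [comp_apply, Chain.splitSum_nil_left]
  · rw [mid b (one M) (.nil Y) c (show i + (Chain.nil Y : Chain A.hom Y Y).deg + 0 = i by
      simp [Chain.deg]), one_nil, map_zsmul, smul_smul]
    simp [Chain.deg, sgn_mul_self]
  · intro Z l r h
    rw [one_of_pos _ _ h]
    simp

theorem one_comp {b : Maps M N} (hb : IsHom 0 b) : comp 0 (one N) b = b := by
  funext X Y c i j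
  ext m
  rw [comp_apply, Chain.splitSum_nil_right]
  · by_cases h : j = i + c.deg
    · subst h
      rw [mid (one N) b c (.nil X) (show i + c.deg + 0 = i + c.deg by simp), one_nil, smul_smul,
        sgn_mul_self, one_smul]
    · rw [hb.deg X Y c i j (by omega), one_nil_ne _ _ (by omega)]
      simp
  · intro Z l r h
    rw [one_of_pos _ _ h]
    simp

theorem d_one (M : PreMod A K) : d 0 (one M) = 0 := by
  funext X Y c i j
  ext m
  rw [d_apply, Chain.splitSum_nil_left c, Chain.splitSum_nil_right c]
  · rw [mid _ (one M) (.nil Y) c (show i + (Chain.nil Y : Chain A.hom Y Y).deg + 0 = i by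
      simp [Chain.deg]), one_nil]
    have h3 : (c.splitSum fun _ l w => w.splitSum fun _ q r =>
        sgn (i + l.deg + q.deg) •
          one M X Y (l.append (.cons (A.μ q (q.deg + 2)) r)) i j m) = 0 := by
      simp [one_of_pos, length_append_cons, Chain.splitSum_zero]
    rw [h3]
    by_cases h : j = i + c.deg + 1
    · subst h
      rw [one_nil, map_zsmul, smul_smul, smul_smul]
      have h1 : sgn (i + c.deg) * sgn (i + c.deg + 1) = -1 := by
        rw [sgn_add (i + c.deg) 1, ← mul_assoc, sgn_mul_self, sgn_one, one_mul]
      rw [h1]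
      simp [Chain.deg, sgn_mul_self]
    · rw [one_nil_ne _ _ (fun h' => h h'.symm)]
      have : μMaps M X Y c i j = 0 := by
        simp only [μMaps, M.μ_deg c i j h]; rfl
      simp [this]
  · intro Z l r h
    rw [one_of_pos _ _ h]
    simp
  · intro Z l r h
    rw [one_of_pos _ _ h]
    simp

/-- Degree zero cocycles of the morphism complex. -/
def cocycles (M N : PreMod A K) : Submodule K (Maps M N) := homDeg M N 0 ⊓ LinearMap.ker (d 0)

/-- Degree zero coboundaries of the morphism complex. -/
def coboundaries (M N : PreMod A K) : Submodule K (Maps M N) := (homDeg M N (-1)).map (d (-1))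

/-- Degree zero cohomology of the morphism complex. -/
abbrev H0 (M N : PreMod A K) : Type u :=
  cocycles M N ⧸ (coboundaries M N).submoduleOf (cocycles M N)

theorem comp_mem_cocycles {b₂ : Maps N P} {b₁ : Maps M N} (h₂ : b₂ ∈ cocycles N P)
    (h₁ : b₁ ∈ cocycles M N) : comp 0 b₂ b₁ ∈ cocycles M P := by
  refine ⟨by simpa only [add_zero] using! IsHom.comp h₂.1 h₁.1, ?_⟩
  have h := d_comp 0 0 b₂ b₁
  rw [LinearMap.mem_ker.1 h₂.2, LinearMap.mem_ker.1 h₁.2, comp_zero, zero_comp] at h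
  refine LinearMap.mem_ker.2 ?_
  simpa using h

theorem comp_mem_coboundaries_left {b₂ : Maps N P} {b₁ : Maps M N} (h₂ : b₂ ∈ coboundaries N P)
    (h₁ : b₁ ∈ cocycles M N) : comp 0 b₂ b₁ ∈ coboundaries M P := by
  obtain ⟨c, hc, rfl⟩ := h₂
  refine ⟨comp 0 c b₁, by simpa using! IsHom.comp hc h₁.1, ?_⟩
  have h := d_comp 0 (-1) c b₁
  rw [LinearMap.mem_ker.1 h₁.2, comp_zero] at h
  simpa [sgn_zero] using h

theorem comp_mem_coboundaries_right {b₂ : Maps N P} {b₁ : Maps M N} (h₂ : b₂ ∈ cocycles N P)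
    (h₁ : b₁ ∈ coboundaries M N) : comp 0 b₂ b₁ ∈ coboundaries M P := by
  obtain ⟨c, hc, rfl⟩ := h₁
  refine ⟨-comp (-1) b₂ c, neg_mem (by simpa using! IsHom.comp h₂.1 hc), ?_⟩
  have h := d_comp (-1) 0 b₂ c
  rw [LinearMap.mem_ker.1 h₂.2, zero_comp] at h
  simpa using congrArg Neg.neg h

/-- Composition on the level of cocycles. -/
def compCocycles (M N P : PreMod A K) :
    cocycles N P →ₗ[K] cocycles M N →ₗ[K] cocycles M P :=
  LinearMap.mk₂ K (fun b₂ b₁ => ⟨comp 0 b₂.1 b₁.1, comp_mem_cocycles b₂.2 b₁.2⟩)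
    (fun _ _ _ => Subtype.ext (add_comp 0 _ _ _))
    (fun _ _ _ => Subtype.ext (smul_comp 0 _ _ _))
    (fun _ _ _ => Subtype.ext (comp_add 0 _ _ _))
    (fun f b₂ b₁ => Subtype.ext (by
      funext X Y c i j
      ext m
      change comp 0 b₂.1 (f • b₁.1) X Y c i j m = f • comp 0 b₂.1 b₁.1 X Y c i j m
      simp only [comp_apply, Pi.smul_apply, AddMonoidHom.smul_apply, b₂.2.1.smul, smul_comm _ f,
        splitSum_smul]))

/-- Composition on the level of cohomology. -/
def compH (M N P : PreMod A K) : H0 N P →ₗ[K] H0 M N →ₗ[K] H0 M P :=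
  LinearMap.flip <| Submodule.liftQ ((coboundaries M N).submoduleOf (cocycles M N))
    (LinearMap.flip <| Submodule.liftQ ((coboundaries N P).submoduleOf (cocycles N P))
      ((compCocycles M N P).compr₂
        (Submodule.mkQ ((coboundaries M P).submoduleOf (cocycles M P))))
      (fun b₂ h₂ => LinearMap.ext fun b₁ =>
        (Submodule.Quotient.mk_eq_zero _).2 (comp_mem_coboundaries_left h₂ b₁.2)))
    (fun b₁ h₁ => by
      refine LinearMap.mem_ker.2 (LinearMap.ext fun x => ?_)
      induction x using Submodule.Quotient.induction_on with
      | H b₂ =>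
        exact (Submodule.Quotient.mk_eq_zero _).2 (comp_mem_coboundaries_right b₂.2 h₁))

end Maps

namespace PreMod
open CategoryTheory

/-- The cohomological category `H⁰` of modules over `A` with base ring `K`. Two families are
quasi-isomorphic if they are isomorphic in this category. -/
instance : Category.{u} (PreMod A K) where
  Hom M N := Maps.H0 M N
  id M := Submodule.Quotient.mk ⟨Maps.one M, Maps.isHom_one M, Maps.d_one M⟩
  comp {M N P} f g := Maps.compH M N P g f
  id_comp {M N} f := by
    induction f using Submodule.Quotient.induction_on with
    | H b =>
      exact congrArg (Submodule.mkQ ((Maps.coboundaries M N).submoduleOf (Maps.cocycles M N)))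
        (Subtype.ext (Maps.comp_one b.1))
  comp_id {M N} f := by
    induction f using Submodule.Quotient.induction_on with
    | H b =>
      exact congrArg (Submodule.mkQ ((Maps.coboundaries M N).submoduleOf (Maps.cocycles M N)))
        (Subtype.ext (Maps.one_comp b.2.1))
  assoc {M N P Q} f g h := by
    induction f using Submodule.Quotient.induction_on with
    | H b₁ =>
    induction g using Submodule.Quotient.induction_on with
    | H b₂ =>
    induction h using Submodule.Quotient.induction_on with
    | H b₃ =>
    exact congrArg (Submodule.mkQ ((Maps.coboundaries M Q).submoduleOf (Maps.cocycles M Q)))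
      (Subtype.ext (Maps.comp_assoc b₃.1 b₂.1 b₁.1).symm)

instance : Preadditive (PreMod A K) where
  homGroup M N := inferInstanceAs (AddCommGroup (Maps.H0 M N))
  add_comp M N P f f' g := (Maps.compH M N P g).map_add f f'
  comp_add M N P f g g' :=
    congrArg (fun φ : Maps.H0 M N →ₗ[K] Maps.H0 M P => φ f) ((Maps.compH M N P).map_add g g')

instance : Linear K (PreMod A K) where
  homModule M N := inferInstanceAs (Module K (Maps.H0 M N))
  smul_comp M N P r f g := (Maps.compH M N P g).map_smul r f
  comp_smul M N P f r g :=
    congrArg (fun φ : Maps.H0 M N →ₗ[K] Maps.H0 M P => φ f) ((Maps.compH M N P).map_smul r g)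

/-- The class in `H⁰` of a cocycle. -/
def toHom (M N : PreMod A K) : Maps.cocycles M N →ₗ[K] (M ⟶ N) :=
  Submodule.mkQ ((Maps.coboundaries M N).submoduleOf (Maps.cocycles M N))

end PreMod
section Tensor

variable (L : Type u) [CommRing L] [Algebra k L] [Algebra K L] [IsScalarTower k K L]
  (P : Type u) [AddCommGroup P] [Module K P] [Module L P] [IsScalarTower K L P]

theorem lTensor_smul {V W : Type u} [AddCommGroup V] [AddCommGroup W] [Module K V] [Module K W]
    (t : k) (f : V →ₗ[K] W) :
    TensorProduct.AlgebraTensorModule.lTensor L P (algebraMap k K t • f) =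
      algebraMap k L t • TensorProduct.AlgebraTensorModule.lTensor L P f := by
  rw [map_smul, IsScalarTower.algebraMap_apply k K L, algebraMap_smul L (algebraMap k K t)]

/-- The module `P ⊗ M`, with `P` concentrated in degree zero, and base ring `L`. Used for the
fibre at a point (`P = L = k`) and for `Ω ⊗ M` (`L = K`). -/
abbrev PreMod.tensor (M : PreMod A K) : PreMod A L where
  obj X i := P ⊗[K] M.obj X i
  μ c i j := TensorProduct.AlgebraTensorModule.lTensor L P (M.μ c i j)
  μ_multilinear X Y i j :=
    { map_add := fun p a b q => by rw [(M.μ_multilinear X Y i j).map_add, map_add]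
      map_smul := fun p t a q => by
        rw [(M.μ_multilinear X Y i j).map_smul, lTensor_smul] }
  μ_deg c i j h := by rw [M.μ_deg c i j h, map_zero]

namespace Maps

/-- The `K`-linear maps which make up `b`. -/
def toLin {M N : PreMod A K} {n : ℤ} {b : Maps M N} (hb : IsHom n b) {X Y : A.Ob}
    (c : Chain A.hom X Y) (i j : ℤ) : M.obj Y i →ₗ[K] N.obj X j where
  toFun := b X Y c i j
  map_add' := map_add _
  map_smul' := hb.smul X Y c i j

/-- The map `id_P ⊗ b`. -/
def tensorMap {M N : PreMod A K} {n : ℤ} {b : Maps M N} (hb : IsHom n b) :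
    Maps (M.tensor L P) (N.tensor L P) := fun _ _ c i j =>
  (TensorProduct.AlgebraTensorModule.lTensor L P (toLin hb c i j)).toAddMonoidHom

theorem tensorMap_tmul {M N : PreMod A K} {n : ℤ} {b : Maps M N} (hb : IsHom n b) {X Y : A.Ob}
    (c : Chain A.hom X Y) (i j : ℤ) (p : P) (m : M.obj Y i) :
    tensorMap L P hb X Y c i j (p ⊗ₜ[K] m) = p ⊗ₜ[K] b X Y c i j m := rfl

theorem tensor_ext {M : PreMod A K} {N : PreMod A L} {b b' : Maps (M.tensor L P) N}
    (h : ∀ (X Y : A.Ob) (c : Chain A.hom X Y) (i j : ℤ) (p : P) (m : M.obj Y i),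
      b X Y c i j (p ⊗ₜ[K] m) = b' X Y c i j (p ⊗ₜ[K] m)) : b = b' := by
  funext X Y c i j
  ext x
  induction x using TensorProduct.induction_on with
  | zero => simp only [map_zero]
  | tmul p m => exact h X Y c i j p m
  | add x y hx hy => simp only [map_add, hx, hy]

theorem isHom_tensorMap {M N : PreMod A K} {n : ℤ} {b : Maps M N} (hb : IsHom n b) :
    IsHom n (tensorMap L P hb) where
  smul X Y c i j f m := map_smul (TensorProduct.AlgebraTensorModule.lTensor L P _) f m
  deg X Y c i j h := by
    have : toLin hb c i j = 0 := LinearMap.ext fun m => by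
      change b X Y c i j m = 0
      rw [hb.deg X Y c i j h]; rfl
    simp only [tensorMap, this, map_zero]; rfl
  multilinear X Y i j :=
    { map_add := fun p x y q => by
        have : toLin hb (p.append (.cons (x + y) q)) i j =
            toLin hb (p.append (.cons x q)) i j + toLin hb (p.append (.cons y q)) i j :=
          LinearMap.ext fun m => DFunLike.congr_fun ((hb.multilinear X Y i j).map_add p x y q) m
        simp only [tensorMap, this, map_add]; rfl
      map_smul := fun p t x q => by
        have : toLin hb (p.append (.cons (t • x) q)) i j =
            algebraMap k K t • toLin hb (p.append (.cons x q)) i j :=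
          LinearMap.ext fun m => DFunLike.congr_fun ((hb.multilinear X Y i j).map_smul p t x q) m
        simp only [tensorMap, this, lTensor_smul]; rfl }
  unital X Y Z p q i j := by
    have : toLin hb (p.append (.cons (A.e Y) q)) i j = 0 := LinearMap.ext fun m =>
      DFunLike.congr_fun (hb.unital X Y Z p q i j) m
    simp only [tensorMap, this, map_zero]; rfl

theorem d_tensorMap_tmul {M N : PreMod A K} {n : ℤ} {b : Maps M N} (hb : IsHom n b) {X Y : A.Ob}
    (c : Chain A.hom X Y) (i j : ℤ) (p : P) (m : M.obj Y i) :
    d n (tensorMap L P hb) X Y c i j (p ⊗ₜ[K] m) = p ⊗ₜ[K] d n b X Y c i j m := by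
  have hm : ∀ x : N.obj X j, p ⊗ₜ[K] x = (TensorProduct.mk K P (N.obj X j) p).toAddMonoidHom x :=
    fun x => rfl
  rw [d_apply, d_apply, hm, map_add, map_add]
  simp only [Chain.map_splitSum, map_zsmul]
  rfl

end Maps

end Tensor

section Fibre

variable (s : K →ₐ[k] k)

/-- The fibre `k ⊗_K M` of a family at a point `s` of the base. -/
def PreMod.fibre (M : PreMod A K) : PreMod A k :=
  letI : Algebra K k := s.toRingHom.toAlgebra
  haveI : IsScalarTower k K k := IsScalarTower.of_algebraMap_eq fun x => (s.commutes x).symm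
  M.tensor k k

namespace Maps

/-- The fibre of a morphism at the point `s`. -/
def fibre {M N : PreMod A K} {n : ℤ} {b : Maps M N} (hb : IsHom n b) :
    Maps (M.fibre s) (N.fibre s) :=
  letI : Algebra K k := s.toRingHom.toAlgebra
  haveI : IsScalarTower k K k := IsScalarTower.of_algebraMap_eq fun x => (s.commutes x).symm
  tensorMap k k hb

theorem isHom_fibre {M N : PreMod A K} {n : ℤ} {b : Maps M N} (hb : IsHom n b) :
    IsHom n (fibre s hb) :=
  letI : Algebra K k := s.toRingHom.toAlgebra
  haveI : IsScalarTower k K k := IsScalarTower.of_algebraMap_eq fun x => (s.commutes x).symm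
  isHom_tensorMap k k hb

theorem fibre_mem_cocycles {M N : PreMod A K} {b : Maps M N} (hb : b ∈ cocycles M N) :
    fibre s hb.1 ∈ cocycles (M.fibre s) (N.fibre s) := by
  letI : Algebra K k := s.toRingHom.toAlgebra
  haveI : IsScalarTower k K k := IsScalarTower.of_algebraMap_eq fun x => (s.commutes x).symm
  refine ⟨isHom_fibre s hb.1, LinearMap.mem_ker.2 ?_⟩
  refine tensor_ext k k fun X Y c i j p m => ?_
  refine (d_tensorMap_tmul k k hb.1 c i j p m).trans ?_
  rw [LinearMap.mem_ker.1 hb.2]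
  exact TensorProduct.tmul_zero _ _

theorem fibre_mem_coboundaries {M N : PreMod A K} {b : Maps M N} (hb : IsHom 0 b)
    (h : b ∈ coboundaries M N) : fibre s hb ∈ coboundaries (M.fibre s) (N.fibre s) := by
  letI : Algebra K k := s.toRingHom.toAlgebra
  haveI : IsScalarTower k K k := IsScalarTower.of_algebraMap_eq fun x => (s.commutes x).symm
  obtain ⟨c, hc, rfl⟩ := h
  refine ⟨fibre s hc, isHom_fibre s hc, ?_⟩
  exact tensor_ext k k fun X Y c' i j p m => d_tensorMap_tmul k k hc c' i j p m

/-- Passage to the fibre at `s`, on cocycles. -/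
def fibreCocycles (M N : PreMod A K) :
    cocycles M N →ₛₗ[s.toRingHom] cocycles (M.fibre s) (N.fibre s) where
  toFun b := ⟨fibre s b.2.1, fibre_mem_cocycles s b.2⟩
  map_add' a b := by
    letI : Algebra K k := s.toRingHom.toAlgebra
    haveI : IsScalarTower k K k := IsScalarTower.of_algebraMap_eq fun x => (s.commutes x).symm
    exact Subtype.ext (tensor_ext k k fun X Y c i j p m => TensorProduct.tmul_add _ _ _)
  map_smul' f b := by
    letI : Algebra K k := s.toRingHom.toAlgebra
    haveI : IsScalarTower k K k := IsScalarTower.of_algebraMap_eq fun x => (s.commutes x).symm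
    refine Subtype.ext (tensor_ext k k fun X Y c i j p m => ?_)
    change p ⊗ₜ[K] (f • b.1 X Y c i j m) = s f • (p ⊗ₜ[K] b.1 X Y c i j m)
    rw [← TensorProduct.smul_tmul]
    rfl

end Maps

namespace PreMod
open CategoryTheory

/-- Passage to the fibre at `s`, on the morphisms of the cohomological category. -/
def fibreMap (M N : PreMod A K) : (M ⟶ N) →ₛₗ[s.toRingHom] (M.fibre s ⟶ N.fibre s) :=
  Submodule.mapQ ((Maps.coboundaries M N).submoduleOf (Maps.cocycles M N))
    ((Maps.coboundaries (M.fibre s) (N.fibre s)).submoduleOf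
      (Maps.cocycles (M.fibre s) (N.fibre s)))
    (Maps.fibreCocycles s M N) fun b hb => Maps.fibre_mem_coboundaries s b.2.1 hb

end PreMod

end Fibre

namespace AInfCat

/-- The linear map `a ↦ μ(l, a, r)`. -/
def slot (A : AInfCat k) {X Y Z W : A.Ob} (l : Chain A.hom Z Y) (r : Chain A.hom X W) (m n : ℤ) :
    A.hom W Z m →ₗ[k] A.hom X Y n where
  toFun a := A.μ (l.append (.cons a r)) n
  map_add' a b := (A.μ_multilinear X Y n).map_add l a b r
  map_smul' t a := (A.μ_multilinear X Y n).map_smul l t a r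

end AInfCat

variable (A K) in
/-- A cocycle `γ ∈ CC¹(𝒜, Ω ⊗ 𝒜)` of the (reduced) Hochschild complex, representing a deformation
field. Here `𝒜 = K ⊗ A` is the constant family with fibre `A`, so that the coefficients are
`Ω[K⁄k] ⊗_K (K ⊗_k hom) = Ω[K⁄k] ⊗_k hom`. -/
structure DeformationCocycle where
  γ : ∀ {X Y : A.Ob}, Chain A.hom X Y → ∀ n : ℤ, Ω[K⁄k] ⊗[k] A.hom X Y n
  γ_multilinear : ∀ (X Y : A.Ob) (n : ℤ), IsMultilinear k K fun c : Chain A.hom X Y => γ c n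
  /-- `γ^d` has degree `1 - d`. -/
  γ_deg : ∀ {X Y : A.Ob} (c : Chain A.hom X Y) (n : ℤ), n ≠ c.deg + 1 → γ c n = 0
  /-- `γ^d` vanishes if one of its entries is an identity element. -/
  γ_e : ∀ {X Y Z : A.Ob} (p : Chain A.hom Y Z) (q : Chain A.hom X Y) (n : ℤ),
    γ (p.append (.cons (A.e Y) q)) n = 0
  /-- The Hochschild differential `∑ μ(l, γ(q), r) - ∑ ± γ(l, μ(q), r)` vanishes (`γ` has reduced degree zero). -/
  closed : ∀ {X Y : A.Ob} (c : Chain A.hom X Y) (n : ℤ),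
    (c.splitSum fun _ l w => w.splitSum fun _ q r =>
      (A.slot l r (q.deg + 1) n).lTensor Ω[K⁄k] (γ q (q.deg + 1)) -
        sgn r.deg • γ (l.append (.cons (A.μ q (q.deg + 2)) r)) n) = 0

/-- The family `Ω ⊗ M`. -/
abbrev PreMod.omega (M : PreMod A K) : PreMod A K := M.tensor K Ω[K⁄k]

namespace Maps
variable {M N : PreMod A K}

/-- The sequence of maps `ω ⊗ b`. -/
def omegaMul (ω : Ω[K⁄k]) (b : Maps M N) : Maps M N.omega := fun X _ c i j =>
  (TensorProduct.mk K Ω[K⁄k] (N.obj X j) ω).toAddMonoidHom.comp (b _ _ c i j)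

/-- The additive map taking `ω ⊗ a` to `ω ⊗ b(·, l, a, r)`. -/
def plug (b : Maps M N)
    (hb : ∀ X Y i j, IsMultilinear k K fun c : Chain A.hom X Y => b X Y c i j)
    {X Y Z W : A.Ob} (l : Chain A.hom Z Y) (r : Chain A.hom X W) (n i j : ℤ) :
    Ω[K⁄k] ⊗[k] A.hom W Z n →+ (M.obj Y i →+ N.omega.obj X j) :=
  TensorProduct.liftAddHom
    { toFun := fun ω =>
        { toFun := fun a => omegaMul ω b X Y (l.append (.cons a r)) i j
          map_zero' := by
            have := (hb X Y i j).map_smul l 0 (0 : A.hom W Z n) r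
            simp only [zero_smul, map_zero] at this
            simp [omegaMul, this]
          map_add' := fun x y => by
            simp only [omegaMul, (hb X Y i j).map_add l x y r]
            ext m
            simp [TensorProduct.tmul_add] }
      map_zero' := by ext a m; simp [omegaMul]
      map_add' := fun x y => by ext a m; simp [omegaMul] }
    (fun t ω a => by
      ext m
      have := DFunLike.congr_fun ((hb X Y i j).map_smul l t a r) m
      simp only [AddMonoidHom.smul_apply] at this
      simp only [AddMonoidHom.coe_mk, ZeroHom.coe_mk, omegaMul, AddMonoidHom.comp_apply, this]
      rw [← algebraMap_smul K t ω]
      exact TensorProduct.smul_tmul _ _ _)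

/-- `(m, a_{d-1}, …, a_1) ↦ - ∑ b(m, l, γ(q), r)`, summed over `(a_{d-1}, …, a_1) = l · q · r`. -/
def contract (γ : DeformationCocycle A K) (b : Maps M N)
    (hb : ∀ X Y i j, IsMultilinear k K fun c : Chain A.hom X Y => b X Y c i j) :
    Maps M N.omega := fun _ _ c i j =>
  -(c.splitSum fun _ l w => w.splitSum fun _ q r =>
    plug b hb l r (q.deg + 1) i j (γ.γ q (q.deg + 1)))

/-- The constant term of the Hochschild cochain on the category of modules induced by `γ`, an element
of the morphism complex from `M` to `Ω ⊗ M` of degree one. -/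
def γmod₀ (γ : DeformationCocycle A K) (M : PreMod A K) : Maps M M.omega :=
  contract γ (μMaps M) fun X Y i j =>
    { map_add := fun p x y q => by
        simp only [μMaps, (M.μ_multilinear X Y i j).map_add]; rfl
      map_smul := fun p t x q => by
        simp only [μMaps, (M.μ_multilinear X Y i j).map_smul]; rfl }

/-- The linear term of the Hochschild cochain on the category of modules induced by `γ`, applied
to `b`. -/
def γmod₁ (γ : DeformationCocycle A K) {n : ℤ} {b : Maps M N} (hb : IsHom n b) : Maps M N.omega :=
  contract γ b hb.multilinear

/-- `D` is a pre-connection on `M`: the maps `m ↦ (-1)^{|m|} D¹(m)` are connections on the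
`K`-modules `M(X)`, and the higher order terms `D^d`, of degree `1 - d`, are `K`-linear. -/
structure IsPreConnection (D : Maps M M.omega) : Prop where
  leibniz : ∀ (X : A.Ob) (i : ℤ) (f : K) (m : M.obj X i),
    sgn i • D X X (.nil X) i i (f • m) =
      KaehlerDifferential.D k K f ⊗ₜ[K] m + f • (sgn i • D X X (.nil X) i i m)
  smul : ∀ (X Y : A.Ob) (c : Chain A.hom X Y), 0 < c.length → ∀ (i j : ℤ) (f : K) (m : M.obj Y i),
    D X Y c i j (f • m) = f • D X Y c i j m
  deg : ∀ (X Y : A.Ob) (c : Chain A.hom X Y) (i j : ℤ), j ≠ i + c.deg → D X Y c i j = 0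
  multilinear : ∀ (X Y : A.Ob) (i j : ℤ),
    IsMultilinear k K fun c : Chain A.hom X Y => D X Y c i j
  unital : ∀ (X Y Z : A.Ob) (p : Chain A.hom Y Z) (q : Chain A.hom X Y) (i j : ℤ),
    D X Z (p.append (.cons (A.e Y) q)) i j = 0

/-- A relative connection: a pre-connection whose deformation cocycle `μ¹(D)` is equal to the
cocycle induced by `γ`. The family `M` follows the deformation field `[γ]`, which means that the
cohomology classes agree, if and only if it admits a relative connection. -/
structure IsRelativeConnection (γ : DeformationCocycle A K) (D : Maps M M.omega) : Prop
    extends IsPreConnection D where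
  d_eq : d 0 D = γmod₀ γ M

/-- The connection induced by relative connections on the morphism complex,
`b ↦ (-1)^{|b|} μ²(D₁, b) - μ²(id_Ω ⊗ b, D₀) + γ^{mod,1}(b)`. -/
def inducedConnection (γ : DeformationCocycle A K) (D₀ : Maps M M.omega) (D₁ : Maps N N.omega)
    {n : ℤ} {b : Maps M N} (hb : IsHom n b) : Maps M N.omega :=
  sgn n • comp n D₁ b - comp 0 (tensorMap K Ω[K⁄k] hb) D₀ + γmod₁ γ hb

end Maps

/-- `M` is a strictly unital `A_∞`-module: the equations
`∑ ± μ(μ(m, l), r) + ∑ ± μ(m, l, μ(q), r) = 0` hold. -/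
structure PreMod.IsModule (M : PreMod A K) : Prop where
  relation : ∀ {X Y : A.Ob} (c : Chain A.hom X Y) (i j : ℤ),
    (c.splitSum fun _ l r => sgn r.deg • (M.μ r (i + l.deg + 1) j ∘ₗ M.μ l i (i + l.deg + 1))) +
      (c.splitSum fun _ l w => w.splitSum fun _ q r =>
        sgn r.deg • M.μ (l.append (.cons (A.μ q (q.deg + 2)) r)) i j) = 0
  μ_e : ∀ (X : A.Ob) (i : ℤ), M.μ (.cons (A.e X) (.nil X)) i i = LinearMap.id
  μ_higher_e : ∀ {X Y Z : A.Ob} (p : Chain A.hom Y Z) (q : Chain A.hom X Y) (i j : ℤ),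
    1 ≤ p.length + q.length → M.μ (p.append (.cons (A.e Y) q)) i j = 0

/-- `M` is a family of `A_∞`-modules over the base ring `K`: each `M(X)` is a graded projective
`K`-module, with bounded and (in each degree) finitely generated cohomology. If `K = k`, these are
the `A_∞`-modules with finite cohomology. -/
structure PreMod.IsFamily (M : PreMod A K) : Prop extends M.IsModule where
  projective : ∀ (X : A.Ob) (i : ℤ), Module.Projective K (M.obj X i)
  finite : ∀ (X : A.Ob) (n : ℤ), Module.Finite K (Cohomology (M.μ (.nil X)) n)
  bounded : ∀ X : A.Ob, ∃ N : ℤ, ∀ n, N < |n| → Subsingleton (Cohomology (M.μ (.nil X)) n)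

variable (A K) in
/-- The data of a family of twisted complexes `⊕_i F_i ⊗ X_i[-σ_i]`, with each `F_i` a finitely
generated projective `K`-module, together with a degree one endomorphism `δ`, whose component from
the `i`-th to the `j`-th summand is `∑_s φ_s ⊗ a_s`, and which is strictly decreasing for a finite
filtration of the `F_i` by direct summands. -/
structure PreTwisted where
  num : ℕ
  F : Fin num → Type u
  [group : ∀ i, AddCommGroup (F i)]
  [module : ∀ i, Module K (F i)]
  [finite : ∀ i, Module.Finite K (F i)]
  [projective : ∀ i, Module.Projective K (F i)]
  X : Fin num → A.Ob
  σ : Fin num → ℤ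
  terms : ℕ
  φ : Fin terms → ∀ i j : Fin num, F i →ₗ[K] F j
  a : Fin terms → ∀ i j : Fin num, A.hom (X i) (X j) (1 + σ i - σ j)
  len : ℕ
  fil : ℕ → ∀ i, Submodule K (F i)
  fil_zero : ∀ i, fil 0 i = ⊤
  fil_len : ∀ i, fil len i = ⊥
  fil_succ_le : ∀ m i, fil (m + 1) i ≤ fil m i
  fil_compl : ∀ m i, ∃ C, IsCompl (fil m i) C
  strict : ∀ s i j m, fil m i ≤ (fil (m + 1) j).comap (φ s i j)

attribute [instance] PreTwisted.group PreTwisted.module PreTwisted.finite PreTwisted.projective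

namespace PreTwisted

/-- The sum of `G j f w` over the pure tensors `f ⊗ w = (φ_{s_r} ⋯ φ_{s_1}) ⊗ (a_{s_r}, …, a_{s_1})`
which make up the `r`-fold tensor power of `δ`, starting at the summand `i` and ending at `j`. -/
def wordSum (T : PreTwisted A K) {E : Type v} [AddCommMonoid E] : ℕ → ∀ i : Fin T.num,
    (∀ j : Fin T.num, (T.F i →ₗ[K] T.F j) → Chain A.hom (T.X i) (T.X j) → E) → E
  | 0, i, G => G i LinearMap.id (.nil (T.X i))
  | r + 1, i, G => T.wordSum r i fun j f w =>
      ∑ j', ∑ s, G j' (T.φ s j j' ∘ₗ f) (.cons (T.a s j j') w)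

end PreTwisted

variable (A K) in
/-- A family of twisted complexes: `δ` satisfies the Maurer-Cartan equation `∑_r μ^r(δ, …, δ) = 0`.
The terms with `r > len` vanish, because of the filtration. (The sign arising from the shifts depends
only on the summand `i` at which one starts, hence does not affect the equation.) -/
structure TwistedComplex extends PreTwisted A K where
  maurerCartan : ∀ (i : Fin num) (n : ℤ),
    (∑ r ∈ Finset.range (len + 1), toPreTwisted.wordSum r i fun j f w =>
      (Pi.single j (f ⊗ₜ[K] ((1 : K) ⊗ₜ[k] A.μ w n)) :
        ∀ j, (F i →ₗ[K] F j) ⊗[K] (K ⊗[k] A.hom (X i) (X j) n))) = 0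

namespace PreTwisted

theorem wordSum_congr (T : PreTwisted A K) {E : Type v} [AddCommMonoid E] (r : ℕ) (i : Fin T.num)
    (G G' : ∀ j : Fin T.num, (T.F i →ₗ[K] T.F j) → Chain A.hom (T.X i) (T.X j) → E)
    (h : ∀ j f w, w.deg = T.σ i - T.σ j → G j f w = G' j f w) :
    T.wordSum r i G = T.wordSum r i G' := by
  induction r generalizing G G' with
  | zero => exact h _ _ _ (by simp [Chain.deg])
  | succ r ih =>
    refine ih _ _ fun j f w hw => ?_
    refine Finset.sum_congr rfl fun j' _ => Finset.sum_congr rfl fun s _ => h _ _ _ ?_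
    simp only [Chain.deg, hw]
    ring

theorem map_wordSum (T : PreTwisted A K) {E E' : Type*} [AddCommMonoid E] [AddCommMonoid E']
    (g : E →+ E') (r : ℕ) (i : Fin T.num)
    (G : ∀ j : Fin T.num, (T.F i →ₗ[K] T.F j) → Chain A.hom (T.X i) (T.X j) → E) :
    g (T.wordSum r i G) = T.wordSum r i fun j f w => g (G j f w) := by
  induction r generalizing G with
  | zero => rfl
  | succ r ih => simp only [wordSum, ih, map_sum]

theorem wordSum_add (T : PreTwisted A K) {E : Type*} [AddCommMonoid E]
    (r : ℕ) (i : Fin T.num)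
    (G G' : ∀ j : Fin T.num, (T.F i →ₗ[K] T.F j) → Chain A.hom (T.X i) (T.X j) → E) :
    (T.wordSum r i fun j f w => G j f w + G' j f w) = T.wordSum r i G + T.wordSum r i G' := by
  induction r generalizing G G' with
  | zero => rfl
  | succ r ih => simp only [wordSum, Finset.sum_add_distrib, ← ih]

theorem wordSum_zero (T : PreTwisted A K) {E : Type*} [AddCommMonoid E] (r : ℕ) (i : Fin T.num) :
    (T.wordSum r i fun _ _ _ => (0 : E)) = 0 := by
  induction r with
  | zero => rfl
  | succ r ih => simp only [wordSum, Finset.sum_const_zero, ih]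

variable (T : PreTwisted A K)

/-- The graded `K`-module `hom(X, T) = ⊕_i F_i ⊗ hom(X, X_i)[-σ_i]`. -/
abbrev yonedaObj (X : A.Ob) (n : ℤ) : Type u :=
  ∀ i, T.F i ⊗[K] (K ⊗[k] A.hom X (T.X i) (n - T.σ i))

/-- The map `p ⊗ b ↦ f(p) ⊗ μ(w, b, c)` from the `i`-th to the `j`-th summand, extended by zero to the
other summands. -/
def yonedaTerm {X Y : A.Ob} (c : Chain A.hom X Y) (n n' : ℤ) (i j : Fin T.num)
    (f : T.F i →ₗ[K] T.F j) (w : Chain A.hom (T.X i) (T.X j)) :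
    T.yonedaObj Y n →ₗ[K] T.yonedaObj X n' :=
  LinearMap.single K (fun j => T.F j ⊗[K] (K ⊗[k] A.hom X (T.X j) (n' - T.σ j))) j ∘ₗ
    TensorProduct.map f ((A.slot w c (n - T.σ i) (n' - T.σ j)).baseChange K) ∘ₗ LinearMap.proj i

theorem slot_add (A : AInfCat k) {X Y Z W U V : A.Ob} (w : Chain A.hom Z Y) {x : ℤ}
    (p : Chain A.hom U W) (a b : A.hom V U x) (q : Chain A.hom X V) (m n : ℤ) :
    A.slot w (p.append (.cons (a + b) q)) m n =
      A.slot w (p.append (.cons a q)) m n + A.slot (Z := Z) w (p.append (.cons b q)) m n := by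
  ext y
  have h := (A.μ_multilinear X Y n).map_add (w.append (.cons y p)) a b q
  simpa only [AInfCat.slot, LinearMap.coe_mk, AddHom.coe_mk, LinearMap.add_apply,
    LinearMap.smul_apply, Chain.append_assoc, Chain.append, Algebra.algebraMap_self,
    RingHom.id_apply] using h

theorem slot_smul (A : AInfCat k) {X Y Z W U V : A.Ob} (w : Chain A.hom Z Y) {x : ℤ}
    (p : Chain A.hom U W) (t : k) (a : A.hom V U x) (q : Chain A.hom X V) (m n : ℤ) :
    A.slot w (p.append (.cons (t • a) q)) m n =
      t • A.slot (Z := Z) w (p.append (.cons a q)) m n := by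
  ext y
  have h := (A.μ_multilinear X Y n).map_smul (w.append (.cons y p)) t a q
  simpa only [AInfCat.slot, LinearMap.coe_mk, AddHom.coe_mk, LinearMap.add_apply,
    LinearMap.smul_apply, Chain.append_assoc, Chain.append, Algebra.algebraMap_self,
    RingHom.id_apply] using h

theorem slot_deg (A : AInfCat k) {X Y Z W : A.Ob} (w : Chain A.hom Z Y) (c : Chain A.hom X W)
    (m n : ℤ) (h : n ≠ w.deg + (m - 1) + c.deg + 2) : A.slot w c m n = 0 := by
  ext y
  exact A.μ_deg _ _ (by rw [Chain.deg_append, Chain.deg]; omega)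

/-- The operation `(b, a_{d-1}, …, a_1) ↦ ∑_r μ(δ, …, δ, b, a_{d-1}, …, a_1)`. -/
def yonedaμ {X Y : A.Ob} (c : Chain A.hom X Y) (n n' : ℤ) :
    T.yonedaObj Y n →ₗ[K] T.yonedaObj X n' :=
  ∑ i, ∑ r ∈ Finset.range (T.len + 1), T.wordSum r i fun j f w => T.yonedaTerm c n n' i j f w

/-- The Yoneda image `hom(·, T)` of a (family of) twisted complexes. -/
def yoneda : PreMod A K where
  obj := T.yonedaObj
  μ c n n' := T.yonedaμ c n n'
  μ_multilinear X Y n n' :=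
    { map_add := fun p a b q => by
        simp only [yonedaμ, ← Finset.sum_add_distrib, ← wordSum_add]
        refine Finset.sum_congr rfl fun i _ => Finset.sum_congr rfl fun r _ =>
          T.wordSum_congr r i _ _ fun j f w _ => ?_
        simp only [yonedaTerm, slot_add, LinearMap.baseChange_add, TensorProduct.map_add_right,
          LinearMap.comp_add, LinearMap.add_comp]
      map_smul := fun p t a q => by
        simp only [yonedaμ, Finset.smul_sum]
        refine Finset.sum_congr rfl fun i _ => Finset.sum_congr rfl fun r _ => ?_
        refine Eq.trans ?_ (T.map_wordSum (DistribSMul.toAddMonoidHom _ (algebraMap k K t)) r i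
          _).symm
        refine T.wordSum_congr r i _ _ fun j f w _ => ?_
        have hs : ∀ {V W : Type u} [AddCommGroup V] [AddCommGroup W] [Module k V] [Module k W]
            (g : V →ₗ[k] W),
            (t • g).baseChange K = algebraMap k K t • g.baseChange K := fun g => by
          rw [LinearMap.baseChange_smul, algebraMap_smul]
        simp only [yonedaTerm, slot_smul, hs, TensorProduct.map_smul_right,
          LinearMap.comp_smul, LinearMap.smul_comp]
        rfl }
  μ_deg {X Y} c n n' h := by
    refine Finset.sum_eq_zero fun i _ => Finset.sum_eq_zero fun r _ => ?_
    refine (T.wordSum_congr r i _ (fun _ _ _ => 0) fun j f w hw => ?_).trans (T.wordSum_zero r i)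
    rw [yonedaTerm, slot_deg _ _ _ _ _ (by omega), LinearMap.baseChange_zero,
      TensorProduct.map_zero_right, LinearMap.zero_comp, LinearMap.comp_zero]

end PreTwisted

open CategoryTheory

/-- A perfect family of modules: a family which is quasi-isomorphic to a direct summand of (the Yoneda
image of) a family of twisted complexes. If `K = k`, these are the perfect modules. -/
structure PreMod.IsPerfect (M : PreMod A K) : Prop where
  isFamily : M.IsFamily
  retract : ∃ T : TwistedComplex A K, Nonempty (Retract M T.yoneda)

/-- Data for parallel transport along the deformation field: two perfect families following `[γ]`,
relative connections on them, and a line bundle `B` inside the morphisms of `H⁰` from the first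
family to the second one, which is invariant under the induced connection. -/
structure TransportFamily (γ : DeformationCocycle A K) where
  M₀ : PreMod A K
  M₁ : PreMod A K
  perfect₀ : M₀.IsPerfect
  perfect₁ : M₁.IsPerfect
  D₀ : Maps M₀ M₀.omega
  D₁ : Maps M₁ M₁.omega
  relative₀ : Maps.IsRelativeConnection γ D₀
  relative₁ : Maps.IsRelativeConnection γ D₁
  B : Submodule K (M₀ ⟶ M₁)
  lineBundle : Module.Invertible K B
  /-- The induced connection maps sections of `B` to `Ω ⊗ B`, on the cohomology level. -/
  invariant : ∀ (b : Maps M₀ M₁) (hb : b ∈ Maps.cocycles M₀ M₁), PreMod.toHom M₀ M₁ ⟨b, hb⟩ ∈ B →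
    Maps.inducedConnection γ D₀ D₁ (n := 0) hb.1 ∈
      Maps.coboundaries M₀ M₁.omega ⊔ Submodule.span K
        {x | ∃ (ω : Ω[K⁄k]) (b' : Maps M₀ M₁) (hb' : b' ∈ Maps.cocycles M₀ M₁),
          PreMod.toHom M₀ M₁ ⟨b', hb'⟩ ∈ B ∧ x = Maps.omegaMul ω b'}

variable (A) in
/-- Two modules together with a subspace of the space of morphisms between them in `H⁰`. -/
structure Triple where
  M₀ : PreMod A k
  M₁ : PreMod A k
  B : Submodule k (M₀ ⟶ M₁)

/-- The fibre of all the data at a point `s`. -/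
def TransportFamily.fibre {γ : DeformationCocycle A K} (T : TransportFamily γ) (s : K →ₐ[k] k) :
    Triple A where
  M₀ := T.M₀.fibre s
  M₁ := T.M₁.fibre s
  B := Submodule.span k (PreMod.fibreMap s T.M₀ T.M₁ '' T.B)

namespace Triple

/-- Quasi-isomorphism of triples: isomorphisms in `H⁰` which map one subspace to the other. -/
def Iso (t t' : Triple A) : Prop :=
  ∃ (f₀ : t.M₀ ≅ t'.M₀) (f₁ : t.M₁ ≅ t'.M₁),
    ∀ b : t.M₀ ⟶ t.M₁, b ∈ t.B ↔ f₀.inv ≫ b ≫ f₁.hom ∈ t'.B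

/-- The triple `t'` is obtained from `t` by parallel transport from `s` to `s'`, for some choice of
families, relative connections, and line bundle. -/
def IsParallelTransport (γ : DeformationCocycle A K) (s s' : K →ₐ[k] k) (t t' : Triple A) :
    Prop :=
  ∃ T : TransportFamily γ, (T.fibre s).Iso t ∧ (T.fibre s').Iso t'

end Triple

/-- The endomorphism ring of `M` in `H⁰` is commutative, and its nilpotent elements form a subspace of
codimension one. -/
structure PreMod.HasLocalEnd (M : PreMod A k) : Prop where
  comm : ∀ x y : M ⟶ M, x ≫ y = y ≫ x
  codim : Module.finrank k ((M ⟶ M) ⧸ Submodule.span k {x : M ⟶ M | IsNilpotent (R := End M) x}) = 1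

/-- The modules `M₀` and `M₁` are perfect and satisfy `HasLocalEnd`, `B` is one-dimensional, and the two
multiplication maps `B ⊗ Hom(M₀, M₀) → Hom(M₀, M₁)` and `Hom(M₁, M₁) ⊗ B → Hom(M₀, M₁)` have the same
image. -/
structure Triple.IsBalanced (t : Triple A) : Prop where
  perfect₀ : t.M₀.IsPerfect
  perfect₁ : t.M₁.IsPerfect
  local₀ : t.M₀.HasLocalEnd
  local₁ : t.M₁.HasLocalEnd
  finrank_B : Module.finrank k t.B = 1
  image_eq : Submodule.span k {f : t.M₀ ⟶ t.M₁ | ∃ x : t.M₀ ⟶ t.M₀, ∃ b ∈ t.B, f = x ≫ b} =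
    Submodule.span k {f : t.M₀ ⟶ t.M₁ | ∃ y : t.M₁ ⟶ t.M₁, ∃ b ∈ t.B, f = b ≫ y}

end AInf
end

/-!
Relative connections on two perfect families `M` and `N` induce a connection on the `K`-module `M ⟶ N`
of morphisms in `H⁰`, and these connections satisfy the Leibniz rule for composition (`PreMod.connHom`,
`PreMod.connHom_comp`): the insertion of the deformation cocycle `γ` into a sequence of maps commutes
with the differential, by the cocycle equation, up to the terms which the defining equation of relative
connections cancels (`Maps.d_ins`, `Maps.d_nab`). Connections are used through their contractions with
derivations of `K`.

The modules `M ⟶ N` are finitely generated (`Maps.finite_HomH`). It suffices to see this for the Yoneda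
image of a family of twisted complexes, which carries a finite filtration; as in the Yoneda lemma, a
cocycle on a graded piece is determined up to coboundaries by its values at the elements `p ⊗ e`.

A finitely generated module with a connection, over the coordinate ring of a smooth affine variety in
characteristic zero, is torsion-free (`Conn.torsionFree`), and its invariant submodules are determined
by their images in the fibre at a single point (`Conn.le_of_le_sup_smul`): an invariant submodule which
vanishes at a point vanishes there to all orders, as one sees by applying an Euler vector field, and
Krull's intersection theorem applies. On a curve, maximal ideals are locally principal
(`exists_local_parameter`), and torsion-freeness of the cohomology in degree one has the consequence
that restriction to the fibre at `s` is a surjective map `(M ⟶ N) → (M.fibre s ⟶ N.fibre s)`, whose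
kernel consists of the morphisms with coefficients in the maximal ideal of `s`
(`PreMod.fibreMap_surjective`, `PreMod.mem_smul_of_fibreMap_eq_zero`). Hence invariant families of
morphisms can be compared in one fibre (`PreMod.eq_of_map_fibreMap_eq`).

Now let two transport families, with objects `M₀`, `M₁` and `N₀`, `N₁` and line bundles `B` and `C`,
have isomorphic balanced triples as their fibres at `s`.

* Each endomorphism ring of the fibres at `s'` is local, or zero: for the finite family of commutative
  rings `H = (M ⟶ M)`, all powers of the ideal of the diagonal in `H ⊗ H` are invariant, and one of them
  is zero at `s` (`diagonalIdeal_pow_eq_bot`, `PreMod.unitOrNilpotentEnd_fibre`).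
* The composites `M₀ ⟶ N₀ ⟶ M₀` span an invariant submodule, which is everything at `s` and therefore
  also at `s'` (`PreMod.compSpan_top_fibre_eq_top`). As the endomorphism rings are local, the fibres of
  `M₀` and `N₀` at `s'` are isomorphic (`UnitOrNilpotentEnd.nonempty_iso`). The same holds for `M₁` and
  `N₁`.
* The submodules of `M₀ ⟶ N₁` spanned by `(M₀ ⟶ N₀) ≫ C` and by `B ≫ (M₁ ⟶ N₁)` are both invariant, and
  agree at `s` because the triple is balanced. So they agree at `s'`, where locality of the endomorphism
  rings permits a choice of isomorphisms which carry the fibre of `B` to that of `C`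
  (`exists_iso_of_compSpan_eq`).
-/

noncomputable section

namespace AInf

/-! ### Modules with connection over a smooth affine variety -/

section

section Base
variable {k : Type u} [Field k] {K : Type u} [CommRing K] [Algebra k K]

/-- A connection on the `K`-module `Q`, given by its contractions with the derivations of `K`. No
linearity in the derivation is required: only one derivation at a time is ever used. -/
structure Conn (k : Type u) [Field k] (K : Type u) [CommRing K] [Algebra k K]
    (Q : Type u) [AddCommGroup Q] [Module K Q] where
  nabla : Derivation k K K → Q →+ Q
  leibniz : ∀ θ f q, nabla θ (f • q) = θ f • q + f • nabla θ q

/-- The submodule `J` is preserved by the connection `c`. -/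
def Conn.Stable {Q : Type u} [AddCommGroup Q] [Module K Q] (c : Conn k K Q)
    (J : Submodule K Q) : Prop :=
  ∀ θ, ∀ q ∈ J, c.nabla θ q ∈ J

/-- The tautological connection `f ↦ θ f` on the base ring. -/
def Conn.base (k : Type u) [Field k] (K : Type u) [CommRing K] [Algebra k K] : Conn k K K where
  nabla θ := θ.toLinearMap.toAddMonoidHom
  leibniz θ f q := by simp [mul_comm, add_comm]

/-- The connection induced on the quotient by an invariant submodule. -/
def Conn.quotient {Q : Type u} [AddCommGroup Q] [Module K Q] (c : Conn k K Q)
    (J : Submodule K Q) (hJ : c.Stable J) : Conn k K (Q ⧸ J) where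
  nabla θ := QuotientAddGroup.map J.toAddSubgroup J.toAddSubgroup (c.nabla θ)
    fun q hq => hJ θ q hq
  leibniz θ f q := by
    induction q using Submodule.Quotient.induction_on with
    | H q =>
      change Submodule.Quotient.mk (c.nabla θ (f • q)) = _
      rw [c.leibniz]
      rfl

/-- Over a point, the tangent directions span: there is a finite sum `∑ aᵢ θᵢ` of derivations with
coefficients in the maximal ideal which acts as the identity on `m / m²`. It plays the role of the
Euler vector field. -/
theorem exists_euler [Algebra.Smooth k K] (s : K →ₐ[k] k) :
    ∃ (n : ℕ) (a : Fin n → K) (θ : Fin n → Derivation k K K), (∀ i, s (a i) = 0) ∧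
      ∀ x, s x = 0 → x - ∑ i, a i * θ i x ∈ RingHom.ker s ^ 2 := by
  have : IsNoetherianRing K := Algebra.FiniteType.isNoetherianRing k K
  set m : Ideal K := RingHom.ker s
  have hm : ∀ x, x ∈ m ↔ s x = 0 := fun x => RingHom.mem_ker
  obtain ⟨n, a, ha⟩ := Submodule.fg_iff_exists_fin_generating_family.1 (IsNoetherian.noetherian m)
  have ham : ∀ i, a i ∈ m := fun i => ha ▸ Submodule.subset_span ⟨i, rfl⟩
  -- the derivation `x ↦ [x - s x]` into `m / m²`
  have hmem : ∀ x, x - algebraMap k K (s x) ∈ m := fun x => by simp [hm]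
  let δ₀ : K →ₗ[k] m := LinearMap.codRestrict (m.restrictScalars k)
    (LinearMap.id - (Algebra.linearMap k K) ∘ₗ s.toLinearMap) hmem
  have hδ₀ : ∀ x, (δ₀ x : K) = x - algebraMap k K (s x) := fun x => rfl
  let δ : Derivation k K m.Cotangent := Derivation.mk' (m.toCotangent.restrictScalars k ∘ₗ δ₀) <| by
    intro x y
    change m.toCotangent (δ₀ (x * y)) = x • m.toCotangent (δ₀ y) + y • m.toCotangent (δ₀ x)
    rw [← map_smul m.toCotangent, ← map_smul m.toCotangent, ← map_add m.toCotangent,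
      Ideal.toCotangent_eq]
    have : ((δ₀ (x * y) : m) : K) - ((x • δ₀ y + y • δ₀ x : m) : K) =
        -((x - algebraMap k K (s x)) * (y - algebraMap k K (s y))) := by
      push_cast
      simp only [hδ₀, map_mul, smul_eq_mul]
      ring
    rw [this, pow_two]
    exact neg_mem (Ideal.mul_mem_mul (hmem x) (hmem y))
  let p : (Fin n → K) →ₗ[K] m.Cotangent :=
    Fintype.linearCombination K (fun i => m.toCotangent ⟨a i, ham i⟩)
  have hp : Function.Surjective p := by
    intro y
    obtain ⟨⟨y, hy⟩, rfl⟩ := m.toCotangent_surjective y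
    have hy' := hy
    rw [← ha, Submodule.mem_span_range_iff_exists_fun] at hy'
    obtain ⟨c, hc⟩ := hy'
    refine ⟨c, ?_⟩
    simp only [p, Fintype.linearCombination_apply, ← map_smul, ← map_sum]
    congr 1
    exact Subtype.ext (by simpa using hc)
  obtain ⟨g, hg⟩ := Module.projective_lifting_property p δ.liftKaehlerDifferential hp
  refine ⟨n, a, fun i => (LinearMap.proj i ∘ₗ g).compDer (KaehlerDifferential.D k K),
    fun i => (hm _).1 (ham i), fun x hx => ?_⟩
  have h1 := LinearMap.congr_fun hg (KaehlerDifferential.D k K x)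
  rw [LinearMap.comp_apply, Derivation.liftKaehlerDifferential_comp_D] at h1
  have h2 : δ x = m.toCotangent ⟨x, (hm x).2 hx⟩ := by
    change m.toCotangent (δ₀ x) = _
    congr 1
    exact Subtype.ext (by simp [hδ₀, hx])
  rw [h2] at h1
  simp only [p, Fintype.linearCombination_apply, ← map_smul, ← map_sum] at h1
  rw [Ideal.toCotangent_eq] at h1
  rw [← neg_mem_iff]
  convert! h1 using 1
  push_cast
  simp [mul_comm]

/-- An invariant submodule which vanishes at a point vanishes there to all orders: the Euler field
multiplies elements of `m ^ r • Q` by `r`, up to `m ^ (r + 1) • Q`, while it maps the submodule to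
`m ^ (r + 2) • Q` once this submodule lies in `m ^ (r + 1) • Q`. -/
theorem conn_pow_le [CharZero k] {Q : Type u} [AddCommGroup Q] [Module K Q] (c : Conn k K Q)
    (m : Ideal K) {n : ℕ} (a : Fin n → K) (θ : Fin n → Derivation k K K) (ha : ∀ i, a i ∈ m)
    (hθ : ∀ x ∈ m, x - ∑ i, a i * θ i x ∈ m ^ 2)
    (J : Submodule K Q) (hJ : c.Stable J) (hJm : J ≤ m • ⊤) (r : ℕ) :
    J ≤ (m ^ (r + 1)) • (⊤ : Submodule K Q) := by
  have key : ∀ r : ℕ, ∀ f ∈ m ^ r, (r : K) * f - ∑ i, a i * θ i f ∈ m ^ (r + 1) := by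
    intro r
    induction r with
    | zero =>
      intro f _
      simp only [Nat.cast_zero, zero_mul, zero_sub, zero_add, pow_one]
      exact neg_mem (sum_mem fun i _ => Ideal.mul_mem_right _ _ (ha i))
    | succ r ih =>
      intro f hf
      rw [pow_succ] at hf
      induction hf using Submodule.mul_induction_on' with
      | mem_mul_mem x hx y hy =>
        have h1 := Ideal.mul_mem_mul (ih x hx) hy
        have h2 := Ideal.mul_mem_mul hx (hθ y hy)
        rw [← pow_succ] at h1
        rw [← pow_add] at h2
        convert! add_mem h1 h2 using 1
        have : ∑ i, a i * θ i (x * y) = x * ∑ i, a i * θ i y + y * ∑ i, a i * θ i x := by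
          rw [Finset.mul_sum, Finset.mul_sum, ← Finset.sum_add_distrib]
          refine Finset.sum_congr rfl fun i _ => ?_
          rw [Derivation.leibniz, smul_eq_mul, smul_eq_mul]; ring
        rw [this]; push_cast; ring
      | add x _ y _ hx hy =>
        convert! add_mem hx hy using 1
        simp only [map_add, mul_add, Finset.sum_add_distrib]; ring
  induction r with
  | zero => simpa using hJm
  | succ r ih =>
    intro q hq
    have h1 : (∑ i, a i • c.nabla (θ i) q) ∈ m ^ (r + 1 + 1) • (⊤ : Submodule K Q) := by
      rw [pow_succ', mul_smul]
      exact sum_mem fun i _ => Submodule.smul_mem_smul (ha i) (ih (hJ _ _ hq))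
    have h2 : ∀ q ∈ m ^ (r + 1) • (⊤ : Submodule K Q),
        ((r + 1 : ℕ) : K) • q - (∑ i, a i • c.nabla (θ i) q) ∈
          m ^ (r + 1 + 1) • (⊤ : Submodule K Q) := by
      intro q hq
      induction hq using Submodule.smul_induction_on' with
      | smul f hf h _ =>
        have e : ((r + 1 : ℕ) : K) • f • h - (∑ i, a i • c.nabla (θ i) (f • h)) =
            (((r + 1 : ℕ) : K) * f - ∑ i, a i * θ i f) • h -
              ∑ i, (a i * f) • c.nabla (θ i) h := by
          simp only [c.leibniz, smul_add, Finset.sum_add_distrib, sub_smul, Finset.sum_smul,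
            smul_smul]
          abel
        rw [e]
        refine sub_mem (Submodule.smul_mem_smul (key _ f hf) trivial)
          (sum_mem fun i _ => Submodule.smul_mem_smul ?_ trivial)
        rw [pow_succ']
        exact Ideal.mul_mem_mul (ha i) hf
      | add x hx y hy h1 h2 =>
        convert! add_mem h1 h2 using 1
        simp only [map_add, smul_add, Finset.sum_add_distrib]; abel
    have h3 := add_mem (h2 q (ih hq)) h1
    rw [sub_add_cancel] at h3
    have h4 := Submodule.smul_mem _ (algebraMap k K ((r + 1 : ℕ) : k)⁻¹) h3
    rwa [smul_smul, ← map_natCast (algebraMap k K), ← map_mul,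
      inv_mul_cancel₀ (Nat.cast_ne_zero.2 (Nat.succ_ne_zero r)), map_one, one_smul] at h4

end Base

section Curve
variable {k : Type u} [Field k] [CharZero k] {K : Type u} [CommRing K] [IsDomain K]
  [Algebra k K] [Algebra.Smooth k K]

/-- By Krull's intersection theorem, an element of an invariant submodule which vanishes at a point is
killed by a function which does not vanish there. -/
theorem Conn.exists_smul_eq_zero {Q : Type u} [AddCommGroup Q] [Module K Q] [Module.Finite K Q]
    (c : Conn k K Q) (s : K →ₐ[k] k) (J : Submodule K Q) (hJ : c.Stable J)
    (hJm : J ≤ (RingHom.ker s : Ideal K) • ⊤) {q : Q} (hq : q ∈ J) :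
    ∃ f : K, f ≠ 0 ∧ f • q = 0 := by
  have : IsNoetherianRing K := Algebra.FiniteType.isNoetherianRing k K
  obtain ⟨n, a, θ, ha, hθ⟩ := exists_euler s
  have h : q ∈ (⨅ i : ℕ, (RingHom.ker s : Ideal K) ^ i • ⊤ : Submodule K Q) := by
    rw [Submodule.mem_iInf]
    rintro (_ | r)
    · simp
    · exact conn_pow_le c _ a θ ha hθ J hJ hJm r hq
  obtain ⟨⟨r, hr⟩, hr'⟩ := (Ideal.mem_iInf_smul_pow_eq_bot_iff _ q).1 h
  refine ⟨1 - r, fun h0 => ?_, by rw [sub_smul, one_smul, sub_eq_zero]; exact hr'.symm⟩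
  have : s (1 - r) = 1 := by rw [map_sub, map_one, (RingHom.mem_ker).1 hr, sub_zero]
  rw [h0, map_zero] at this
  exact zero_ne_one this

/-- The Nullstellensatz, for an algebra of finite type over an algebraically closed field. -/
theorem exists_point [IsAlgClosed k] (m : Ideal K) [m.IsMaximal] :
    ∃ s : K →ₐ[k] k, RingHom.ker s = m := by
  letI : Field (K ⧸ m) := Ideal.Quotient.field m
  have : Module.Finite k (K ⧸ m) := finite_of_finite_type_of_isJacobsonRing k (K ⧸ m)
  have hb := IsAlgClosed.algebraMap_bijective_of_isIntegral (k := k) (K := K ⧸ m)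
  let e : k ≃ₐ[k] (K ⧸ m) := AlgEquiv.ofBijective (Algebra.ofId k (K ⧸ m)) hb
  refine ⟨e.symm.toAlgHom.comp (Ideal.Quotient.mkₐ k m), ?_⟩
  ext x
  rw [RingHom.mem_ker]
  simp [Ideal.Quotient.eq_zero_iff_mem]

/-- The coordinate ring of a smooth affine variety is differentially simple. -/
theorem ideal_eq_top_of_stable [IsAlgClosed k] (I : Ideal K) (hI : (Conn.base k K).Stable I)
    (h0 : I ≠ ⊥) : I = ⊤ := by
  by_contra hne
  obtain ⟨m, hm, hle⟩ := Ideal.exists_le_maximal I hne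
  obtain ⟨s, rfl⟩ := exists_point (k := k) m
  obtain ⟨x, hx, hx0⟩ := Submodule.exists_mem_ne_zero_of_ne_bot h0
  obtain ⟨f, hf, hfx⟩ := (Conn.base k K).exists_smul_eq_zero s I hI
    (hle.trans (by simp)) hx
  exact (mul_ne_zero hf hx0) hfx

variable {Q : Type u} [AddCommGroup Q] [Module K Q] [Module.Finite K Q]

/-- A finitely generated module with a connection is torsion-free: the annihilator of its torsion is a
nonzero ideal invariant under all derivations. -/
theorem Conn.torsionFree [IsAlgClosed k] (c : Conn k K Q) {f : K} (hf : f ≠ 0) {q : Q}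
    (h : f • q = 0) : q = 0 := by
  have : IsNoetherianRing K := Algebra.FiniteType.isNoetherianRing k K
  let T := Submodule.torsion K Q
  have hmem : ∀ {q : Q} {f : K}, f ≠ 0 → f • q = 0 → q ∈ T := fun {q f} hf h =>
    (Submodule.mem_torsion_iff q).2 ⟨⟨f, mem_nonZeroDivisors_of_ne_zero hf⟩, h⟩
  have hst : ∀ θ, ∀ q ∈ T, c.nabla θ q ∈ T := by
    intro θ q hq
    obtain ⟨⟨f, hf⟩, hfq⟩ := (Submodule.mem_torsion_iff q).1 hq
    have hfq : f • q = 0 := hfq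
    have hf0 := nonZeroDivisors.ne_zero hf
    refine hmem (mul_ne_zero hf0 hf0) ?_
    have h1 := c.leibniz θ f q
    rw [hfq, map_zero] at h1
    rw [mul_smul, eq_neg_of_add_eq_zero_right h1.symm, smul_neg, smul_comm, hfq, smul_zero,
      neg_zero]
  obtain ⟨g, hg, hg0⟩ := Submodule.annihilator_top_inter_nonZeroDivisors
    (Submodule.torsion_isTorsion : Module.IsTorsion K T)
  have hann : ∀ f : K, f ∈ T.annihilator ↔ ∀ q ∈ T, f • q = 0 := fun f =>
    Submodule.mem_annihilator
  have htop : T.annihilator = ⊤ := by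
    refine ideal_eq_top_of_stable (k := k) _ (fun θ f hf => ?_) fun h0 => ?_
    · rw [hann] at hf ⊢
      intro q hq
      have h1 := c.leibniz θ f q
      rw [hf q hq, map_zero, hf _ (hst θ q hq), add_zero] at h1
      exact h1.symm
    · refine nonZeroDivisors.ne_zero hg0 ?_
      have : g ∈ T.annihilator := (hann g).2 fun q hq => by
        have := (Submodule.mem_annihilator (N := (⊤ : Submodule K T))).1 hg ⟨q, hq⟩ trivial
        exact congrArg Subtype.val this
      rw [h0] at this
      exact this
  have := (hann 1).1 (by rw [htop]; trivial) q (hmem hf h)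
  rwa [one_smul] at this

/-- An invariant submodule of a finitely generated module with a connection is zero if it vanishes in
the fibre at one point. -/
theorem Conn.eq_bot_of_le_smul [IsAlgClosed k] (c : Conn k K Q) (s : K →ₐ[k] k)
    (J : Submodule K Q) (hJ : c.Stable J) (hJm : J ≤ (RingHom.ker s : Ideal K) • ⊤) : J = ⊥ := by
  refine (Submodule.eq_bot_iff _).2 fun q hq => ?_
  obtain ⟨f, hf, h⟩ := c.exists_smul_eq_zero s J hJ hJm hq
  exact c.torsionFree hf h

/-- An inclusion of invariant submodules can be checked in the fibre at one point. -/
theorem Conn.le_of_le_sup_smul [IsAlgClosed k] (c : Conn k K Q) (s : K →ₐ[k] k)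
    (U V : Submodule K Q) (hU : c.Stable U) (hV : c.Stable V)
    (h : U ≤ V ⊔ (RingHom.ker s : Ideal K) • ⊤) : U ≤ V := by
  have hst : (c.quotient V hV).Stable (U.map V.mkQ) := by
    rintro θ _ ⟨x, hx, rfl⟩
    exact ⟨c.nabla θ x, hU θ x hx, rfl⟩
  have := (c.quotient V hV).eq_bot_of_le_smul s (U.map V.mkQ) hst <| by
    refine (Submodule.map_mono h).trans ?_
    rw [Submodule.map_sup, Submodule.map_smul'']
    simp
  rw [← V.ker_mkQ]
  exact LinearMap.le_ker_iff_map.2 this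

end Curve

end

/-! ### Local parameters, and finite families of commutative rings -/

section

section Curve
variable {k : Type u} [Field k] [CharZero k] {K : Type u} [CommRing K] [IsDomain K]
  [Algebra k K] [Algebra.Smooth k K]

/-- The maximal ideal of a point on a smooth curve is locally principal: it becomes principal after
inverting some `g` with `g(s) = 1`. If there were two coordinates `x`, `y` with independent differentials
at the point, there would be a vector field `θ` with `θ x = 0` and `(θ y)(s) ≠ 0`; but near the point, some
power of `y` is a multiple of `x` for dimension reasons, and applying `θ` lowers that power. -/
theorem exists_local_parameter (hK : ringKrullDim K = 1) (s : K →ₐ[k] k) :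
    ∃ a g : K, a ≠ 0 ∧ s a = 0 ∧ s g = 1 ∧ ∀ x, s x = 0 → ∃ y, g * x = a * y := by
  have : IsNoetherianRing K := Algebra.FiniteType.isNoetherianRing k K
  set m : Ideal K := RingHom.ker s with hmdef
  have hm : ∀ x, x ∈ m ↔ s x = 0 := fun x => RingHom.mem_ker
  have hprime : m.IsPrime := RingHom.ker_isPrime s
  have hs : Function.Surjective s := fun t => ⟨algebraMap k K t, by simp⟩
  have hdim : ∀ P : Ideal K, P.IsPrime → P ≠ ⊥ → P.IsMaximal := by
    have h1 : Ring.KrullDimLE 1 K := Ring.krullDimLE_iff.2 (by rw [hK]; rfl)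
    intro P hP hP0
    exact Ring.krullDimLE_one_iff_of_isPrime_bot.1 h1 P hP0 hP
  have hm0 : m ≠ ⊥ := by
    intro h0
    have hf : IsField K := by
      have : Function.Bijective s :=
        ⟨(injective_iff_map_eq_zero s).2 fun x hx => by
          have := (hm x).2 hx
          rwa [h0] at this, hs⟩
      exact (RingEquiv.ofBijective s this).toMulEquiv.isField (Field.toIsField k)
    have := hf.isPrincipalIdealRing
    rw [ringKrullDim_eq_zero_of_isField hf] at hK
    exact zero_ne_one hK
  obtain ⟨n, e, θ, he, hθ⟩ := exists_euler s
  have hsq : ∀ x ∈ m ^ 2, s x = 0 := fun x hx => (hm x).1 (Ideal.pow_le_self two_ne_zero hx)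
  obtain ⟨a, ham, ha2⟩ : ∃ a ∈ m, a ∉ m ^ 2 := by
    by_contra! h
    have hle : m ≤ m • m := by rw [smul_eq_mul, ← pow_two]; exact h
    obtain ⟨r, hr, hr'⟩ := Submodule.exists_sub_one_mem_and_smul_eq_zero_of_fg_of_le_smul
      m m (IsNoetherian.noetherian m) hle
    obtain ⟨x, hx, hx0⟩ := Submodule.exists_mem_ne_zero_of_ne_bot hm0
    have hr0 : r = 0 := (mul_eq_zero.1 (hr' x hx)).resolve_right hx0
    rw [hr0, hm] at hr
    simp at hr
  have ha0 : a ≠ 0 := fun h => ha2 (by rw [h]; exact zero_mem _)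
  -- some power of every `y ∈ m` is a multiple of `a` near the point
  have hpow : ∀ y ∈ m, ∃ (g : K) (N : ℕ), s g ≠ 0 ∧ g * y ^ N ∈ Ideal.span {a} := by
    intro y hy
    by_contra! h
    let S : Submonoid K :=
      { carrier := {x | ∃ (g : K) (N : ℕ), s g ≠ 0 ∧ x = g * y ^ N}
        one_mem' := ⟨1, 0, by simp, by simp⟩
        mul_mem' := by
          rintro _ _ ⟨g, N, hg, rfl⟩ ⟨g', N', hg', rfl⟩
          exact ⟨g * g', N + N', by simp [hg, hg'], by ring⟩ }
    obtain ⟨P, hP, haP, hd⟩ := Ideal.exists_le_prime_disjoint (Ideal.span {a}) S <| by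
      rw [Set.disjoint_left]
      rintro x hx ⟨g, N, hg, rfl⟩
      exact h g N hg hx
    have hPm : P ≤ m := by
      intro x hx
      by_contra hxm
      exact Set.disjoint_left.1 hd hx ⟨x, 0, fun h0 => hxm ((hm x).2 h0), by simp⟩
    have haP' : a ∈ P := haP (Ideal.mem_span_singleton_self a)
    have hPmax := hdim P hP fun h0 => ha0 (by rwa [h0] at haP')
    have hPe : P = m := hPmax.eq_of_le hprime.ne_top hPm
    exact Set.disjoint_left.1 hd (hPe ▸ hy : y ∈ P) ⟨1, 1, by simp, by simp⟩
  -- a derivation killing `a` cannot be nonzero on `y` at the point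
  have hder : ∀ (D : Derivation k K K), D a = 0 → ∀ y ∈ m, s (D y) = 0 := by
    intro D hD y hy
    by_contra hy0
    have hstep : ∀ (N : ℕ) (g : K), s g ≠ 0 → g * y ^ N ∈ Ideal.span {a} → False := by
      intro N
      induction N with
      | zero =>
        intro g hg h
        have : Ideal.span {a} ≤ m := (Ideal.span_singleton_le_iff_mem _).2 ham
        exact hg ((hm g).1 (this (by simpa using h)))
      | succ N ih =>
        intro g hg h
        refine ih (g * g * ((N + 1 : ℕ) : K) * D y) ?_ ?_
        · simp only [map_mul, map_natCast]
          exact mul_ne_zero (mul_ne_zero (mul_ne_zero hg hg) (Nat.cast_ne_zero.2 N.succ_ne_zero)) hy0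
        · have hstab : ∀ x ∈ Ideal.span {a}, D x ∈ Ideal.span {a} := by
            intro x hx
            obtain ⟨c, rfl⟩ := Ideal.mem_span_singleton'.1 hx
            rw [Derivation.leibniz, hD, smul_zero, zero_add, smul_eq_mul]
            exact Ideal.mul_mem_right _ _ (Ideal.mem_span_singleton_self a)
          have h1 := sub_mem (Ideal.mul_mem_left _ g (hstab _ h)) (Ideal.mul_mem_left _ (D g) h)
          convert! h1 using 1
          simp only [Derivation.leibniz, Derivation.leibniz_pow, smul_eq_mul, nsmul_eq_mul,
            Nat.add_sub_cancel]
          ring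
    obtain ⟨g, N, hg, h⟩ := hpow y hy
    exact hstep N g hg h
  have hgen : m ≤ Ideal.span {a} ⊔ m • m := by
    intro y hy
    have hi : ∃ i, s (θ i a) ≠ 0 := by
      by_contra! h0
      refine ha2 ?_
      rw [← sub_add_cancel a (∑ i, e i * θ i a)]
      refine add_mem (hθ a ((hm a).1 ham)) (sum_mem fun i _ => ?_)
      rw [pow_two]
      exact Ideal.mul_mem_mul ((hm _).2 (he i)) ((hm _).2 (h0 i))
    obtain ⟨i, hi⟩ := hi
    set t : k := s (θ i y) / s (θ i a)
    have hj : ∀ j, s (θ j (y - algebraMap k K t * a)) = 0 := by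
      intro j
      have := hder (θ i a • θ j - θ j a • θ i) (by simp [mul_comm]) y hy
      simp only [Derivation.sub_apply, Derivation.smul_apply, smul_eq_mul, map_sub, map_mul] at this
      simp only [map_sub, Derivation.leibniz, Derivation.map_algebraMap, smul_eq_mul, mul_zero,
        add_zero, map_mul, AlgHom.commutes, Algebra.algebraMap_self, RingHom.id_apply, t]
      field_simp
      linear_combination this
    set y' := y - algebraMap k K t * a with hy'
    have h0 : s y' = 0 := by simp [hy', (hm y).1 hy, (hm a).1 ham]
    have h2 : y' ∈ m • m := by
      rw [smul_eq_mul, ← sub_add_cancel y' (∑ i, e i * θ i y')]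
      refine add_mem (by rw [← pow_two]; exact hθ y' h0) (sum_mem fun i _ => ?_)
      exact Ideal.mul_mem_mul ((hm _).2 (he i)) ((hm _).2 (hj i))
    have : y = algebraMap k K t * a + y' := by rw [hy']; ring
    rw [this]
    exact Submodule.add_mem_sup (Ideal.mul_mem_left _ _ (Ideal.mem_span_singleton_self a)) h2
  obtain ⟨g, hg, hg'⟩ := Submodule.exists_sub_one_mem_and_smul_le_of_fg_of_le_sup
    (IsNoetherian.noetherian m) le_rfl hgen
  refine ⟨a, g, ha0, (hm a).1 ham, ?_, fun x hx => ?_⟩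
  · have := (hm _).1 hg
    rw [map_sub, map_one, sub_eq_zero] at this
    exact this
  · obtain ⟨y, hy⟩ := Ideal.mem_span_singleton'.1
      (hg' (Submodule.smul_mem_pointwise_smul x g m ((hm x).2 hx)))
    exact ⟨y, by rw [mul_comm a, hy]; rfl⟩

end Curve

section LocalEnd
variable {k : Type u} [Field k] [CharZero k] [IsAlgClosed k] {K : Type u} [CommRing K] [IsDomain K]
  [Algebra k K] [Algebra.Smooth k K]
  {H : Type u} [CommRing H] [Algebra K H] [Module.Finite K H]

/-- The connection on `H ⊗ H` induced by one on `H`. -/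
def Conn.tensor (c : Conn k K H) : Conn k K (H ⊗[K] H) where
  nabla θ := TensorProduct.liftAddHom
    (AddMonoidHom.mk' (fun x => AddMonoidHom.mk' (fun y => c.nabla θ x ⊗ₜ[K] y + x ⊗ₜ c.nabla θ y)
      fun y y' => by simp only [TensorProduct.tmul_add, map_add]; abel)
      fun x x' => by
        ext y
        simp only [AddMonoidHom.mk'_apply, AddMonoidHom.add_apply, TensorProduct.add_tmul, map_add]
        abel)
    fun f x y => by
      simp only [AddMonoidHom.mk'_apply, c.leibniz, TensorProduct.add_tmul, TensorProduct.tmul_add,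
        TensorProduct.smul_tmul]
      abel
  leibniz θ f q := by
    induction q using TensorProduct.induction_on with
    | zero => simp
    | tmul x y =>
      rw [TensorProduct.smul_tmul']
      simp only [TensorProduct.liftAddHom_tmul, AddMonoidHom.mk'_apply, c.leibniz,
        TensorProduct.add_tmul, smul_add, TensorProduct.smul_tmul']
      abel
    | add x y hx hy => simp only [smul_add, map_add, hx, hy]; abel

theorem Conn.tensor_tmul (c : Conn k K H) (θ : Derivation k K K) (x y : H) :
    c.tensor.nabla θ (x ⊗ₜ y) = c.nabla θ x ⊗ₜ y + x ⊗ₜ c.nabla θ y := rfl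

theorem Conn.tensor_mul (c : Conn k K H)
    (hc : ∀ θ x y, c.nabla θ (x * y) = c.nabla θ x * y + x * c.nabla θ y) (θ : Derivation k K K)
    (x y : H ⊗[K] H) :
    c.tensor.nabla θ (x * y) = c.tensor.nabla θ x * y + x * c.tensor.nabla θ y := by
  induction x using TensorProduct.induction_on with
  | zero => simp
  | add x x' hx hx' => simp only [add_mul, map_add, hx, hx']; abel
  | tmul x x' =>
    induction y using TensorProduct.induction_on with
    | zero => simp
    | add y y' hy hy' => simp only [mul_add, map_add, hy, hy']; abel
    | tmul y y' =>
      simp only [Algebra.TensorProduct.tmul_mul_tmul, Conn.tensor_tmul, hc,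
        TensorProduct.add_tmul, TensorProduct.tmul_add, add_mul, mul_add]
      abel

variable (K H) in
/-- The ideal of the diagonal in `H ⊗ H`. -/
def diagonalIdeal : Ideal (H ⊗[K] H) :=
  Ideal.span (Set.range fun x : H => x ⊗ₜ[K] (1 : H) - (1 : H) ⊗ₜ[K] x)

/-- If the fibre of the finite family of commutative rings `H` at one point is local with residue field
`k`, then the ideal of the diagonal of `H` is nilpotent: some power of it vanishes at that point, and
all its powers are invariant under the connection. -/
theorem diagonalIdeal_pow_eq_bot (c : Conn k K H)
    (hc : ∀ θ x y, c.nabla θ (x * y) = c.nabla θ x * y + x * c.nabla θ y) (s : K →ₐ[k] k)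
    (h : ∀ x : H, ∃ (f : K) (N : ℕ),
      (x - algebraMap K H f) ^ N ∈ (RingHom.ker s : Ideal K) • (⊤ : Submodule K H)) :
    ∃ N : ℕ, diagonalIdeal K H ^ N = ⊥ := by
  have : IsNoetherianRing K := Algebra.FiniteType.isNoetherianRing k K
  have : IsNoetherianRing (H ⊗[K] H) := IsNoetherianRing.of_finite K _
  set m : Ideal K := RingHom.ker s
  have hmap : ∀ z : H ⊗[K] H, z ∈ m.map (algebraMap K (H ⊗[K] H)) ↔
      z ∈ m • (⊤ : Submodule K (H ⊗[K] H)) := fun z => by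
    rw [Ideal.smul_top_eq_map]; rfl
  have hl : ∀ x ∈ m • (⊤ : Submodule K H), x ⊗ₜ[K] (1 : H) ∈ m • (⊤ : Submodule K (H ⊗[K] H)) := by
    intro x hx
    have := Submodule.mem_map_of_mem
      (f := (Algebra.TensorProduct.includeLeft : H →ₐ[K] H ⊗[K] H).toLinearMap) hx
    rw [Submodule.map_smul''] at this
    exact Submodule.smul_mono le_rfl le_top this
  have hr : ∀ x ∈ m • (⊤ : Submodule K H), (1 : H) ⊗ₜ[K] x ∈ m • (⊤ : Submodule K (H ⊗[K] H)) := by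
    intro x hx
    have := Submodule.mem_map_of_mem
      (f := (Algebra.TensorProduct.includeRight : H →ₐ[K] H ⊗[K] H).toLinearMap) hx
    rw [Submodule.map_smul''] at this
    exact Submodule.smul_mono le_rfl le_top this
  have hrad : diagonalIdeal K H ≤ (m.map (algebraMap K (H ⊗[K] H))).radical := by
    refine Ideal.span_le.2 ?_
    rintro _ ⟨x, rfl⟩
    obtain ⟨f, N, hN⟩ := h x
    have e : x ⊗ₜ[K] (1 : H) - (1 : H) ⊗ₜ[K] x =
        (x - algebraMap K H f) ⊗ₜ[K] (1 : H) - (1 : H) ⊗ₜ[K] (x - algebraMap K H f) := by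
      rw [TensorProduct.sub_tmul, TensorProduct.tmul_sub, Algebra.algebraMap_eq_smul_one,
        TensorProduct.smul_tmul]
      abel
    change _ ∈ (m.map (algebraMap K (H ⊗[K] H))).radical
    rw [show (fun x : H => x ⊗ₜ[K] (1 : H) - (1 : H) ⊗ₜ[K] x) x = _ from e]
    refine sub_mem ⟨N, ?_⟩ ⟨N, ?_⟩
    · rw [hmap, Algebra.TensorProduct.tmul_pow, one_pow]
      exact hl _ hN
    · rw [hmap, Algebra.TensorProduct.tmul_pow, one_pow]
      exact hr _ hN
  obtain ⟨N, hN⟩ := Ideal.exists_pow_le_of_le_radical_of_fg hrad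
    (IsNoetherian.noetherian (diagonalIdeal K H))
  refine ⟨N, ?_⟩
  have hst1 : ∀ θ, ∀ z ∈ diagonalIdeal K H, c.tensor.nabla θ z ∈ diagonalIdeal K H := by
    intro θ z hz
    induction hz using Submodule.span_induction with
    | mem z hz =>
      obtain ⟨x, rfl⟩ := hz
      have h1 : c.nabla θ 1 = 0 := by
        have := hc θ 1 1
        simpa using this
      have : c.tensor.nabla θ (x ⊗ₜ[K] (1 : H) - (1 : H) ⊗ₜ[K] x) =
          c.nabla θ x ⊗ₜ[K] (1 : H) - (1 : H) ⊗ₜ[K] c.nabla θ x := by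
        rw [map_sub, Conn.tensor_tmul, Conn.tensor_tmul, h1]
        simp
      rw [show (fun x : H => x ⊗ₜ[K] (1 : H) - (1 : H) ⊗ₜ[K] x) x = _ from rfl, this]
      exact Ideal.subset_span ⟨c.nabla θ x, rfl⟩
    | zero => rw [map_zero]; exact zero_mem _
    | add x y _ _ hx hy => rw [map_add]; exact add_mem hx hy
    | smul a x hx hx' =>
      rw [smul_eq_mul, c.tensor_mul hc]
      exact add_mem (Ideal.mul_mem_left _ _ hx) (Ideal.mul_mem_left _ _ hx')
  have hst : ∀ N : ℕ, ∀ θ, ∀ z ∈ diagonalIdeal K H ^ N,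
      c.tensor.nabla θ z ∈ diagonalIdeal K H ^ N := by
    intro N θ
    induction N with
    | zero => intro z _; simp
    | succ N ih =>
      intro z hz
      rw [pow_succ] at hz ⊢
      induction hz using Submodule.mul_induction_on' with
      | mem_mul_mem x hx y hy =>
        rw [c.tensor_mul hc]
        exact add_mem (Ideal.mul_mem_mul (ih x hx) hy) (Ideal.mul_mem_mul hx (hst1 θ y hy))
      | add x _ y _ hx hy => rw [map_add]; exact add_mem hx hy
  have := c.tensor.eq_bot_of_le_smul s ((diagonalIdeal K H ^ N).restrictScalars K)
    (hst N) fun z hz => (hmap z).1 (hN hz)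
  rwa [Submodule.restrictScalars_eq_bot_iff] at this

/-- A finite family of commutative rings, with a connection which is a derivation of the product, has
local fibres if one fibre is local. -/
theorem isUnit_or_isNilpotent_of_conn (c : Conn k K H)
    (hc : ∀ θ x y, c.nabla θ (x * y) = c.nabla θ x * y + x * c.nabla θ y) (s s' : K →ₐ[k] k)
    (h : ∀ x : H, ∃ (f : K) (N : ℕ),
      (x - algebraMap K H f) ^ N ∈ (RingHom.ker s : Ideal K) • (⊤ : Submodule K H))
    {R : Type u} [Ring R] (φ : H →+* R) (hφ : Function.Surjective φ)
    (hφs : ∀ f, s' f = 0 → φ (algebraMap K H f) = 0) (x : R) : IsUnit x ∨ IsNilpotent x := by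
  obtain ⟨N, hN⟩ := diagonalIdeal_pow_eq_bot c hc s h
  -- every prime ideal of the fibre is the kernel of a character with values in `k`
  have hchar : ∀ P : Ideal H, P.IsPrime → RingHom.ker φ ≤ P →
      ∃ χ : H →+* k, (∀ x, χ x = 0 ↔ x ∈ P) ∧ ∀ f, χ (algebraMap K H f) = s' f := by
    intro P hP hle
    let ι : k →+* H ⧸ P := (algebraMap K (H ⧸ P)).comp (algebraMap k K)
    have hι : ∀ f, algebraMap K (H ⧸ P) f = ι (s' f) := by
      intro f
      have h0 : φ (algebraMap K H (f - algebraMap k K (s' f))) = 0 := hφs _ (by simp)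
      have h1 : Ideal.Quotient.mk P (algebraMap K H (f - algebraMap k K (s' f))) = 0 :=
        Ideal.Quotient.eq_zero_iff_mem.2 (hle h0)
      rw [map_sub, map_sub, sub_eq_zero] at h1
      exact h1
    letI : Algebra k (H ⧸ P) := ι.toAlgebra
    letI : Algebra K k := s'.toRingHom.toAlgebra
    have : IsScalarTower K k (H ⧸ P) := IsScalarTower.of_algebraMap_eq fun f => hι f
    have : Module.Finite k (H ⧸ P) := Module.Finite.of_restrictScalars_finite K k (H ⧸ P)
    have hb : Function.Bijective ι :=
      IsAlgClosed.algebraMap_bijective_of_isIntegral (k := k) (K := H ⧸ P)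
    let e : k ≃+* H ⧸ P := RingEquiv.ofBijective ι hb
    refine ⟨(e.symm : H ⧸ P →+* k).comp (Ideal.Quotient.mk P), fun x => ?_, fun f => ?_⟩
    · simp [Ideal.Quotient.eq_zero_iff_mem]
    · change e.symm (algebraMap K (H ⧸ P) f) = _
      rw [hι, RingEquiv.symm_apply_eq]
      rfl
  obtain ⟨x, rfl⟩ := hφ x
  by_contra! hx
  obtain ⟨hx1, hx2⟩ := hx
  obtain ⟨P₁, hP₁, hle₁, hxP₁⟩ : ∃ P : Ideal H, P.IsPrime ∧ RingHom.ker φ ≤ P ∧ x ∈ P := by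
    have : RingHom.ker φ ⊔ Ideal.span {x} ≠ ⊤ := by
      intro ht
      obtain ⟨y, hy, z, hz, hyz⟩ := Submodule.mem_sup.1 ((Ideal.eq_top_iff_one _).1 ht)
      obtain ⟨w, rfl⟩ := Ideal.mem_span_singleton'.1 hz
      have h1 := congrArg φ hyz
      rw [map_add, (RingHom.mem_ker).1 hy, zero_add, map_mul, map_one] at h1
      have h2 : φ x * φ w = 1 := by rw [← map_mul, mul_comm, map_mul, h1]
      exact hx1 ⟨⟨φ x, φ w, h2, h1⟩, rfl⟩
    obtain ⟨P, hP, hle⟩ := Ideal.exists_le_maximal _ this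
    exact ⟨P, hP.isPrime, le_sup_left.trans hle,
      hle (Ideal.mem_sup_right (Ideal.mem_span_singleton_self x))⟩
  obtain ⟨P₂, hP₂, hle₂, hxP₂⟩ : ∃ P : Ideal H, P.IsPrime ∧ RingHom.ker φ ≤ P ∧ x ∉ P := by
    have : x ∉ (RingHom.ker φ).radical := by
      rintro ⟨n, hn⟩
      exact hx2 ⟨n, by rw [← map_pow]; exact hn⟩
    rw [Ideal.radical_eq_sInf, Submodule.mem_sInf] at this
    push Not at this
    obtain ⟨P, ⟨hle, hP⟩, hx⟩ := this
    exact ⟨P, hP, hle, hx⟩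
  obtain ⟨χ₁, h₁, hf₁⟩ := hchar P₁ hP₁ hle₁
  obtain ⟨χ₂, h₂, hf₂⟩ := hchar P₂ hP₂ hle₂
  letI : Algebra K k := s'.toRingHom.toAlgebra
  let χ : H ⊗[K] H →ₐ[K] k := Algebra.TensorProduct.lift
    ({ χ₁ with commutes' := hf₁ } : H →ₐ[K] k) ({ χ₂ with commutes' := hf₂ } : H →ₐ[K] k)
    fun _ _ => Commute.all _ _
  have hmem : (x ⊗ₜ[K] (1 : H) - (1 : H) ⊗ₜ[K] x) ^ N ∈ diagonalIdeal K H ^ N :=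
    Ideal.pow_mem_pow (show _ ∈ diagonalIdeal K H from Ideal.subset_span ⟨x, rfl⟩) N
  rw [hN, Submodule.mem_bot] at hmem
  have h3 := congrArg χ hmem
  rw [map_pow, map_zero, map_sub] at h3
  have e₁ : χ (x ⊗ₜ[K] (1 : H)) = χ₁ x := by
    change χ₁ x * χ₂ 1 = _
    rw [map_one, mul_one]
  have e₂ : χ ((1 : H) ⊗ₜ[K] x) = χ₂ x := by
    change χ₁ 1 * χ₂ x = _
    rw [map_one, one_mul]
  rw [e₁, e₂, (h₁ x).2 hxP₁, zero_sub] at h3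
  have h4 := eq_zero_of_pow_eq_zero h3
  rw [neg_eq_zero, h₂] at h4
  exact hxP₂ h4

end LocalEnd

end

/-! ### The differential and composition of maps of modules -/

section

namespace Chain
variable {Ob : Type u} {H : Ob → Ob → ℤ → Type u} {E : Type v} [AddCommMonoid E]

/-- The ways of cutting a chain with a distinguished entry `a` into three pieces `l · w · r`, sorted by
the piece which contains `a`. -/
theorem splitSum₃_append_cons {X Y W Z : Ob} {n : ℤ} (p : Chain H Y Z) (a : H W Y n)
    (q : Chain H X W) (G : ∀ U V, Chain H U Z → Chain H V U → Chain H X V → E) :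
    ((p.append (cons a q)).splitSum fun U l w => w.splitSum fun V x r => G U V l x r) =
      (p.splitSum fun U l w => w.splitSum fun V x r => G U V l x (r.append (cons a q))) +
      (p.splitSum fun U l l' => q.splitSum fun V r' r => G U V l (l'.append (cons a r')) r) +
      (q.splitSum fun U l w => w.splitSum fun V x r => G U V (p.append (cons a l)) x r) := by
  rw [splitSum_append_cons]
  congr 1
  rw [← splitSum_add]
  exact splitSum_congr _ _ _ fun Y l r _ => splitSum_append_cons _ _ _ _

/-- A sum over cuts which only involves cuts in front of the last entry. -/
theorem splitSum_last {X Z : Ob} (p : Chain H X Z) (hp : 0 < p.length)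
    (G : ∀ Y, Chain H Y Z → Chain H X Y → E) (x : E)
    (h0 : ∀ Y l r, r.length ≠ 1 → G Y l r = 0)
    (h1 : ∀ Y n (a : H X Y n) l, l.append (cons a (nil X)) = p → G Y l (cons a (nil X)) = x) :
    p.splitSum G = x := by
  induction p with
  | nil => simp [length] at hp
  | @cons Y Z n a p ih =>
    simp only [splitSum]
    by_cases h : 0 < p.length
    · rw [h0 _ _ _ (by simp only [length]; omega), zero_add]
      exact ih h _ (fun Y l r hr => h0 Y _ r hr)
        fun Y n b l hl => h1 Y n b (cons a l) (by simp [append, hl])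
    · cases p with
      | nil =>
        simp only [splitSum]
        rw [h1 _ _ a (nil _) rfl, h0 _ _ _ (by simp [length]), add_zero]
      | cons b p => simp [length] at h

end Chain

namespace Maps
variable {k : Type u} [Field k] {A : AInfCat k} {K : Type u} [CommRing K] [Algebra k K]
variable {M N P Q : PreMod A K}

theorem cons_congr {E : Type*} {X Y Z : A.Ob} (F : Chain A.hom X Y → E) {W : A.Ob}
    (l : Chain A.hom Z Y) (q : Chain A.hom W Z) (r : Chain A.hom X W) {m n : ℤ} (h : m = n) :
    F (l.append (.cons (A.μ q m) r)) = F (l.append (.cons (A.μ q n) r)) := by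
  subst h; rfl

theorem append_cons_append {X Y Z U V W : A.Ob} {m n : ℤ} (l : Chain A.hom Z Y) (a : A.hom W Z m)
    (r : Chain A.hom V W) (b : A.hom U V n) (q : Chain A.hom X U) :
    l.append (.cons a (r.append (.cons b q))) = (l.append (.cons a r)).append (.cons b q) := by
  simp only [Chain.append_assoc, Chain.append]

/-- The part of the differential on morphisms which comes from the operations of `A`. -/
def aPart (t : Maps M N) : Maps M N := fun _ _ c i j =>
  c.splitSum fun _ l w => w.splitSum fun _ q r =>
    sgn (i + l.deg + q.deg) • t _ _ (l.append (.cons (A.μ q (q.deg + 2)) r)) i j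

theorem aPart_apply (t : Maps M N) {X Y : A.Ob} (c : Chain A.hom X Y) (i j : ℤ) (m : M.obj Y i) :
    aPart t X Y c i j m = c.splitSum fun _ l w => w.splitSum fun _ q r =>
      sgn (i + l.deg + q.deg) • t _ _ (l.append (.cons (A.μ q (q.deg + 2)) r)) i j m := by
  simp only [aPart, splitSum_apply]
  rfl

/-- The differential is the commutator with the module structures, plus the part coming from `A`. -/
theorem d_eq (n : ℤ) (t : Maps M N) :
    d n t = comp n (μMaps N) t + comp 1 t (μMaps M) + aPart t := rfl

/-- Composition is associative up to a sign. -/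
theorem comp_comp (n₁ n₂ : ℤ) (b₃ : Maps P Q) (b₂ : Maps N P) (b₁ : Maps M N) :
    comp n₁ (comp n₂ b₃ b₂) b₁ = sgn n₁ • comp (n₁ + n₂) b₃ (comp n₁ b₂ b₁) := by
  funext X Y c i j
  ext m
  change _ = sgn n₁ • comp (n₁ + n₂) b₃ (comp n₁ b₂ b₁) X Y c i j m
  simp only [comp_apply, map_splitSum_apply, zsmul_splitSum]
  rw [← Chain.splitSum_assoc]
  refine Chain.splitSum_congr _ _ _ fun W w r h => Chain.splitSum_congr _ _ _ fun Z l q h' => ?_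
  rw [map_zsmul, smul_smul, smul_smul, smul_smul,
    mid₂ _ _ _ l q r rfl (show i + l.deg + n₁ + q.deg + n₂ = i + w.deg + (n₁ + n₂) by omega)]
  congr 1
  rw [← sgn_add, ← sgn_add, ← sgn_add]
  exact sgn_congr ⟨0, by omega⟩

/-- A sequence of maps of degree `n`, additive and `k`-linear in all entries. In contrast to `IsHom`,
this includes the structure maps of a module and the contractions of connections. -/
structure IsPre (n : ℤ) (b : Maps M N) : Prop where
  smul : ∀ (X Y : A.Ob) (c : Chain A.hom X Y) (i j : ℤ) (t : k) (m : M.obj Y i),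
    b X Y c i j (algebraMap k K t • m) = algebraMap k K t • b X Y c i j m
  deg : ∀ (X Y : A.Ob) (c : Chain A.hom X Y) (i j : ℤ), j ≠ i + c.deg + n → b X Y c i j = 0
  multilinear : ∀ (X Y : A.Ob) (i j : ℤ),
    IsMultilinear k K fun c : Chain A.hom X Y => b X Y c i j

theorem IsHom.isPre {n : ℤ} {b : Maps M N} (h : IsHom n b) : IsPre n b :=
  ⟨fun X Y c i j _ m => h.smul X Y c i j _ m, h.deg, h.multilinear⟩

theorem isPre_μMaps (M : PreMod A K) : IsPre 1 (μMaps M) where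
  smul X Y c i j t m := map_smul (M.μ c i j) _ m
  deg X Y c i j h := by simp only [μMaps, M.μ_deg c i j h]; rfl
  multilinear X Y i j :=
    { map_add := fun p x y q => by simp only [μMaps, (M.μ_multilinear X Y i j).map_add]; rfl
      map_smul := fun p t x q => by simp only [μMaps, (M.μ_multilinear X Y i j).map_smul]; rfl }

theorem IsPre.add {n : ℤ} {b b' : Maps M N} (h : IsPre n b) (h' : IsPre n b') :
    IsPre n (b + b') where
  smul X Y c i j t m := by simp [h.smul, h'.smul]
  deg X Y c i j hj := by simp [h.deg X Y c i j hj, h'.deg X Y c i j hj]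
  multilinear X Y i j :=
    { map_add := fun p x y q => by
        simp only [Pi.add_apply, (h.multilinear X Y i j).map_add, (h'.multilinear X Y i j).map_add]
        abel
      map_smul := fun p t x q => by
        simp only [Pi.add_apply, (h.multilinear X Y i j).map_smul,
          (h'.multilinear X Y i j).map_smul, smul_add] }

theorem IsPre.zsmul {n : ℤ} {b : Maps M N} (h : IsPre n b) (z : ℤ) : IsPre n (z • b) where
  smul X Y c i j t m := by
    simp only [Pi.smul_apply, AddMonoidHom.smul_apply, h.smul]
    rw [smul_comm]
  deg X Y c i j hj := by simp [h.deg X Y c i j hj]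
  multilinear X Y i j :=
    { map_add := fun p x y q => by
        simp only [Pi.smul_apply, (h.multilinear X Y i j).map_add, smul_add]
      map_smul := fun p t x q => by
        simp only [Pi.smul_apply, (h.multilinear X Y i j).map_smul]
        rw [smul_comm] }

theorem IsPre.comp {n₁ n₂ : ℤ} {b₂ : Maps N P} {b₁ : Maps M N} (h₂ : IsPre n₂ b₂)
    (h₁ : IsPre n₁ b₁) : IsPre (n₁ + n₂) (comp n₁ b₂ b₁) where
  smul X Y c i j f m := by
    simp only [comp_apply, h₁.smul, h₂.smul, smul_comm _ (algebraMap k K f), splitSum_smul]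
  deg X Y c i j h := by
    ext m
    rw [comp_apply, Chain.splitSum_congr c _ (fun _ _ _ => 0), Chain.splitSum_zero]
    · rfl
    intro Z l r hlr
    rw [h₂.deg X Z r (i + l.deg + n₁) j (by omega)]
    simp
  multilinear X Y i j :=
    { map_add := fun {V W n} p x y q => by
        ext m
        simp only [comp_apply, AddMonoidHom.add_apply, Chain.splitSum_append_cons,
          (h₂.multilinear _ _ _ _).map_add, (h₁.multilinear _ _ _ _).map_add, smul_add, map_add,
          Chain.splitSum_add]
        rw [comp_aux b₂ b₁ p (x + y) x, comp_aux b₂ b₁ p (x + y) y]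
        abel
      map_smul := fun {V W n} p t x q => by
        ext m
        simp only [comp_apply, AddMonoidHom.smul_apply, Chain.splitSum_append_cons,
          (h₂.multilinear _ _ _ _).map_smul, (h₁.multilinear _ _ _ _).map_smul, smul_add,
          h₂.smul, smul_comm _ (algebraMap k K t), splitSum_smul]
        rw [comp_aux b₂ b₁ p (t • x) x] }

theorem isPre_aPart {n : ℤ} {b : Maps M N} (h : IsPre n b) : IsPre (n + 1) (aPart b) where
  smul X Y c i j f m := by
    simp only [aPart_apply, h.smul, smul_comm _ (algebraMap k K f), splitSum_smul]
  deg X Y c i j hj := by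
    ext m
    rw [aPart_apply, Chain.splitSum_congr c _ (fun _ _ _ => 0), Chain.splitSum_zero]
    · rfl
    intro Z l w hlw
    rw [Chain.splitSum_congr w _ (fun _ _ _ => 0), Chain.splitSum_zero]
    intro W q r hqr
    rw [h.deg _ _ _ i j (by rw [Chain.deg_append, Chain.deg]; omega)]
    simp
  multilinear X Y i j :=
    { map_add := fun {V W n} p x y q => by
        have hd : ∀ (U V' : A.Ob) (l' : Chain A.hom W U) (r' : Chain A.hom V' V) (z : A.hom V W n),
            (l'.append (.cons z r')).deg = (l'.append (.cons x r')).deg := fun U V' l' r' z => by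
          simp only [Chain.deg_append, Chain.deg]
        ext m
        simp only [aPart_apply, AddMonoidHom.add_apply, Chain.splitSum₃_append_cons]
        have e : ∀ a b c a' b' c' : N.obj X j, a + b + c + (a' + b' + c') =
            a + a' + (b + b') + (c + c') := fun _ _ _ _ _ _ => by abel
        rw [e]
        congr 1
        · congr 1
          · simp only [← Chain.splitSum_add]
            refine Chain.splitSum_congr _ _ _ fun _ l w _ => Chain.splitSum_congr _ _ _
              fun _ u r _ => ?_
            simp only [append_cons_append]
            rw [(h.multilinear _ _ _ _).map_add, AddMonoidHom.add_apply, smul_add]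
          · simp only [← Chain.splitSum_add]
            refine Chain.splitSum_congr _ _ _ fun _ l l' _ => Chain.splitSum_congr _ _ _
              fun _ r' r _ => ?_
            rw [cons_congr (fun c => b _ _ c i j) l (l'.append (.cons (x + y) r')) r
                (congrArg (· + 2) (hd _ _ l' r' (x + y))),
              cons_congr (fun c => b _ _ c i j) l (l'.append (.cons y r')) r
                (congrArg (· + 2) (hd _ _ l' r' y)), hd _ _ l' r' (x + y), hd _ _ l' r' y,
              (A.μ_multilinear _ _ _).map_add, (h.multilinear _ _ _ _).map_add,
              AddMonoidHom.add_apply, smul_add]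
        · simp only [← Chain.splitSum_add]
          refine Chain.splitSum_congr _ _ _ fun _ l w _ => Chain.splitSum_congr _ _ _
            fun _ u r _ => ?_
          simp only [← append_cons_append, hd _ _ _ _ (x + y), hd _ _ _ _ y]
          rw [(h.multilinear _ _ _ _).map_add, AddMonoidHom.add_apply, smul_add]
      map_smul := fun {V W n} p t x q => by
        have hd : ∀ (U V' : A.Ob) (l' : Chain A.hom W U) (r' : Chain A.hom V' V) (z : A.hom V W n),
            (l'.append (.cons z r')).deg = (l'.append (.cons x r')).deg := fun U V' l' r' z => by
          simp only [Chain.deg_append, Chain.deg]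
        ext m
        simp only [aPart_apply, AddMonoidHom.smul_apply, Chain.splitSum₃_append_cons, smul_add,
          ← splitSum_smul]
        congr 1
        · congr 1
          · refine Chain.splitSum_congr _ _ _ fun _ l w _ => Chain.splitSum_congr _ _ _
              fun _ u r _ => ?_
            simp only [append_cons_append]
            rw [(h.multilinear _ _ _ _).map_smul, smul_comm]
            rfl
          · refine Chain.splitSum_congr _ _ _ fun _ l l' _ => Chain.splitSum_congr _ _ _
              fun _ r' r _ => ?_
            rw [cons_congr (fun c => b _ _ c i j) l (l'.append (.cons (t • x) r')) r
                (congrArg (· + 2) (hd _ _ l' r' (t • x))), hd _ _ l' r' (t • x),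
              (A.μ_multilinear _ _ _).map_smul, Algebra.algebraMap_self, RingHom.id_apply,
              (h.multilinear _ _ _ _).map_smul, AddMonoidHom.smul_apply, smul_comm]
        · refine Chain.splitSum_congr _ _ _ fun _ l w _ => Chain.splitSum_congr _ _ _
            fun _ u r _ => ?_
          simp only [← append_cons_append, hd _ _ _ _ (t • x)]
          rw [(h.multilinear _ _ _ _).map_smul, smul_comm]
          rfl }

end Maps

end

/-! ### The square of the differential -/

section

namespace Chain
variable {Ob : Type u} {H : Ob → Ob → ℤ → Type u} {E : Type v} [AddCommMonoid E]

/-- Choosing in a chain a piece `q`, and then a piece `p` to the left of it, amounts to cutting the chain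
into five pieces. -/
theorem splitSum_disjoint {X Z : Ob} (c : Chain H X Z)
    (G : ∀ U' V' U V, Chain H U' Z → Chain H V' U' → Chain H U V' → Chain H V U → Chain H X V → E) :
    (c.splitSum fun U l w => w.splitSum fun V q r => l.splitSum fun U' l₁ v =>
      v.splitSum fun V' p l₂ => G U' V' U V l₁ p l₂ q r) =
    c.splitSum fun U' l₁ w => w.splitSum fun V' p w => w.splitSum fun U l₂ w =>
      w.splitSum fun V q r => G U' V' U V l₁ p l₂ q r := by
  have h1 : ∀ (U : Ob) (l : Chain H U Z) (w : Chain H X U),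
      (w.splitSum fun V q r => l.splitSum fun U' l₁ v =>
        v.splitSum fun V' p l₂ => G U' V' U V l₁ p l₂ q r) =
      l.splitSum fun U' l₁ v => v.splitSum fun V' p l₂ =>
        w.splitSum fun V q r => G U' V' U V l₁ p l₂ q r := by
    intro U l w
    rw [splitSum_comm w l fun V q r U' l₁ v =>
        v.splitSum fun V' p l₂ => G U' V' U V l₁ p l₂ q r]
    refine splitSum_congr _ _ _ fun U' l₁ v _ => ?_
    exact splitSum_comm w v fun V q r V' p l₂ => G U' V' U V l₁ p l₂ q r
  simp only [h1]
  rw [splitSum_assoc c fun U' U l₁ v w => v.splitSum fun V' p l₂ =>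
        w.splitSum fun V q r => G U V' U' V l₁ p l₂ q r]
  refine splitSum_congr _ _ _ fun U' l₁ w _ => ?_
  exact splitSum_assoc w fun U V' p l₂ w => w.splitSum fun V q r => G U' V' U V l₁ p l₂ q r

/-- Choosing in a chain a piece `q`, and then a larger piece `l₂ · q · r₁`, amounts to choosing the larger
piece first. -/
theorem splitSum_nested {X Z : Ob} (c : Chain H X Z)
    (G : ∀ U' U V V', Chain H U' Z → Chain H U U' → Chain H V U → Chain H V' V → Chain H X V' → E) :
    (c.splitSum fun U l w => w.splitSum fun V q r => l.splitSum fun U' l₁ l₂ =>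
      r.splitSum fun V' r₁ r₂ => G U' U V V' l₁ l₂ q r₁ r₂) =
    c.splitSum fun U' l₁ w => w.splitSum fun V' u r₂ => u.splitSum fun U l₂ v =>
      v.splitSum fun V q r₁ => G U' U V V' l₁ l₂ q r₁ r₂ := by
  have h1 : ∀ (U : Ob) (l : Chain H U Z) (w : Chain H X U),
      (w.splitSum fun V q r => l.splitSum fun U' l₁ l₂ =>
        r.splitSum fun V' r₁ r₂ => G U' U V V' l₁ l₂ q r₁ r₂) =
      l.splitSum fun U' l₁ l₂ => w.splitSum fun V q r =>
        r.splitSum fun V' r₁ r₂ => G U' U V V' l₁ l₂ q r₁ r₂ := fun U l w =>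
    splitSum_comm w l fun V q r U' l₁ l₂ => r.splitSum fun V' r₁ r₂ => G U' U V V' l₁ l₂ q r₁ r₂
  simp only [h1]
  rw [splitSum_assoc c fun U U' l₁ l₂ w => w.splitSum fun V q r =>
        r.splitSum fun V' r₁ r₂ => G U' U V V' l₁ l₂ q r₁ r₂]
  refine splitSum_congr _ _ _ fun U' l₁ w _ => ?_
  rw [splitSum_assoc w fun V' U l₂ v r₂ =>
      v.splitSum fun V q r₁ => G U' U V V' l₁ l₂ q r₁ r₂]
  refine splitSum_congr _ _ _ fun U l₂ x _ => ?_
  exact (splitSum_assoc x fun V' V q r₁ r₂ => G U' U V V' l₁ l₂ q r₁ r₂).symm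

end Chain

namespace Maps
variable {k : Type u} [Field k] {A : AInfCat k} {K : Type u} [CommRing K] [Algebra k K]
variable {M N P Q : PreMod A K}

/-- An additive function of chains, in one entry. -/
def slotHom {E : Type u} [AddCommGroup E] [Module K E] {X Y : A.Ob} {F : Chain A.hom X Y → E}
    (hF : IsMultilinear k K F) {W Z : A.Ob} (l : Chain A.hom Z Y) (r : Chain A.hom X W) (n : ℤ) :
    A.hom W Z n →+ E :=
  AddMonoidHom.mk' (fun a => F (l.append (.cons a r))) fun a b => hF.map_add l a b r

/-- The part of the differential coming from `A` squares to zero: insertions in disjoint places cancel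
in pairs, nested ones by the `A_∞`-relations of `A`. -/
theorem aPart_aPart {n : ℤ} {t : Maps M N} (h : IsPre n t) : aPart (aPart t) = 0 := by
  funext X Y c i j
  ext m
  rw [aPart_apply]
  simp only [aPart_apply, Chain.splitSum₃_append_cons, smul_add, Chain.splitSum_add, zsmul_splitSum]
  -- the two insertions are disjoint
  have h13 : (c.splitSum fun _ l w => w.splitSum fun _ q r => l.splitSum fun _ l₁ v =>
        v.splitSum fun _ p l₂ => sgn (i + l.deg + q.deg) • sgn (i + l₁.deg + p.deg) •
          t X Y (l₁.append (.cons (A.μ p (p.deg + 2)) (l₂.append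
            (.cons (A.μ q (q.deg + 2)) r)))) i j m) +
      (c.splitSum fun _ l w => w.splitSum fun _ q r => r.splitSum fun _ r₁ v =>
        v.splitSum fun _ p r₂ => sgn (i + l.deg + q.deg) •
          sgn (i + (l.append (.cons (A.μ q (q.deg + 2)) r₁)).deg + p.deg) •
          t X Y ((l.append (.cons (A.μ q (q.deg + 2)) r₁)).append
            (.cons (A.μ p (p.deg + 2)) r₂)) i j m) = 0 := by
    rw [add_eq_zero_iff_eq_neg, ← neg_one_smul ℤ]
    simp only [zsmul_splitSum]
    refine Eq.trans ?_ ((Chain.splitSum_disjoint c fun _ _ _ _ l₁ p l₂ q r =>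
      (-1 : ℤ) • sgn (i + l₁.deg + p.deg) •
        sgn (i + (l₁.append (.cons (A.μ p (p.deg + 2)) l₂)).deg + q.deg) •
          t X Y ((l₁.append (.cons (A.μ p (p.deg + 2)) l₂)).append
            (.cons (A.μ q (q.deg + 2)) r)) i j m).trans rfl)
    refine Chain.splitSum_congr _ _ _ fun _ l w _ => Chain.splitSum_congr _ _ _ fun _ q r _ =>
      Chain.splitSum_congr _ _ _ fun _ l₁ v hv => Chain.splitSum_congr _ _ _ fun _ p l₂ hp => ?_
    rw [append_cons_append, smul_smul, smul_smul, smul_smul, Chain.deg_append, Chain.deg]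
    congr 1
    rw [← sgn_one, ← sgn_add, ← sgn_add, ← sgn_add]
    exact sgn_congr ⟨-1, by omega⟩
  -- one insertion is nested in the other
  have h2 : (c.splitSum fun _ l w => w.splitSum fun _ q r => l.splitSum fun _ l₁ l₂ =>
        r.splitSum fun _ r₁ r₂ => sgn (i + l.deg + q.deg) •
          sgn (i + l₁.deg + (l₂.append (.cons (A.μ q (q.deg + 2)) r₁)).deg) •
          t X Y (l₁.append (.cons (A.μ (l₂.append (.cons (A.μ q (q.deg + 2)) r₁))
            ((l₂.append (.cons (A.μ q (q.deg + 2)) r₁)).deg + 2)) r₂)) i j m) = 0 := by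
    refine Eq.trans ?_ (Chain.splitSum_zero c)
    refine Eq.trans ?_ ((Chain.splitSum_nested c fun _ _ _ _ l₁ l₂ q r₁ r₂ =>
      sgn (i + (l₁.deg + l₂.deg) + q.deg) •
          sgn (i + l₁.deg + (l₂.append (.cons (A.μ q (q.deg + 2)) r₁)).deg) •
          t X Y (l₁.append (.cons (A.μ (l₂.append (.cons (A.μ q (q.deg + 2)) r₁))
            ((l₂.append (.cons (A.μ q (q.deg + 2)) r₁)).deg + 2)) r₂)) i j m).trans ?_)
    · refine Chain.splitSum_congr _ _ _ fun _ l w _ => Chain.splitSum_congr _ _ _ fun _ q r _ =>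
        Chain.splitSum_congr _ _ _ fun _ l₁ l₂ hl => ?_
      rw [hl]
    refine Chain.splitSum_congr _ _ _ fun _ l₁ w _ => ?_
    refine Eq.trans ?_ (Chain.splitSum_zero w)
    refine Chain.splitSum_congr _ _ _ fun _ u r₂ _ => ?_
    have h1 := congrArg (fun z => ((slotHom (h.multilinear X Y i j) l₁ r₂ (u.deg + 3)) z) m)
      (A.relation u (u.deg + 3))
    simp only [map_zero, AddMonoidHom.zero_apply] at h1
    rw [← smul_zero (-1 : ℤ), ← h1, Chain.map_splitSum, splitSum_apply, zsmul_splitSum]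
    refine Chain.splitSum_congr _ _ _ fun _ l₂ v _ => ?_
    rw [Chain.map_splitSum, splitSum_apply, zsmul_splitSum]
    refine Chain.splitSum_congr _ _ _ fun _ q r₁ _ => ?_
    have hd : (l₂.append (.cons (A.μ q (q.deg + 2)) r₁)).deg = u.deg + 1 := by
      rw [Chain.deg_append, Chain.deg]; omega
    rw [cons_congr (fun c => t X Y c i j) l₁ _ r₂ (show _ = u.deg + 3 by rw [hd]; ring), map_zsmul,
      hd]
    change _ = (-1 : ℤ) • sgn r₁.deg • t X Y (l₁.append _) i j m
    rw [smul_smul, smul_smul]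
    congr 1
    rw [← sgn_one, ← sgn_add, ← sgn_add]
    exact sgn_congr ⟨i + l₁.deg + l₂.deg + q.deg, by omega⟩
  rw [add_right_comm, h13, h2, add_zero]
  rfl

/-- The `A_∞`-module equations, as a Maurer-Cartan equation for the structure maps. -/
theorem maurer_cartan (hN : N.IsModule) :
    comp 1 (μMaps N) (μMaps N) + aPart (μMaps N) = 0 := by
  funext X Y c i j
  ext m
  have h := congrArg (fun z => sgn (i + c.deg) • z m) (hN.relation c i j)
  change comp 1 (μMaps N) (μMaps N) X Y c i j m + aPart (μMaps N) X Y c i j m = 0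
  simp only [LinearMap.add_apply, LinearMap.zero_apply, smul_zero, smul_add] at h
  rw [← h, comp_apply, aPart_apply]
  have e : ∀ z : N.obj Y i →ₗ[K] N.obj X j,
    z m = ((LinearMap.applyₗ m : (N.obj Y i →ₗ[K] N.obj X j) →ₗ[K] N.obj X j)).toAddMonoidHom z :=
    fun z => rfl
  congr 1
  · rw [e, Chain.map_splitSum, zsmul_splitSum]
    refine Chain.splitSum_congr _ _ _ fun _ l r hlr => ?_
    rw [← e, LinearMap.smul_apply, smul_smul]
    change _ = (sgn (i + c.deg) * sgn r.deg) • μMaps N _ _ r _ j (μMaps N _ _ l i _ m)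
    congr 1
    rw [← sgn_add]
    exact sgn_congr ⟨-r.deg, by omega⟩
  · rw [e, Chain.map_splitSum, zsmul_splitSum]
    refine Chain.splitSum_congr _ _ _ fun _ l w hlw => ?_
    rw [Chain.map_splitSum, zsmul_splitSum]
    refine Chain.splitSum_congr _ _ _ fun _ q r hqr => ?_
    rw [← e, LinearMap.smul_apply, smul_smul]
    change _ = (sgn (i + c.deg) * sgn r.deg) • μMaps N _ _ _ _ j m
    congr 1
    rw [← sgn_add]
    exact sgn_congr ⟨-r.deg, by omega⟩

theorem neg_comp (n : ℤ) (b : Maps N P) (b₁ : Maps M N) : comp n (-b) b₁ = -comp n b b₁ := by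
  have := smul_comp n (-1 : K) b b₁
  simpa using this

theorem comp_neg (n : ℤ) (b : Maps N P) (b₁ : Maps M N) : comp n b (-b₁) = -comp n b b₁ := by
  rw [eq_neg_iff_add_eq_zero, ← comp_add, neg_add_cancel, comp_zero]

/-- The square of the differential is zero. -/
theorem d_d (hM : M.IsModule) (hN : N.IsModule) {n : ℤ} {b : Maps M N} (hb : IsPre n b) :
    d (n + 1) (d n b) = 0 := by
  have h1 := d_comp n 1 (μMaps N) b
  have h2 := d_comp 1 n b (μMaps M)
  have hdN : d 1 (μMaps N) = comp 1 (μMaps N) (μMaps N) := by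
    rw [d_eq, add_assoc, maurer_cartan hN, add_zero]
  have hdM : d 1 (μMaps M) = comp 1 (μMaps M) (μMaps M) := by
    rw [d_eq, add_assoc, maurer_cartan hM, add_zero]
  rw [hdN, comp_comp, smul_smul, sgn_mul_self, one_smul] at h1
  rw [hdM, sgn_one, add_comm 1 n] at h2
  have h3 : d (n + 1) (aPart b) = comp (n + 1) (μMaps N) (aPart b) + comp 1 (aPart b) (μMaps M) := by
    rw [d_eq, aPart_aPart hb, add_zero]
  have h4 := comp_comp 1 n (μMaps N) b (μMaps M)
  have h5 := comp_comp 1 1 b (μMaps M) (μMaps M)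
  rw [sgn_one, add_comm 1 n] at h4
  rw [sgn_one] at h5
  have e : d (n + 1) (d n b) = d (n + 1) (comp n (μMaps N) b) + d (n + 1) (comp 1 b (μMaps M)) +
      d (n + 1) (aPart b) := by
    rw [d_eq n b, map_add, map_add]
  rw [e, h1, h2, h3, d_eq n b]
  simp only [comp_add, add_comp, h4, h5, neg_smul, one_smul]
  abel

theorem append_nil {X Y : A.Ob} (p : Chain A.hom X Y) : p.append (.nil X) = p := by
  induction p with
  | nil => rfl
  | cons a p ih => simp [Chain.append, ih]

/-- The differential preserves the (strictly unital) morphism complex. -/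
theorem isHom_d (hM : M.IsModule) (hN : N.IsModule) {n : ℤ} {b : Maps M N} (hb : IsHom n b) :
    IsHom (n + 1) (d n b) := by
  have hpre : IsPre (n + 1) (d n b) := by
    rw [d_eq]
    refine ((by simpa only [add_comm] using (isPre_μMaps N).comp hb.isPre : IsPre (n + 1) _).add
      (by simpa only [add_comm] using hb.isPre.comp (isPre_μMaps M) : IsPre (n + 1) _)).add
      (isPre_aPart hb.isPre)
  refine ⟨fun X Y c i j f m => ?_, hpre.deg, hpre.multilinear, fun X Y Z p q i j => ?_⟩
  · have h1 : ∀ (N : PreMod A K) (X Y : A.Ob) (c : Chain A.hom X Y) (i j : ℤ) (m : N.obj Y i),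
      μMaps N X Y c i j (f • m) = f • μMaps N X Y c i j m := fun N X Y c i j m =>
        map_smul (N.μ c i j) f m
    simp only [d_apply, hb.smul, h1, smul_comm _ f, splitSum_smul, smul_add]
  · ext m
    -- all the surviving terms are `b` applied to the chain with the identity removed
    set x : N.obj X j := sgn (i + p.deg) • b X Z (p.append q) i j m with hx
    have e1 : comp n (μMaps N) b X Z (p.append (.cons (A.e Y) q)) i j m =
        if q.length = 0 then x else 0 := by
      rw [comp_apply, Chain.splitSum_append_cons]
      have hz : (q.splitSum fun V l r => sgn (i + (p.append (.cons (A.e Y) l)).deg) •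
          μMaps N X V r (i + (p.append (.cons (A.e Y) l)).deg + n) j
            (b V Z (p.append (.cons (A.e Y) l)) i
              (i + (p.append (.cons (A.e Y) l)).deg + n) m)) = 0 := by
        simp [hb.unital, Chain.splitSum_zero]
      rw [hz, add_zero]
      split_ifs with h
      · cases q with
        | cons a q => simp [Chain.length] at h
        | nil =>
          rw [Chain.splitSum_nil_right]
          · rw [hx, append_nil]
            congr 1
            by_cases hj : i + p.deg + n = j
            · subst hj
              exact LinearMap.congr_fun (hN.μ_e X (i + p.deg + n)) _
            · rw [hb.deg _ _ p i j (fun h => hj h.symm)]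
              have := N.μ_deg (.cons (A.e X) (.nil X)) (i + p.deg + n) j
                (by simp only [Chain.deg]; omega)
              exact LinearMap.congr_fun this _
          · intro V l r hr
            have := hN.μ_higher_e r (.nil X) (i + l.deg + n) j (by omega)
            exact (congrArg (fun z => sgn (i + l.deg) • z (b V Z l i (i + l.deg + n) m)) this).trans
              (smul_zero _)
      · rw [Chain.splitSum_congr p _ (fun _ _ _ => 0), Chain.splitSum_zero]
        intro V l r _
        have := hN.μ_higher_e r q (i + l.deg + n) j (by omega)
        exact (congrArg (fun z => sgn (i + l.deg) • z (b V Z l i (i + l.deg + n) m)) this).trans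
          (smul_zero _)
    have e2 : comp 1 b (μMaps M) X Z (p.append (.cons (A.e Y) q)) i j m =
        if p.length = 0 then -x else 0 := by
      rw [comp_apply, Chain.splitSum_append_cons]
      have hz : (p.splitSum fun V l r => sgn (i + l.deg) •
          b X V (r.append (.cons (A.e Y) q)) (i + l.deg + 1) j
            (μMaps M V Z l i (i + l.deg + 1) m)) = 0 := by
        simp [hb.unital, Chain.splitSum_zero]
      rw [hz, zero_add]
      split_ifs with h
      · cases p with
        | cons a p => simp [Chain.length] at h
        | nil =>
          rw [Chain.splitSum_nil_left]
          · rw [hx, ← neg_one_smul ℤ, smul_smul, ← sgn_one, ← sgn_add,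
              mid b (μMaps M) _ q (show i + ((Chain.nil Y).append
                (.cons (A.e Y) (.nil Y))).deg + 1 = i by simp [Chain.append, Chain.deg])]
            congr 1
            · exact sgn_congr ⟨-1, by simp only [Chain.append, Chain.deg]; ring⟩
            · exact congrArg _ (LinearMap.congr_fun (hM.μ_e Y i) m)
          · intro V l r hl
            have := hM.μ_higher_e (.nil Y) l i
              (i + ((Chain.nil Y).append (.cons (A.e Y) l)).deg + 1) (by omega)
            exact (congrArg (fun z => sgn _ • b X V r _ j (z m)) this).trans
              (by rw [LinearMap.zero_apply, map_zero, smul_zero])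
      · rw [Chain.splitSum_congr q _ (fun _ _ _ => 0), Chain.splitSum_zero]
        intro V l r _
        have := hM.μ_higher_e p l i (i + (p.append (.cons (A.e Y) l)).deg + 1) (by omega)
        exact (congrArg (fun z => sgn _ • b X V r _ j (z m)) this).trans
          (by rw [LinearMap.zero_apply, map_zero, smul_zero])
    have e3 : aPart b X Z (p.append (.cons (A.e Y) q)) i j m =
        (if p.length = 0 then 0 else -x) + if q.length = 0 then 0 else x := by
      rw [aPart_apply, Chain.splitSum₃_append_cons]
      have hz1 : (p.splitSum fun _ l w => w.splitSum fun _ u r => sgn (i + l.deg + u.deg) •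
          b X Z (l.append (.cons (A.μ u (u.deg + 2)) (r.append (.cons (A.e Y) q)))) i j m) = 0 := by
        simp [append_cons_append, hb.unital, Chain.splitSum_zero]
      have hz2 : (q.splitSum fun _ l w => w.splitSum fun _ u r =>
          sgn (i + (p.append (.cons (A.e Y) l)).deg + u.deg) •
          b X Z ((p.append (.cons (A.e Y) l)).append (.cons (A.μ u (u.deg + 2)) r)) i j m) = 0 := by
        simp [← append_cons_append, hb.unital, Chain.splitSum_zero]
      rw [hz1, hz2, zero_add, add_zero]
      let T : ∀ (U V : A.Ob) (l : Chain A.hom U Z) (l' : Chain A.hom Y U) (r' : Chain A.hom V Y)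
        (r : Chain A.hom X V), N.obj X j := fun U V l l' r' r =>
        sgn (i + l.deg + (l'.append (.cons (A.e Y) r')).deg) •
          b X Z (l.append (.cons (A.μ (l'.append (.cons (A.e Y) r'))
            ((l'.append (.cons (A.e Y) r')).deg + 2)) r)) i j m
      have hT : ∀ U V l l' r' r, l'.length + r'.length ≠ 1 → T U V l l' r' r = 0 := by
        intro U V l l' r' r h
        have h0 : A.μ (l'.append (.cons (A.e Y) r')) ((l'.append (.cons (A.e Y) r')).deg + 2) = 0 := by
          by_cases h' : 2 ≤ l'.length + r'.length
          · exact A.μ_higher_e _ _ _ h'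
          · cases l' with
            | cons a l' => simp only [Chain.length] at h h'; omega
            | nil =>
              cases r' with
              | cons a r' => simp only [Chain.length] at h h'; omega
              | nil => exact A.μ_e _ _
        have h1 := congrArg (fun z => z m) (map_zero (slotHom (hb.multilinear X Z i j) l r
          ((l'.append (.cons (A.e Y) r')).deg + 2)))
        change sgn _ • b X Z _ i j m = 0
        rw [h0]
        exact (congrArg _ h1).trans (smul_zero _)
      change (p.splitSum fun U l l' => q.splitSum fun V r' r => T U V l l' r' r) = _
      -- the terms in which `e` is multiplied with the entry to its left
      have hL : (p.splitSum fun U l l' => q.splitSum fun V r' r =>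
          if r'.length = 0 then T U V l l' r' r else 0) = if p.length = 0 then 0 else -x := by
        split_ifs with h
        · cases p with
          | cons a p => simp [Chain.length] at h
          | nil =>
            simp only [Chain.splitSum]
            rw [Chain.splitSum_congr q _ (fun _ _ _ => 0), Chain.splitSum_zero]
            intro V l r _
            split_ifs with h1
            · exact hT _ _ _ _ _ _ (by simp [Chain.length, h1])
            · rfl
        · refine Chain.splitSum_last p (by omega) _ _ (fun U l l' hl' => ?_) fun U t a l hl => ?_
          · rw [Chain.splitSum_congr q _ (fun _ _ _ => 0), Chain.splitSum_zero]
            intro V r' r _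
            split_ifs with h1
            · exact hT _ _ _ _ _ _ (by omega)
            · rfl
          · rw [Chain.splitSum_nil_left]
            · rw [if_pos (show (Chain.nil Y : Chain A.hom Y Y).length = 0 from rfl)]
              change sgn (i + l.deg + (t - 1 + (0 - 1 + 0))) • b X Z (l.append (.cons
                (A.μ (.cons a (.cons (A.e Y) (.nil Y))) (t - 1 + (0 - 1 + 0) + 2)) q)) i j m = _
              rw [cons_congr (fun c => b X Z c i j) l _ q (show t - 1 + (0 - 1 + 0) + 2 = t by ring),
                A.μ_right_e, hx, ← neg_one_smul ℤ, smul_smul, ← hl, Chain.append_assoc,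
                Chain.deg_append, ← sgn_one, ← sgn_add]
              congr 1
              exact sgn_congr ⟨-1, by simp only [Chain.deg]; ring⟩
            · intro V r' r hr'
              rw [if_neg (by omega)]
      -- the terms in which `e` is multiplied with the entry to its right
      have hR : (p.splitSum fun U l l' => q.splitSum fun V r' r =>
          if r'.length = 0 then 0 else T U V l l' r' r) = if q.length = 0 then 0 else x := by
        rw [Chain.splitSum_nil_right]
        · split_ifs with h
          · cases q with
            | cons a q => simp [Chain.length] at h
            | nil => simp [Chain.splitSum, Chain.length]
          · cases q with
            | nil => simp [Chain.length] at h
            | @cons W Y t a q =>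
              simp only [Chain.splitSum]
              rw [if_pos (by simp [Chain.length]), zero_add, Chain.splitSum_nil_left]
              · rw [if_neg (by simp [Chain.length])]
                change sgn (i + p.deg + (0 - 1 + (t - 1 + 0))) • b X Z (p.append (.cons
                  (A.μ (.cons (A.e _) (.cons a (.nil _))) (0 - 1 + (t - 1 + 0) + 2)) q)) i j m = _
                rw [cons_congr (fun c => b X Z c i j) p _ q
                  (show 0 - 1 + (t - 1 + 0) + 2 = t by ring), A.μ_left_e]
                have h1 := congrArg (fun z => z m) (map_zsmul (slotHom (hb.multilinear X Z i j) p q t)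
                  (sgn t) a)
                refine (congrArg _ h1).trans ?_
                change sgn _ • sgn t • b X Z (p.append (.cons a q)) i j m = _
                rw [smul_smul, ← sgn_add]
                congr 1
                exact sgn_congr ⟨t - 1, by ring⟩
              · intro V l r hl
                rw [if_neg (by simp [Chain.length])]
                exact hT _ _ _ _ _ _ (by simp only [Chain.length]; omega)
        · intro U l l' hl'
          rw [Chain.splitSum_congr q _ (fun _ _ _ => 0), Chain.splitSum_zero]
          intro V r' r _
          split_ifs with h1
          · rfl
          · exact hT _ _ _ _ _ _ (by omega)
      rw [← hL, ← hR, ← Chain.splitSum_add]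
      refine Chain.splitSum_congr _ _ _ fun U l l' _ => ?_
      rw [← Chain.splitSum_add]
      refine Chain.splitSum_congr _ _ _ fun V r' r _ => ?_
      split_ifs <;> simp
    change comp n (μMaps N) b X Z (p.append (.cons (A.e Y) q)) i j m +
      comp 1 b (μMaps M) X Z (p.append (.cons (A.e Y) q)) i j m +
      aPart b X Z (p.append (.cons (A.e Y) q)) i j m = 0
    rw [e1, e2, e3]
    split_ifs <;> abel

end Maps

end

/-! ### Contraction with derivations, and insertion of the deformation cocycle -/

section

variable {k : Type u} [Field k] {A : AInfCat k} {K : Type u} [CommRing K] [Algebra k K]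

/-- The deformation cocycle, contracted with a derivation of `K`. -/
def DeformationCocycle.contr (γ : DeformationCocycle A K) (θ : Derivation k K K) {X Y : A.Ob}
    (c : Chain A.hom X Y) (n : ℤ) : K ⊗[k] A.hom X Y n :=
  (θ.liftKaehlerDifferential.restrictScalars k).rTensor _ (γ.γ c n)

/-- The Hochschild cocycle equation, contracted with a derivation. -/
theorem DeformationCocycle.contr_closed (γ : DeformationCocycle A K) (θ : Derivation k K K)
    {X Y : A.Ob} (c : Chain A.hom X Y) (n : ℤ) :
    (c.splitSum fun _ l w => w.splitSum fun _ q r =>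
      (A.slot l r (q.deg + 1) n).lTensor K (γ.contr θ q (q.deg + 1))) =
    c.splitSum fun _ l w => w.splitSum fun _ q r =>
      sgn r.deg • γ.contr θ (l.append (.cons (A.μ q (q.deg + 2)) r)) n := by
  have h := congrArg ((θ.liftKaehlerDifferential.restrictScalars k).rTensor
    (A.hom X Y n)).toAddMonoidHom (γ.closed c n)
  rw [map_zero, Chain.map_splitSum] at h
  rw [← sub_eq_zero, ← h, sub_eq_add_neg, ← neg_one_smul ℤ, Maps.zsmul_splitSum,
    ← Chain.splitSum_add]
  refine Chain.splitSum_congr _ _ _ fun _ l w _ => ?_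
  rw [Chain.map_splitSum, Maps.zsmul_splitSum, ← Chain.splitSum_add]
  refine Chain.splitSum_congr _ _ _ fun _ q r _ => ?_
  rw [map_sub, map_zsmul, neg_one_smul, ← sub_eq_add_neg]
  congr 1
  change (A.slot l r (q.deg + 1) n).lTensor K
    ((θ.liftKaehlerDifferential.restrictScalars k).rTensor _ (γ.γ q (q.deg + 1))) =
    (θ.liftKaehlerDifferential.restrictScalars k).rTensor _
      ((A.slot l r (q.deg + 1) n).lTensor _ (γ.γ q (q.deg + 1)))
  rw [← LinearMap.comp_apply, ← LinearMap.comp_apply, LinearMap.lTensor_comp_rTensor,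
    LinearMap.rTensor_comp_lTensor]

namespace Maps
variable {M N P Q : PreMod A K}

section plug
variable {E : Type u} [AddCommGroup E] [Module K E] {X Y : A.Ob} {F : Chain A.hom X Y → E}

/-- The additive map taking `f ⊗ a` to `f • F(l, a, r)`. -/
def plugK (hF : IsMultilinear k K F) {Z W : A.Ob} (l : Chain A.hom Z Y) (r : Chain A.hom X W)
    (n : ℤ) : K ⊗[k] A.hom W Z n →+ E :=
  TensorProduct.liftAddHom
    (AddMonoidHom.mk' (fun f => (DistribSMul.toAddMonoidHom E f).comp (slotHom hF l r n))
      fun f g => by ext a; simp [add_smul])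
    fun t f a => by
      change (t • f) • F (l.append (.cons a r)) = f • F (l.append (.cons (t • a) r))
      rw [hF.map_smul, smul_smul, Algebra.smul_def, mul_comm]

theorem plugK_tmul (hF : IsMultilinear k K F) {Z W : A.Ob} (l : Chain A.hom Z Y)
    (r : Chain A.hom X W) (n : ℤ) (f : K) (a : A.hom W Z n) :
    plugK hF l r n (f ⊗ₜ a) = f • F (l.append (.cons a r)) := rfl

theorem plugK_congr (hF : IsMultilinear k K F) {Z W : A.Ob} (l : Chain A.hom Z Y)
    (r : Chain A.hom X W) {m n : ℤ} (h : m = n) (γ : DeformationCocycle A K) (θ : Derivation k K K)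
    (q : Chain A.hom W Z) :
    plugK hF l r m (γ.contr θ q m) = plugK hF l r n (γ.contr θ q n) := by
  subst h; rfl

theorem plugK_eq_zero (hF : IsMultilinear k K F) {Z W : A.Ob} (l : Chain A.hom Z Y)
    (r : Chain A.hom X W) (n : ℤ) (h : ∀ a : A.hom W Z n, F (l.append (.cons a r)) = 0)
    (x : K ⊗[k] A.hom W Z n) : plugK hF l r n x = 0 := by
  induction x using TensorProduct.induction_on with
  | zero => exact map_zero _
  | tmul f a => rw [plugK_tmul, h, smul_zero]
  | add x y hx hy => rw [map_add, hx, hy, add_zero]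

end plug

/-- `b` is additive and `k`-linear in the entries of the chain. -/
abbrev Multi (b : Maps M N) : Prop :=
  ∀ X Y i j, IsMultilinear k K fun c : Chain A.hom X Y => b X Y c i j

/-- The insertion of the deformation cocycle, contracted with a derivation of `K`, into `b`:
`(m, a_{d-1}, …, a_1) ↦ - ∑ b(m, l, γ(q), r)`. -/
def ins (γ : DeformationCocycle A K) (θ : Derivation k K K) (b : Maps M N) (hb : Multi b) :
    Maps M N := fun X Y c i j =>
  -(c.splitSum fun _ l w => w.splitSum fun _ q r =>
    plugK (hb X Y i j) l r (q.deg + 1) (γ.contr θ q (q.deg + 1)))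

theorem ins_apply (γ : DeformationCocycle A K) (θ : Derivation k K K) (b : Maps M N) (hb : Multi b)
    {X Y : A.Ob} (c : Chain A.hom X Y) (i j : ℤ) (m : M.obj Y i) :
    ins γ θ b hb X Y c i j m = -(c.splitSum fun _ l w => w.splitSum fun _ q r =>
      plugK (hb X Y i j) l r (q.deg + 1) (γ.contr θ q (q.deg + 1)) m) := by
  simp only [ins, AddMonoidHom.neg_apply, splitSum_apply]

theorem ins_congr (γ : DeformationCocycle A K) (θ : Derivation k K K) {b b' : Maps M N} (h : b = b')
    (hb : Multi b) (hb' : Multi b') : ins γ θ b hb = ins γ θ b' hb' := by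
  subst h; rfl

/-- Contraction of `Ω ⊗ E` with a derivation. -/
def ctr₀ (θ : Derivation k K K) (E : Type u) [AddCommGroup E] [Module K E] :
    Ω[K⁄k] ⊗[K] E →ₗ[K] E :=
  (TensorProduct.lid K E).toLinearMap ∘ₗ θ.liftKaehlerDifferential.rTensor E

theorem ctr₀_tmul (θ : Derivation k K K) (E : Type u) [AddCommGroup E] [Module K E] (ω : Ω[K⁄k])
    (x : E) : ctr₀ θ E (ω ⊗ₜ x) = θ.liftKaehlerDifferential ω • x := rfl

/-- Contraction of a map to `Ω ⊗ N` with a derivation. -/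
def ctr (θ : Derivation k K K) (t : Maps M N.omega) : Maps M N := fun X Y c i j =>
  (ctr₀ θ (N.obj X j)).toAddMonoidHom.comp (t X Y c i j)

theorem ctr_apply (θ : Derivation k K K) (t : Maps M N.omega) {X Y : A.Ob} (c : Chain A.hom X Y)
    (i j : ℤ) (m : M.obj Y i) : ctr θ t X Y c i j m = ctr₀ θ (N.obj X j) (t X Y c i j m) := rfl

theorem ctr₀_lTensor (θ : Derivation k K K) {E F : Type u} [AddCommGroup E] [Module K E]
    [AddCommGroup F] [Module K F] (g : E →ₗ[K] F) (x : Ω[K⁄k] ⊗[K] E) :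
    ctr₀ θ F (TensorProduct.AlgebraTensorModule.lTensor K Ω[K⁄k] g x) = g (ctr₀ θ E x) := by
  induction x using TensorProduct.induction_on with
  | zero => simp
  | tmul ω x =>
    rw [TensorProduct.AlgebraTensorModule.lTensor_tmul, ctr₀_tmul, ctr₀_tmul, map_smul]
  | add x y hx hy => rw [map_add, map_add, hx, hy, map_add, map_add]

theorem ctr_comp (θ : Derivation k K K) (n : ℤ) (D : Maps N P.omega) (b : Maps M N) :
    ctr θ (comp n D b) = comp n (ctr θ D) b := by
  funext X Y c i j
  ext m
  rw [ctr_apply, comp_apply, comp_apply]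
  change (ctr₀ θ (P.obj X j)).toAddMonoidHom _ = _
  rw [Chain.map_splitSum]
  refine Chain.splitSum_congr _ _ _ fun _ l r _ => ?_
  rw [map_zsmul]
  rfl

theorem ctr_comp_tensorMap (θ : Derivation k K K) {n : ℤ} {b : Maps N P} (hb : IsHom n b) (m : ℤ)
    (D : Maps M N.omega) :
    ctr θ (comp m (tensorMap K Ω[K⁄k] hb) D) = comp m b (ctr θ D) := by
  funext X Y c i j
  ext x
  rw [ctr_apply, comp_apply, comp_apply]
  change (ctr₀ θ (P.obj X j)).toAddMonoidHom _ = _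
  rw [Chain.map_splitSum]
  refine Chain.splitSum_congr _ _ _ fun _ l r _ => ?_
  rw [map_zsmul]
  exact congrArg _ (ctr₀_lTensor θ (toLin hb r _ j) _)

theorem ctr_d (θ : Derivation k K K) (n : ℤ) (t : Maps M N.omega) :
    ctr θ (d n t) = d n (ctr θ t) := by
  funext X Y c i j
  ext m
  rw [ctr_apply, d_apply, d_apply, map_add, map_add]
  congr 1
  · congr 1
    · change (ctr₀ θ (N.obj X j)).toAddMonoidHom _ = _
      rw [Chain.map_splitSum]
      refine Chain.splitSum_congr _ _ _ fun _ l r _ => ?_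
      rw [map_zsmul]
      exact congrArg _ (ctr₀_lTensor θ (N.μ r _ j) _)
    · change (ctr₀ θ (N.obj X j)).toAddMonoidHom _ = _
      rw [Chain.map_splitSum]
      refine Chain.splitSum_congr _ _ _ fun _ l r _ => ?_
      rw [map_zsmul]
      rfl
  · change (ctr₀ θ (N.obj X j)).toAddMonoidHom _ = _
    rw [Chain.map_splitSum]
    refine Chain.splitSum_congr _ _ _ fun _ l r _ => ?_
    rw [Chain.map_splitSum]
    refine Chain.splitSum_congr _ _ _ fun _ q r _ => ?_
    rw [map_zsmul]
    rfl

theorem ctr_add (θ : Derivation k K K) (s t : Maps M N.omega) :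
    ctr θ (s + t) = ctr θ s + ctr θ t := by
  funext X Y c i j
  ext m
  exact map_add (ctr₀ θ (N.obj X j)) _ _

theorem ctr_zsmul (θ : Derivation k K K) (z : ℤ) (t : Maps M N.omega) :
    ctr θ (z • t) = z • ctr θ t := by
  funext X Y c i j
  ext m
  exact map_zsmul (ctr₀ θ (N.obj X j)) _ _

theorem ctr_smul (θ : Derivation k K K) (f : K) (t : Maps M N.omega) :
    ctr θ (f • t) = f • ctr θ t := by
  funext X Y c i j
  ext m
  exact map_smul (ctr₀ θ (N.obj X j)) _ _

theorem ctr_contract (γ : DeformationCocycle A K) (θ : Derivation k K K) (b : Maps M N)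
    (hb : Multi b) : ctr θ (contract γ b hb) = ins γ θ b hb := by
  funext X Y c i j
  ext m
  have key : ∀ {Z W : A.Ob} (l : Chain A.hom Z Y) (r : Chain A.hom X W) (n : ℤ)
      (x : Ω[K⁄k] ⊗[k] A.hom W Z n), ctr₀ θ (N.obj X j) (plug b hb l r n i j x m) =
      plugK (hb X Y i j) l r n ((θ.liftKaehlerDifferential.restrictScalars k).rTensor _ x) m := by
    intro Z W l r n x
    induction x using TensorProduct.induction_on with
    | zero => simp
    | tmul ω a => rfl
    | add x y hx hy => simp only [map_add, AddMonoidHom.add_apply, hx, hy]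
  rw [ctr_apply, ins_apply]
  simp only [contract, AddMonoidHom.neg_apply, splitSum_apply, map_neg]
  congr 1
  change (ctr₀ θ (N.obj X j)).toAddMonoidHom _ = _
  rw [Chain.map_splitSum]
  refine Chain.splitSum_congr _ _ _ fun _ l w _ => ?_
  rw [Chain.map_splitSum]
  refine Chain.splitSum_congr _ _ _ fun _ q r _ => ?_
  exact key l r _ _

end Maps

end

/-! ### Insertion of the cocycle is a derivation -/

section

namespace Maps
variable {k : Type u} [Field k] {A : AInfCat k} {K : Type u} [CommRing K] [Algebra k K]
variable {M N P Q : PreMod A K}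

theorem splitSum_neg {E : Type*} [AddCommGroup E] {X Z : A.Ob} (c : Chain A.hom X Z)
    (G : ∀ Y, Chain A.hom Y Z → Chain A.hom X Y → E) :
    (c.splitSum fun Y l r => -G Y l r) = -c.splitSum G := by
  rw [← neg_one_smul ℤ, zsmul_splitSum]
  simp

/-- The places in a composition where an entry can be inserted: the second factor or the first one. -/
theorem plugK_comp {b₂ : Maps N P} {b₁ : Maps M N} (n₁ : ℤ) (h₂ : Multi b₂) (h₁ : Multi b₁)
    (h : Multi (comp n₁ b₂ b₁))
    (hK : ∀ (X Y : A.Ob) (c : Chain A.hom X Y) (i j : ℤ) (f : K) (m : N.obj Y i),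
      b₂ X Y c i j (f • m) = f • b₂ X Y c i j m)
    {X Y Z W : A.Ob} (l : Chain A.hom Z Y) (r : Chain A.hom X W) (n i j : ℤ) (m : M.obj Y i)
    (x : K ⊗[k] A.hom W Z n) :
    plugK (h X Y i j) l r n x m =
      (l.splitSum fun V p l₂ => sgn (i + p.deg) • plugK (h₂ X V (i + p.deg + n₁) j) l₂ r n x
        (b₁ V Y p i (i + p.deg + n₁) m)) +
      (r.splitSum fun V r₁ q => sgn (i + (l.deg + (n - 1 + r₁.deg))) •
        b₂ X V q (i + (l.deg + (n - 1 + r₁.deg)) + n₁) j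
          (plugK (h₁ V Y i (i + (l.deg + (n - 1 + r₁.deg)) + n₁)) l r₁ n x m)) := by
  induction x using TensorProduct.induction_on with
  | zero => simp [Chain.splitSum_zero]
  | tmul f a =>
    simp only [plugK_tmul, AddMonoidHom.smul_apply, comp_apply, Chain.splitSum_append_cons, hK,
      smul_comm _ f, splitSum_smul, smul_add]
    congr 2
    refine Chain.splitSum_congr _ _ _ fun V r₁ q _ => ?_
    have hd : (l.append (.cons a r₁)).deg = l.deg + (n - 1 + r₁.deg) := by
      rw [Chain.deg_append, Chain.deg]
    rw [mid b₂ b₁ (l.append (.cons a r₁)) q (show _ = i + (l.deg + (n - 1 + r₁.deg)) + n₁ by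
      rw [hd]), hd]
  | add x y hx hy =>
    simp only [map_add, AddMonoidHom.add_apply, hx, hy, smul_add, Chain.splitSum_add]
    abel

/-- The insertion of the deformation cocycle is a derivation with respect to composition. -/
theorem ins_comp (γ : DeformationCocycle A K) (θ : Derivation k K K) {b₂ : Maps N P}
    {b₁ : Maps M N} (n₁ : ℤ) (h₂ : Multi b₂) (h₁ : Multi b₁) (h : Multi (comp n₁ b₂ b₁))
    (hK : ∀ (X Y : A.Ob) (c : Chain A.hom X Y) (i j : ℤ) (f : K) (m : N.obj Y i),
      b₂ X Y c i j (f • m) = f • b₂ X Y c i j m) :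
    ins γ θ (comp n₁ b₂ b₁) h = comp n₁ (ins γ θ b₂ h₂) b₁ + comp n₁ b₂ (ins γ θ b₁ h₁) := by
  funext X Y c i j
  ext m
  change _ = comp n₁ (ins γ θ b₂ h₂) b₁ X Y c i j m + comp n₁ b₂ (ins γ θ b₁ h₁) X Y c i j m
  rw [ins_apply, comp_apply, comp_apply]
  simp only [plugK_comp n₁ h₂ h₁ h hK, Chain.splitSum_add, ins_apply, neg_add, map_neg, smul_neg]
  rw [splitSum_neg, splitSum_neg]
  congr 2
  · -- the entry `γ` goes into `b₂`
    simp only [zsmul_splitSum]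
    rw [Chain.splitSum_congr c _ _ fun V l w _ => Chain.splitSum_comm w l fun W q r U p l₂ =>
      sgn (i + p.deg) • plugK (h₂ X U (i + p.deg + n₁) j) l₂ r (q.deg + 1)
        (γ.contr θ q (q.deg + 1)) (b₁ U Y p i (i + p.deg + n₁) m)]
    exact Chain.splitSum_assoc c fun V U p l₂ w => w.splitSum fun W q r =>
      sgn (i + p.deg) • plugK (h₂ X U (i + p.deg + n₁) j) l₂ r (q.deg + 1)
        (γ.contr θ q (q.deg + 1)) (b₁ U Y p i (i + p.deg + n₁) m)
  · -- the entry `γ` goes into `b₁`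
    simp only [map_splitSum_apply]
    rw [Chain.splitSum_congr c _ _ fun V l w _ => (Chain.splitSum_assoc w
      fun W U q r₁ r₂ => sgn (i + (l.deg + (q.deg + 1 - 1 + r₁.deg))) •
        b₂ X W r₂ (i + (l.deg + (q.deg + 1 - 1 + r₁.deg)) + n₁) j
          (plugK (h₁ W Y i (i + (l.deg + (q.deg + 1 - 1 + r₁.deg)) + n₁)) l r₁ (q.deg + 1)
            (γ.contr θ q (q.deg + 1)) m)).symm]
    rw [← Chain.splitSum_assoc]
    refine Chain.splitSum_congr _ _ _ fun W u r₂ h => ?_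
    refine Chain.splitSum_congr _ _ _ fun V l w h₁ => ?_
    refine Chain.splitSum_congr _ _ _ fun U q r₁ h₂ => ?_
    have hd : l.deg + (q.deg + 1 - 1 + r₁.deg) = u.deg := by omega
    rw [hd]

/-- The places where an entry can be inserted into a chain from which a piece `q` is already replaced
by `μ(q)`: to the right of `q`, to the left of it, or inside. -/
theorem plugK_aPart {b : Maps M N} (h : Multi b) (h' : Multi (aPart b))
    {X Y Z W : A.Ob} (l : Chain A.hom Z Y) (r : Chain A.hom X W) (n i j : ℤ) (m : M.obj Y i)
    (x : K ⊗[k] A.hom W Z n) :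
    plugK (h' X Y i j) l r n x m =
      (l.splitSum fun _ l₁ w => w.splitSum fun _ p l₂ => sgn (i + l₁.deg + p.deg) •
        plugK (h X Y i j) (l₁.append (.cons (A.μ p (p.deg + 2)) l₂)) r n x m) +
      (l.splitSum fun _ l₁ l₂ => r.splitSum fun _ r₁ r₂ =>
        sgn (i + l₁.deg + (l₂.deg + (n - 1 + r₁.deg))) •
        plugK (h X Y i j) l₁ r₂ (l₂.deg + (n - 1 + r₁.deg) + 2)
          ((A.slot l₂ r₁ n (l₂.deg + (n - 1 + r₁.deg) + 2)).lTensor K x) m) +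
      (r.splitSum fun _ r₁ w => w.splitSum fun _ p r₂ =>
        sgn (i + (l.deg + (n - 1 + r₁.deg)) + p.deg) •
        plugK (h X Y i j) l (r₁.append (.cons (A.μ p (p.deg + 2)) r₂)) n x m) := by
  induction x using TensorProduct.induction_on with
  | zero => simp [Chain.splitSum_zero]
  | tmul f a =>
    have hc : ∀ {U V : A.Ob} (l₁ : Chain A.hom U Y) (l₂ : Chain A.hom Z U) (r₁ : Chain A.hom V W)
        (r₂ : Chain A.hom X V), b X Y (l₁.append (.cons (A.μ (l₂.append (.cons a r₁))
          (l₂.deg + (n - 1 + r₁.deg) + 2)) r₂)) i j m =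
          b X Y (l₁.append (.cons (A.slot l₂ r₁ n (l₂.deg + (n - 1 + r₁.deg) + 2) a) r₂)) i j m :=
      fun _ _ _ _ => rfl
    have hd : ∀ {U V : A.Ob} (l₁ : Chain A.hom U Y) (l₂ : Chain A.hom Z U) (r₁ : Chain A.hom V W)
        (r₂ : Chain A.hom X V), b X Y (l₁.append (.cons (A.μ (l₂.append (.cons a r₁))
          ((l₂.append (.cons a r₁)).deg + 2)) r₂)) i j =
        b X Y (l₁.append (.cons (A.μ (l₂.append (.cons a r₁))
          (l₂.deg + (n - 1 + r₁.deg) + 2)) r₂)) i j := fun l₁ l₂ r₁ r₂ =>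
      cons_congr (fun c => b X Y c i j) l₁ _ r₂ (by rw [Chain.deg_append, Chain.deg])
    simp only [plugK_tmul, LinearMap.lTensor_tmul, AddMonoidHom.smul_apply, aPart_apply,
      Chain.splitSum₃_append_cons, smul_comm _ f, splitSum_smul, smul_add]
    congr 1
    · congr 1
      · simp only [append_cons_append]
      · simp only [hd, hc, Chain.deg_append, Chain.deg]
    · simp only [append_cons_append, Chain.deg_append, Chain.deg]
  | add x y hx hy =>
    simp only [map_add, AddMonoidHom.add_apply, hx, hy, smul_add, Chain.splitSum_add]
    abel

/-- The insertion of the deformation cocycle commutes with the part of the differential coming from `A`;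
this is where the cocycle equation enters. -/
theorem aPart_ins (γ : DeformationCocycle A K) (θ : Derivation k K K) {b : Maps M N} (h : Multi b)
    (h' : Multi (aPart b)) : aPart (ins γ θ b h) = ins γ θ (aPart b) h' := by
  funext X Y c i j
  ext m
  have e1 : (c.splitSum fun _ l w => w.splitSum fun _ q r => l.splitSum fun _ l₁ v =>
        v.splitSum fun _ p l₂ => sgn (i + l.deg + q.deg) • plugK (h X Y i j) l₁
          (l₂.append (.cons (A.μ q (q.deg + 2)) r)) (p.deg + 1) (γ.contr θ p (p.deg + 1)) m) =
      c.splitSum fun _ l w => w.splitSum fun _ q r => r.splitSum fun _ r₁ v =>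
        v.splitSum fun _ p r₂ => sgn (i + (l.deg + (q.deg + 1 - 1 + r₁.deg)) + p.deg) •
          plugK (h X Y i j) l (r₁.append (.cons (A.μ p (p.deg + 2)) r₂)) (q.deg + 1)
            (γ.contr θ q (q.deg + 1)) m := by
    refine Eq.trans ?_ (Chain.splitSum_disjoint c fun _ _ _ _ l₁ p l₂ q r =>
      sgn (i + (l₁.deg + (p.deg + 1 - 1 + l₂.deg)) + q.deg) • plugK (h X Y i j) l₁
          (l₂.append (.cons (A.μ q (q.deg + 2)) r)) (p.deg + 1) (γ.contr θ p (p.deg + 1)) m)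
    refine Chain.splitSum_congr _ _ _ fun _ l w _ => Chain.splitSum_congr _ _ _ fun _ q r _ =>
      Chain.splitSum_congr _ _ _ fun _ l₁ v hv => Chain.splitSum_congr _ _ _ fun _ p l₂ hp => ?_
    rw [show l₁.deg + (p.deg + 1 - 1 + l₂.deg) = l.deg by omega]
  have e3 : (c.splitSum fun _ l w => w.splitSum fun _ q r => l.splitSum fun _ l₁ v =>
        v.splitSum fun _ p l₂ => sgn (i + l₁.deg + p.deg) • plugK (h X Y i j)
          (l₁.append (.cons (A.μ p (p.deg + 2)) l₂)) r (q.deg + 1) (γ.contr θ q (q.deg + 1)) m) =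
      c.splitSum fun _ l w => w.splitSum fun _ q r => r.splitSum fun _ r₁ v =>
        v.splitSum fun _ p r₂ => sgn (i + l.deg + q.deg) •
          plugK (h X Y i j) (l.append (.cons (A.μ q (q.deg + 2)) r₁)) r₂ (p.deg + 1)
            (γ.contr θ p (p.deg + 1)) m :=
    Chain.splitSum_disjoint c fun _ _ _ _ l₁ p l₂ q r => sgn (i + l₁.deg + p.deg) •
      plugK (h X Y i j) (l₁.append (.cons (A.μ p (p.deg + 2)) l₂)) r (q.deg + 1)
        (γ.contr θ q (q.deg + 1)) m
  -- the nested insertions agree because the cocycle is closed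
  have e2 : (c.splitSum fun _ l w => w.splitSum fun _ q r => l.splitSum fun _ l₁ l₂ =>
        r.splitSum fun _ r₁ r₂ => sgn (i + l.deg + q.deg) • plugK (h X Y i j) l₁ r₂
          ((l₂.append (.cons (A.μ q (q.deg + 2)) r₁)).deg + 1)
          (γ.contr θ (l₂.append (.cons (A.μ q (q.deg + 2)) r₁))
            ((l₂.append (.cons (A.μ q (q.deg + 2)) r₁)).deg + 1)) m) =
      c.splitSum fun _ l w => w.splitSum fun _ q r => l.splitSum fun _ l₁ l₂ =>
        r.splitSum fun _ r₁ r₂ => sgn (i + l₁.deg + (l₂.deg + (q.deg + 1 - 1 + r₁.deg))) •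
          plugK (h X Y i j) l₁ r₂ (l₂.deg + (q.deg + 1 - 1 + r₁.deg) + 2)
            ((A.slot l₂ r₁ (q.deg + 1) (l₂.deg + (q.deg + 1 - 1 + r₁.deg) + 2)).lTensor K
              (γ.contr θ q (q.deg + 1))) m := by
    refine Eq.trans ?_ ((Chain.splitSum_nested c fun _ _ _ _ l₁ l₂ q r₁ r₂ =>
      sgn (i + (l₁.deg + l₂.deg) + q.deg) • plugK (h X Y i j) l₁ r₂
          ((l₂.append (.cons (A.μ q (q.deg + 2)) r₁)).deg + 1)
          (γ.contr θ (l₂.append (.cons (A.μ q (q.deg + 2)) r₁))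
            ((l₂.append (.cons (A.μ q (q.deg + 2)) r₁)).deg + 1)) m).trans ?_)
    · refine Chain.splitSum_congr _ _ _ fun _ l w _ => Chain.splitSum_congr _ _ _ fun _ q r _ =>
        Chain.splitSum_congr _ _ _ fun _ l₁ l₂ hl => ?_
      rw [hl]
    rw [Chain.splitSum_nested c fun _ _ _ _ l₁ l₂ q r₁ r₂ =>
      sgn (i + l₁.deg + (l₂.deg + (q.deg + 1 - 1 + r₁.deg))) •
          plugK (h X Y i j) l₁ r₂ (l₂.deg + (q.deg + 1 - 1 + r₁.deg) + 2)
            ((A.slot l₂ r₁ (q.deg + 1) (l₂.deg + (q.deg + 1 - 1 + r₁.deg) + 2)).lTensor K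
              (γ.contr θ q (q.deg + 1))) m]
    refine Chain.splitSum_congr _ _ _ fun _ l₁ w _ => Chain.splitSum_congr _ _ _ fun _ u r₂ _ => ?_
    have hc := congrArg (fun z => sgn (i + l₁.deg + u.deg) •
      ((plugK (h X Y i j) l₁ r₂ (u.deg + 2)) z) m) (γ.contr_closed θ u (u.deg + 2))
    simp only [Chain.map_splitSum, splitSum_apply, zsmul_splitSum] at hc
    refine Eq.trans ?_ (hc.symm.trans ?_)
    · refine Chain.splitSum_congr _ _ _ fun _ l₂ v _ => Chain.splitSum_congr _ _ _ fun _ q r₁ _ => ?_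
      have hd : (l₂.append (.cons (A.μ q (q.deg + 2)) r₁)).deg = u.deg + 1 := by
        rw [Chain.deg_append, Chain.deg]; omega
      rw [plugK_congr (h X Y i j) l₁ r₂ (show _ = u.deg + 2 by rw [hd]; ring), map_zsmul,
        AddMonoidHom.zsmul_apply, smul_smul]
      congr 1
      rw [← sgn_add]
      exact sgn_congr ⟨-r₁.deg, by omega⟩
    · refine Chain.splitSum_congr _ _ _ fun _ l₂ v _ => Chain.splitSum_congr _ _ _ fun _ q r₁ _ => ?_
      rw [show l₂.deg + (q.deg + 1 - 1 + r₁.deg) = u.deg by omega]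
  rw [aPart_apply, ins_apply]
  simp only [plugK_aPart h h', Chain.splitSum_add, ins_apply, Chain.splitSum₃_append_cons,
    smul_neg, smul_add, zsmul_splitSum, splitSum_neg]
  rw [e1, e2, e3]
  congr 1
  abel

end Maps

end

/-! ### Insertion of the cocycle and the differential -/

section

namespace Maps
variable {k : Type u} [Field k] {A : AInfCat k} {K : Type u} [CommRing K] [Algebra k K]
variable {M N P Q : PreMod A K}

section plug
variable {E : Type u} [AddCommGroup E] [Module K E] {X Y : A.Ob} {F : Chain A.hom X Y → E}

theorem plugK_add (hF : IsMultilinear k K F) {Z W : A.Ob} (l₁ l₂ l₃ : Chain A.hom Z Y)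
    (r₁ r₂ r₃ : Chain A.hom X W) (n : ℤ) (h : ∀ a : A.hom W Z n, F (l₁.append (.cons a r₁)) =
      F (l₂.append (.cons a r₂)) + F (l₃.append (.cons a r₃))) (x : K ⊗[k] A.hom W Z n) :
    plugK hF l₁ r₁ n x = plugK hF l₂ r₂ n x + plugK hF l₃ r₃ n x := by
  induction x using TensorProduct.induction_on with
  | zero => simp
  | tmul f a => rw [plugK_tmul, plugK_tmul, plugK_tmul, h, smul_add]
  | add x y hx hy => rw [map_add, map_add, map_add, hx, hy]; abel

theorem plugK_smul (hF : IsMultilinear k K F) {Z W : A.Ob} (l₁ l₂ : Chain A.hom Z Y)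
    (r₁ r₂ : Chain A.hom X W) (n : ℤ) (g : K) (h : ∀ a : A.hom W Z n, F (l₁.append (.cons a r₁)) =
      g • F (l₂.append (.cons a r₂))) (x : K ⊗[k] A.hom W Z n) :
    plugK hF l₁ r₁ n x = g • plugK hF l₂ r₂ n x := by
  induction x using TensorProduct.induction_on with
  | zero => simp
  | tmul f a => rw [plugK_tmul, plugK_tmul, h, smul_comm]
  | add x y hx hy => rw [map_add, map_add, hx, hy, smul_add]

theorem plugK_smul_right (hF : IsMultilinear k K F) {Z W : A.Ob} (l : Chain A.hom Z Y)
    (r : Chain A.hom X W) (n : ℤ) (t : k) (x : K ⊗[k] A.hom W Z n) :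
    plugK hF l r n (t • x) = algebraMap k K t • plugK hF l r n x := by
  induction x using TensorProduct.induction_on with
  | zero => simp
  | tmul f a => rw [TensorProduct.smul_tmul', plugK_tmul, plugK_tmul, Algebra.smul_def, mul_smul]
  | add x y hx hy => rw [smul_add, map_add, map_add, hx, hy, smul_add]

end plug

theorem contr_add (γ : DeformationCocycle A K) (θ : Derivation k K K) {X Y V W : A.Ob} {n : ℤ}
    (p : Chain A.hom W Y) (a b : A.hom V W n) (q : Chain A.hom X V) (m : ℤ) :
    γ.contr θ (p.append (.cons (a + b) q)) m =
      γ.contr θ (p.append (.cons a q)) m + γ.contr θ (p.append (.cons b q)) m := by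
  rw [DeformationCocycle.contr, (γ.γ_multilinear X Y m).map_add, map_add]
  rfl

theorem contr_smul (γ : DeformationCocycle A K) (θ : Derivation k K K) {X Y V W : A.Ob} {n : ℤ}
    (p : Chain A.hom W Y) (t : k) (a : A.hom V W n) (q : Chain A.hom X V) (m : ℤ) :
    γ.contr θ (p.append (.cons (t • a) q)) m = t • γ.contr θ (p.append (.cons a q)) m := by
  rw [DeformationCocycle.contr, (γ.γ_multilinear X Y m).map_smul, algebraMap_smul, map_smul]
  rfl

theorem contr_e (γ : DeformationCocycle A K) (θ : Derivation k K K) {X Y Z : A.Ob}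
    (p : Chain A.hom Y Z) (q : Chain A.hom X Y) (n : ℤ) :
    γ.contr θ (p.append (.cons (A.e Y) q)) n = 0 := by
  rw [DeformationCocycle.contr, γ.γ_e, map_zero]

theorem ins_smul_apply (γ : DeformationCocycle A K) (θ : Derivation k K K) {b : Maps M N}
    (hb : Multi b) (f : K) (h : ∀ (X Y : A.Ob) (c : Chain A.hom X Y) (i j : ℤ) (m : M.obj Y i),
      b X Y c i j (f • m) = f • b X Y c i j m) {X Y : A.Ob} (c : Chain A.hom X Y) (i j : ℤ)
    (m : M.obj Y i) : ins γ θ b hb X Y c i j (f • m) = f • ins γ θ b hb X Y c i j m := by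
  have key : ∀ {Z W : A.Ob} (l : Chain A.hom Z Y) (r : Chain A.hom X W) (n : ℤ)
      (x : K ⊗[k] A.hom W Z n), plugK (hb X Y i j) l r n x (f • m) =
        f • plugK (hb X Y i j) l r n x m := by
    intro Z W l r n x
    induction x using TensorProduct.induction_on with
    | zero => simp
    | tmul g a =>
      rw [plugK_tmul, AddMonoidHom.smul_apply, AddMonoidHom.smul_apply, h, smul_comm]
    | add x y hx hy => rw [map_add, AddMonoidHom.add_apply, AddMonoidHom.add_apply, hx, hy, smul_add]
  simp only [ins_apply, key, splitSum_smul, smul_neg]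

theorem isPre_ins (γ : DeformationCocycle A K) (θ : Derivation k K K) {n : ℤ} {b : Maps M N}
    (h : IsPre n b) : IsPre n (ins γ θ b h.multilinear) where
  smul X Y c i j t m := ins_smul_apply γ θ _ _ (fun X Y c i j m => h.smul X Y c i j t m) c i j m
  deg X Y c i j hj := by
    rw [ins, Chain.splitSum_congr c _ (fun _ _ _ => 0), Chain.splitSum_zero, neg_zero]
    intro Z l w hlw
    rw [Chain.splitSum_congr w _ (fun _ _ _ => 0), Chain.splitSum_zero]
    intro W q r hqr
    exact plugK_eq_zero _ _ _ _ (fun a => h.deg _ _ _ i j (by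
      rw [Chain.deg_append, Chain.deg]; omega)) _
  multilinear X Y i j :=
    { map_add := fun {V W n} p x y q => by
        have hd : ∀ (U V' : A.Ob) (l' : Chain A.hom W U) (r' : Chain A.hom V' V) (z : A.hom V W n),
            (l'.append (.cons z r')).deg = (l'.append (.cons x r')).deg := fun U V' l' r' z => by
          simp only [Chain.deg_append, Chain.deg]
        simp only [ins, Chain.splitSum₃_append_cons]
        rw [← neg_add]
        congr 1
        have e : ∀ a b c a' b' c' : M.obj Y i →+ N.obj X j, a + b + c + (a' + b' + c') =
            a + a' + (b + b') + (c + c') := fun _ _ _ _ _ _ => by abel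
        rw [e]
        congr 1
        · congr 1
          · simp only [← Chain.splitSum_add]
            refine Chain.splitSum_congr _ _ _ fun _ l w _ => Chain.splitSum_congr _ _ _
              fun _ u r _ => plugK_add _ _ _ _ _ _ _ _ (fun a => ?_) _
            simp only [append_cons_append]
            rw [(h.multilinear _ _ _ _).map_add]
          · simp only [← Chain.splitSum_add]
            refine Chain.splitSum_congr _ _ _ fun _ l l' _ => Chain.splitSum_congr _ _ _
              fun _ r' r _ => ?_
            rw [plugK_congr _ l r (congrArg (· + 1) (hd _ _ l' r' (x + y))),
              plugK_congr _ l r (congrArg (· + 1) (hd _ _ l' r' y)), contr_add, map_add]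
        · simp only [← Chain.splitSum_add]
          refine Chain.splitSum_congr _ _ _ fun _ l w _ => Chain.splitSum_congr _ _ _
            fun _ u r _ => plugK_add _ _ _ _ _ _ _ _ (fun a => ?_) _
          simp only [← append_cons_append]
          rw [(h.multilinear _ _ _ _).map_add]
      map_smul := fun {V W n} p t x q => by
        have hd : ∀ (U V' : A.Ob) (l' : Chain A.hom W U) (r' : Chain A.hom V' V) (z : A.hom V W n),
            (l'.append (.cons z r')).deg = (l'.append (.cons x r')).deg := fun U V' l' r' z => by
          simp only [Chain.deg_append, Chain.deg]
        simp only [ins, Chain.splitSum₃_append_cons]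
        rw [smul_neg, smul_add, smul_add]
        congr 1
        congr 1
        · congr 1
          · simp only [← splitSum_smul]
            refine Chain.splitSum_congr _ _ _ fun _ l w _ => Chain.splitSum_congr _ _ _
              fun _ u r _ => plugK_smul _ _ _ _ _ _ _ (fun a => ?_) _
            simp only [append_cons_append]
            rw [(h.multilinear _ _ _ _).map_smul]
          · simp only [← splitSum_smul]
            refine Chain.splitSum_congr _ _ _ fun _ l l' _ => Chain.splitSum_congr _ _ _
              fun _ r' r _ => ?_
            rw [plugK_congr _ l r (congrArg (· + 1) (hd _ _ l' r' (t • x))), contr_smul,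
              plugK_smul_right]
        · simp only [← splitSum_smul]
          refine Chain.splitSum_congr _ _ _ fun _ l w _ => Chain.splitSum_congr _ _ _
            fun _ u r _ => plugK_smul _ _ _ _ _ _ _ (fun a => ?_) _
          simp only [← append_cons_append]
          rw [(h.multilinear _ _ _ _).map_smul] }

theorem ins_unital (γ : DeformationCocycle A K) (θ : Derivation k K K) {b : Maps M N}
    (hb : Multi b) (h : ∀ (X Y Z : A.Ob) (p : Chain A.hom Y Z) (q : Chain A.hom X Y) (i j : ℤ),
      b X Z (p.append (.cons (A.e Y) q)) i j = 0)
    {X Y Z : A.Ob} (p : Chain A.hom Y Z) (q : Chain A.hom X Y) (i j : ℤ) :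
    ins γ θ b hb X Z (p.append (.cons (A.e Y) q)) i j = 0 := by
  simp only [ins, Chain.splitSum₃_append_cons]
  rw [Chain.splitSum_congr p _ (fun _ _ _ => 0), Chain.splitSum_zero,
    Chain.splitSum_congr p _ (fun _ _ _ => 0), Chain.splitSum_zero,
    Chain.splitSum_congr q _ (fun _ _ _ => 0), Chain.splitSum_zero, add_zero, add_zero, neg_zero]
  · intro U l w _
    rw [Chain.splitSum_congr w _ (fun _ _ _ => 0), Chain.splitSum_zero]
    exact fun V u r _ => plugK_eq_zero _ _ _ _ (fun a => by rw [← append_cons_append, h]) _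
  · intro U l l' _
    rw [Chain.splitSum_congr q _ (fun _ _ _ => 0), Chain.splitSum_zero]
    exact fun V u r _ => by rw [contr_e, map_zero]
  · intro U l w _
    rw [Chain.splitSum_congr w _ (fun _ _ _ => 0), Chain.splitSum_zero]
    exact fun V u r _ => plugK_eq_zero _ _ _ _ (fun a => by rw [append_cons_append, h]) _

theorem ins_add (γ : DeformationCocycle A K) (θ : Derivation k K K) {b b' : Maps M N}
    (h : Multi b) (h' : Multi b') (h'' : Multi (b + b')) :
    ins γ θ (b + b') h'' = ins γ θ b h + ins γ θ b' h' := by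
  funext X Y c i j
  have key : ∀ {Z W : A.Ob} (l : Chain A.hom Z Y) (r : Chain A.hom X W) (n : ℤ)
      (x : K ⊗[k] A.hom W Z n), plugK (h'' X Y i j) l r n x =
        plugK (h X Y i j) l r n x + plugK (h' X Y i j) l r n x := by
    intro Z W l r n x
    induction x using TensorProduct.induction_on with
    | zero => simp
    | tmul g a => rw [plugK_tmul, plugK_tmul, plugK_tmul, ← smul_add]; rfl
    | add x y hx hy => rw [map_add, map_add, map_add, hx, hy]; abel
  ext m
  simp only [ins, key, Chain.splitSum_add, Pi.add_apply, AddMonoidHom.add_apply, AddMonoidHom.neg_apply]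
  abel

theorem ins_smul (γ : DeformationCocycle A K) (θ : Derivation k K K) {b : Maps M N} (f : K)
    (h : Multi b) (h' : Multi (f • b)) : ins γ θ (f • b) h' = f • ins γ θ b h := by
  funext X Y c i j
  have key : ∀ {Z W : A.Ob} (l : Chain A.hom Z Y) (r : Chain A.hom X W) (n : ℤ)
      (x : K ⊗[k] A.hom W Z n), plugK (h' X Y i j) l r n x = f • plugK (h X Y i j) l r n x := by
    intro Z W l r n x
    induction x using TensorProduct.induction_on with
    | zero => simp
    | tmul g a => rw [plugK_tmul, plugK_tmul, smul_comm]; rfl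
    | add x y hx hy => rw [map_add, map_add, hx, hy, smul_add]
  ext m
  simp only [ins, key, splitSum_smul, Pi.smul_apply, smul_neg]

/-- The insertion of the deformation cocycle commutes with the differential, up to the terms coming
from the operations of the two modules. -/
theorem d_ins (γ : DeformationCocycle A K) (θ : Derivation k K K) {n : ℤ} {b : Maps M N}
    (h : IsHom n b) (hd : Multi (d n b)) :
    d n (ins γ θ b h.multilinear) + comp n (ins γ θ (μMaps N) (isPre_μMaps N).multilinear) b +
      comp 1 b (ins γ θ (μMaps M) (isPre_μMaps M).multilinear) = ins γ θ (d n b) hd := by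
  have hN := isPre_μMaps N
  have hM := isPre_μMaps M
  have h1 := (hN.comp h.isPre).multilinear
  have h2 := (h.isPre.comp hM).multilinear
  have h3 := (isPre_aPart h.isPre).multilinear
  have h12 : Multi (comp n (μMaps N) b + comp 1 b (μMaps M)) :=
    (((by simpa only [add_comm] using (isPre_μMaps N).comp h.isPre : IsPre (n + 1) _).add
      (by simpa only [add_comm] using h.isPre.comp (isPre_μMaps M) : IsPre (n + 1) _))).multilinear
  rw [ins_congr γ θ (d_eq n b) hd (d_eq n b ▸ hd), ins_add γ θ h12 h3, ins_add γ θ h1 h2,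
    ins_comp γ θ n hN.multilinear h.multilinear h1 fun X Y c i j f m => map_smul (N.μ c i j) f m,
    ins_comp γ θ 1 h.multilinear hM.multilinear h2 h.smul, ← aPart_ins γ θ h.multilinear h3, d_eq]
  abel

end Maps

end

/-! ### Induced connections on cohomology -/

section

namespace Maps
variable {k : Type u} [Field k] {A : AInfCat k} {K : Type u} [CommRing K] [Algebra k K]
variable {M N P Q : PreMod A K}

/-- Degree `n` cocycles of the morphism complex. -/
def cocyclesIn (M N : PreMod A K) (n : ℤ) : Submodule K (Maps M N) :=
  homDeg M N n ⊓ LinearMap.ker (d n)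

/-- The coboundaries of the degree `n` elements of the morphism complex. -/
def coboundariesFrom (M N : PreMod A K) (n : ℤ) : Submodule K (Maps M N) := (homDeg M N n).map (d n)

/-- The cohomology of the morphism complex in degree `n`, as the quotient of the degree `n` cocycles
by the coboundaries of the degree `n'` elements; the case of interest is `n = n' + 1`. -/
abbrev HomH (M N : PreMod A K) (n' n : ℤ) : Type u :=
  cocyclesIn M N n ⧸ (coboundariesFrom M N n').submoduleOf (cocyclesIn M N n)

/-- A relative connection on `M`, contracted with the derivation `θ` of `K`. -/
structure IsContracted (γ : DeformationCocycle A K) (θ : Derivation k K K) (D : Maps M M) :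
    Prop where
  isPre : IsPre 0 D
  leibniz : ∀ (X Y : A.Ob) (c : Chain A.hom X Y) (i j : ℤ) (f : K) (m : M.obj Y i),
    D X Y c i j (f • m) = θ f • one M X Y c i j m + f • D X Y c i j m
  unital : ∀ (X Y Z : A.Ob) (p : Chain A.hom Y Z) (q : Chain A.hom X Y) (i j : ℤ),
    D X Z (p.append (.cons (A.e Y) q)) i j = 0
  d_eq : d 0 D = ins γ θ (μMaps M) (isPre_μMaps M).multilinear

theorem IsRelativeConnection.isContracted {γ : DeformationCocycle A K} {D : Maps M M.omega}
    (h : IsRelativeConnection γ D) (θ : Derivation k K K) : IsContracted γ θ (ctr θ D) := by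
  have hl : ∀ (X Y : A.Ob) (c : Chain A.hom X Y) (i j : ℤ) (f : K) (m : M.obj Y i),
      ctr θ D X Y c i j (f • m) = θ f • one M X Y c i j m + f • ctr θ D X Y c i j m := by
    intro X Y c i j f m
    cases c with
    | cons a c =>
      rw [one_of_pos M _ (by simp [Chain.length]), ctr_apply, ctr_apply,
        h.smul X Y _ (by simp [Chain.length]), map_smul]
      simp
    | nil =>
      by_cases hij : i = j
      · subst hij
        have h2 : ctr₀ θ (M.obj X i) (sgn i • sgn i • D X X (.nil X) i i (f • m)) = _ :=
          congrArg (ctr₀ θ (M.obj X i)) (congrArg (sgn i • ·) (h.leibniz X i f m))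
        rw [smul_add, smul_comm (sgn i) f, smul_smul, smul_smul, sgn_mul_self, one_smul, one_smul,
          map_add, map_zsmul, ctr₀_tmul, Derivation.liftKaehlerDifferential_comp_D,
          LinearMap.map_smul (ctr₀ θ (M.obj X i)) f] at h2
        rw [ctr_apply, ctr_apply, one_nil, h2, smul_comm]
      · rw [one_nil_ne M X hij, ctr_apply, ctr_apply, h.deg X X _ i j (by
          simp only [Chain.deg]; omega)]
        simp
  exact
  { isPre :=
      { smul := fun X Y c i j t m => by rw [hl, Derivation.map_algebraMap, zero_smul, zero_add]
        deg := fun X Y c i j hj => by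
          ext m
          rw [ctr_apply, h.deg X Y c i j (by simpa using hj)]
          simp
        multilinear := fun X Y i j =>
          { map_add := fun p a b q => by
              ext m
              simp only [ctr_apply, AddMonoidHom.add_apply, (h.multilinear X Y i j).map_add,
                map_add]
            map_smul := fun p t a q => by
              ext m
              simp only [ctr_apply, AddMonoidHom.smul_apply, (h.multilinear X Y i j).map_smul,
                map_smul] } }
    leibniz := hl
    unital := fun X Y Z p q i j => by
      ext m
      rw [ctr_apply, h.unital]
      simp
    d_eq := by
      rw [← ctr_d, h.d_eq, γmod₀, ctr_contract] }

/-- The connection on the morphism complex in degree `n`, contracted with a derivation. -/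
def nab (γ : DeformationCocycle A K) (θ : Derivation k K K) (D₀ : Maps M M) (D₁ : Maps N N) (n : ℤ)
    (b : Maps M N) (hb : Multi b) : Maps M N :=
  sgn n • comp n D₁ b - comp 0 b D₀ + ins γ θ b hb

/-- The contraction of the induced connection with a derivation is expressed through the contractions of
the relative connections. -/
theorem ctr_inducedConnection {γ : DeformationCocycle A K} (θ : Derivation k K K)
    (D₀ : Maps M M.omega) (D₁ : Maps N N.omega) {n : ℤ} {b : Maps M N} (hb : IsHom n b) :
    ctr θ (inducedConnection γ D₀ D₁ hb) = nab γ θ (ctr θ D₀) (ctr θ D₁) n b hb.multilinear := by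
  rw [inducedConnection, ctr_add, sub_eq_add_neg, ctr_add, ctr_zsmul, ctr_comp,
    ← neg_one_smul ℤ (comp 0 _ D₀), ctr_zsmul, ctr_comp_tensorMap, γmod₁, ctr_contract,
    neg_one_smul, ← sub_eq_add_neg]
  rfl

theorem isHom_ctr (θ : Derivation k K K) {n : ℤ} {b : Maps M N.omega} (h : IsHom n b) :
    IsHom n (ctr θ b) where
  smul X Y c i j f m := by rw [ctr_apply, ctr_apply, h.smul, map_smul]
  deg X Y c i j hj := by
    ext m
    rw [ctr_apply, h.deg X Y c i j hj]
    simp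
  multilinear X Y i j :=
    { map_add := fun p a b q => by
        ext m
        simp only [ctr_apply, AddMonoidHom.add_apply, (h.multilinear X Y i j).map_add, map_add]
      map_smul := fun p t a q => by
        ext m
        simp only [ctr_apply, AddMonoidHom.smul_apply, (h.multilinear X Y i j).map_smul,
          map_smul] }
  unital X Y Z p q i j := by
    ext m
    rw [ctr_apply, h.unital]
    simp

theorem coboundariesFrom_le_cocyclesIn (hM : M.IsModule) (hN : N.IsModule) {n' n : ℤ}
    (hn : n' + 1 = n) : coboundariesFrom M N n' ≤ cocyclesIn M N n := by
  subst hn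
  rintro _ ⟨c, hc, rfl⟩
  exact ⟨isHom_d hM hN hc, LinearMap.mem_ker.2 (d_d hM hN (IsHom.isPre hc))⟩

theorem coboundaries_le_cocycles (hM : M.IsModule) (hN : N.IsModule) :
    coboundaries M N ≤ cocycles M N :=
  coboundariesFrom_le_cocyclesIn (n' := -1) (n := 0) hM hN rfl

theorem comp_one_left {n : ℤ} {b : Maps M N} (hb : IsHom n b) :
    comp n (one N) b = sgn n • b := by
  funext X Y c i j
  ext m
  rw [comp_apply, Chain.splitSum_nil_right]
  · change _ = sgn n • b X Y c i j m
    by_cases h : j = i + c.deg + n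
    · subst h
      rw [one_nil, smul_smul, sgn_add (i + c.deg) n, ← mul_assoc, sgn_mul_self, one_mul]
    · rw [hb.deg X Y c i j (by omega), one_nil_ne _ _ (by omega)]
      simp
  · intro Z l r h
    rw [one_of_pos _ _ h]
    simp

section nab
variable {γ : DeformationCocycle A K} {θ : Derivation k K K} {D₀ : Maps M M} {D₁ : Maps N N}
  {D₂ : Maps P P}

theorem sub_apply' (b b' : Maps M N) {X Y : A.Ob} (c : Chain A.hom X Y) (i j : ℤ) (m : M.obj Y i) :
    (b - b') X Y c i j m = b X Y c i j m - b' X Y c i j m := rfl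

theorem add_apply' (b b' : Maps M N) {X Y : A.Ob} (c : Chain A.hom X Y) (i j : ℤ) (m : M.obj Y i) :
    (b + b') X Y c i j m = b X Y c i j m + b' X Y c i j m := rfl

theorem zsmul_apply' (z : ℤ) (b : Maps M N) {X Y : A.Ob} (c : Chain A.hom X Y) (i j : ℤ)
    (m : M.obj Y i) : (z • b) X Y c i j m = z • b X Y c i j m := rfl

theorem smul_apply' (f : K) (b : Maps M N) {X Y : A.Ob} (c : Chain A.hom X Y) (i j : ℤ)
    (m : M.obj Y i) : (f • b) X Y c i j m = f • b X Y c i j m := rfl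

theorem comp_smul_leibniz (h₁ : IsContracted γ θ D₁) (n : ℤ) (f : K) (b : Maps M N) :
    comp n D₁ (f • b) = θ f • comp n (one N) b + f • comp n D₁ b := by
  funext X Y c i j
  ext m
  rw [add_apply', smul_apply', smul_apply', comp_apply, comp_apply, comp_apply]
  simp only [smul_apply', h₁.leibniz, smul_add, Chain.splitSum_add, ← splitSum_smul,
    smul_comm (_ : K) (_ : ℤ)]

theorem isHom_nab (h₀ : IsContracted γ θ D₀) (h₁ : IsContracted γ θ D₁) {n : ℤ} {b : Maps M N}
    (hb : IsHom n b) : IsHom n (nab γ θ D₀ D₁ n b hb.multilinear) := by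
  have hp : IsPre n (nab γ θ D₀ D₁ n b hb.multilinear) := by
    have e1 : IsPre n (sgn n • comp n D₁ b) := by
      simpa using (h₁.isPre.comp hb.isPre).zsmul (sgn n)
    have e2 : IsPre n ((-1 : ℤ) • comp 0 b D₀) := by
      simpa using (hb.isPre.comp h₀.isPre).zsmul (-1)
    rw [nab, sub_eq_add_neg, ← neg_one_smul ℤ]
    exact (e1.add e2).add (isPre_ins γ θ hb.isPre)
  exact
  { smul := fun X Y c i j f m => by
      have hD : comp n D₁ b X Y c i j (f • m) =
          θ f • sgn n • b X Y c i j m + f • comp n D₁ b X Y c i j m := by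
        rw [← zsmul_apply', ← comp_one_left hb]
        simp only [comp_apply, hb.smul, h₁.leibniz, smul_add, Chain.splitSum_add, ← splitSum_smul,
          smul_comm (_ : K) (_ : ℤ)]
      have hD' : comp 0 b D₀ X Y c i j (f • m) =
          θ f • b X Y c i j m + f • comp 0 b D₀ X Y c i j m := by
        conv_rhs => rw [← comp_one b, comp_one b]
        rw [← DFunLike.congr_fun (congrFun (congrFun (congrFun (congrFun (congrFun
          (comp_one b) X) Y) c) i) j) m]
        simp only [comp_apply, hb.smul, h₀.leibniz, smul_add, map_add, Chain.splitSum_add,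
          ← splitSum_smul, smul_comm (_ : K) (_ : ℤ)]
      simp only [nab, add_apply', sub_apply', zsmul_apply', hD, hD',
        ins_smul_apply γ θ hb.multilinear f (fun X Y c i j m => hb.smul X Y c i j f m), smul_add,
        smul_sub, smul_comm (_ : K) (_ : ℤ), smul_smul (sgn n) (sgn n), sgn_mul_self, one_smul]
      abel
    deg := hp.deg
    multilinear := hp.multilinear
    unital := fun X Y Z p q i j => by
      ext m
      simp [nab, comp_apply, Chain.splitSum_append_cons,
        hb.unital, h₀.unital, h₁.unital, Chain.splitSum_zero, ins_unital γ θ hb.multilinear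
          hb.unital] }

/-- The induced connection is a chain map, since `μ¹(D) = γ^{mod,0}` for both relative connections. -/
theorem d_nab (h₀ : IsContracted γ θ D₀) (h₁ : IsContracted γ θ D₁) {n : ℤ} {b : Maps M N}
    (hb : IsHom n b) (hd : Multi (d n b)) :
    d n (nab γ θ D₀ D₁ n b hb.multilinear) = nab γ θ D₀ D₁ (n + 1) (d n b) hd := by
  have e1 := d_comp n 0 D₁ b
  have e2 := d_comp 0 n b D₀
  have e3 := d_ins γ θ hb hd
  rw [add_zero, h₁.d_eq] at e1
  rw [zero_add, h₀.d_eq, sgn_zero, one_smul, zero_add] at e2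
  rw [nab, map_add, map_sub, map_zsmul, e1, e2, nab, ← e3, smul_sub, smul_smul, sgn_mul_self,
    one_smul, sgn_add, sgn_one, mul_neg_one, neg_smul]
  abel

theorem nab_congr {b b' : Maps M N} (h : b = b') (n : ℤ) (hb : Multi b) (hb' : Multi b') :
    nab γ θ D₀ D₁ n b hb = nab γ θ D₀ D₁ n b' hb' := by
  subst h; rfl

theorem nab_add {n : ℤ} {b b' : Maps M N} (hb : Multi b) (hb' : Multi b') (h : Multi (b + b')) :
    nab γ θ D₀ D₁ n (b + b') h = nab γ θ D₀ D₁ n b hb + nab γ θ D₀ D₁ n b' hb' := by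
  simp only [nab, comp_add, add_comp, ins_add γ θ hb hb' h, smul_add]
  abel

theorem nab_smul (h₁ : IsContracted γ θ D₁) {n : ℤ} (f : K) {b : Maps M N} (hb : IsHom n b)
    (h : Multi (f • b)) :
    nab γ θ D₀ D₁ n (f • b) h = θ f • b + f • nab γ θ D₀ D₁ n b hb.multilinear := by
  rw [nab, nab, comp_smul_leibniz h₁, smul_comp, ins_smul γ θ f hb.multilinear h,
    comp_one_left hb, smul_add, smul_comm (sgn n) (θ f), smul_smul, sgn_mul_self, one_smul,
    smul_add, smul_sub, smul_comm f (sgn n)]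
  abel

/-- The induced connections are compatible with composition. -/
theorem nab_comp {b₂ : Maps N P} {b₁ : Maps M N} (h₂ : IsHom 0 b₂) (h₁ : IsHom 0 b₁)
    (h : Multi (comp 0 b₂ b₁)) :
    nab γ θ D₀ D₂ 0 (comp 0 b₂ b₁) h =
      comp 0 (nab γ θ D₁ D₂ 0 b₂ h₂.multilinear) b₁ +
        comp 0 b₂ (nab γ θ D₀ D₁ 0 b₁ h₁.multilinear) := by
  simp only [nab, sgn_zero, one_smul, sub_eq_add_neg, add_comp, comp_add, neg_comp, comp_neg,
    comp_assoc, ins_comp γ θ 0 h₂.multilinear h₁.multilinear h h₂.smul]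
  abel

end nab

/-- Relative connections on `M` and `N` induce a connection on the cocycles of the morphism
complex. -/
def connCocycles {γ : DeformationCocycle A K} {D₀ : Maps M M.omega} {D₁ : Maps N N.omega}
    (h₀ : IsRelativeConnection γ D₀) (h₁ : IsRelativeConnection γ D₁) (n : ℤ) :
    Conn k K (cocyclesIn M N n) where
  nabla θ := AddMonoidHom.mk' (fun b => ⟨nab γ θ (ctr θ D₀) (ctr θ D₁) n b.1 b.2.1.multilinear,
      isHom_nab (h₀.isContracted θ) (h₁.isContracted θ) b.2.1, by
        have hd : d n b.1 = 0 := b.2.2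
        have h0 : IsHom (n + 1) (0 : Maps M N) := (homDeg M N (n + 1)).zero_mem
        refine LinearMap.mem_ker.2 ?_
        rw [d_nab (h₀.isContracted θ) (h₁.isContracted θ) b.2.1
          (hd ▸ h0.multilinear), nab_congr hd _ _ h0.multilinear]
        have := nab_add (γ := γ) (θ := θ) (D₀ := ctr θ D₀) (D₁ := ctr θ D₁) (n := n + 1)
          h0.multilinear h0.multilinear ((add_zero (0 : Maps M N)).symm ▸ h0.multilinear)
        rw [nab_congr (add_zero 0) _ _ h0.multilinear] at this
        simpa using this⟩)
    fun b b' => Subtype.ext (nab_add b.2.1.multilinear b'.2.1.multilinear _)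
  leibniz θ f b := Subtype.ext (nab_smul (h₁.isContracted θ) f b.2.1 _)

theorem connCocycles_stable {γ : DeformationCocycle A K} {D₀ : Maps M M.omega}
    {D₁ : Maps N N.omega} (h₀ : IsRelativeConnection γ D₀) (h₁ : IsRelativeConnection γ D₁)
    {n' n : ℤ} (hn : n' + 1 = n) :
    (connCocycles h₀ h₁ n).Stable ((coboundariesFrom M N n').submoduleOf (cocyclesIn M N n)) := by
  subst hn
  rintro θ ⟨b, hb⟩ ⟨c, hc, hcb : d n' c = b⟩
  subst hcb
  exact ⟨_, isHom_nab (h₀.isContracted θ) (h₁.isContracted θ) hc,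
    d_nab (h₀.isContracted θ) (h₁.isContracted θ) hc _⟩

/-- Relative connections on `M` and `N` induce a connection on the cohomology of the morphism
complex. -/
def connH {γ : DeformationCocycle A K} {D₀ : Maps M M.omega} {D₁ : Maps N N.omega}
    (h₀ : IsRelativeConnection γ D₀) (h₁ : IsRelativeConnection γ D₁)
    {n' n : ℤ} (hn : n' + 1 = n) : Conn k K (HomH M N n' n) :=
  (connCocycles h₀ h₁ n).quotient _ (connCocycles_stable h₀ h₁ hn)

end Maps

namespace PreMod
open CategoryTheory Maps
variable {k : Type u} [Field k] {A : AInfCat k} {K : Type u} [CommRing K] [Algebra k K]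
variable {M N P : PreMod A K} {γ : DeformationCocycle A K} {D₀ : Maps M M.omega}
  {D₁ : Maps N N.omega} {D₂ : Maps P P.omega}

/-- The connection on the morphisms of the cohomological category induced by relative connections. -/
def connHom (h₀ : IsRelativeConnection γ D₀) (h₁ : IsRelativeConnection γ D₁) : Conn k K (M ⟶ N) :=
  connH h₀ h₁ (n' := -1) (n := 0) rfl

/-- The induced connections satisfy the Leibniz rule for composition in `H⁰`. -/
theorem connHom_comp (h₀ : IsRelativeConnection γ D₀) (h₁ : IsRelativeConnection γ D₁)
    (h₂ : IsRelativeConnection γ D₂)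
    (θ : Derivation k K K) (f : M ⟶ N) (g : N ⟶ P) :
    (connHom h₀ h₂).nabla θ (f ≫ g) =
      (connHom h₀ h₁).nabla θ f ≫ g + f ≫ (connHom h₁ h₂).nabla θ g := by
  induction f using Submodule.Quotient.induction_on with
  | H b₁ =>
  induction g using Submodule.Quotient.induction_on with
  | H b₂ =>
  exact congrArg (toHom M P) (a₁ := (connCocycles h₀ h₂ 0).nabla θ (compCocycles M N P b₂ b₁))
    (a₂ := compCocycles M N P b₂ ((connCocycles h₀ h₁ 0).nabla θ b₁) +
      compCocycles M N P ((connCocycles h₁ h₂ 0).nabla θ b₂) b₁)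
    (Subtype.ext ((nab_comp (D₁ := ctr θ D₁) b₂.2.1 b₁.2.1
      (comp_mem_cocycles b₂.2 b₁.2).1.multilinear).trans (add_comm _ _)))

end PreMod

/-- The line bundle of a transport family is preserved by the induced connection. -/
theorem TransportFamily.stable {k : Type u} [Field k] {A : AInfCat k} {K : Type u} [CommRing K]
    [Algebra k K] {γ : DeformationCocycle A K} (T : TransportFamily γ) :
    (PreMod.connHom T.relative₀ T.relative₁).Stable T.B := by
  intro θ q hq
  induction q using Submodule.Quotient.induction_on with
  | H b =>
  obtain ⟨b, hb⟩ := b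
  have h := T.invariant b hb hq
  have hctr : ∀ x ∈ Maps.coboundaries T.M₀ T.M₁.omega ⊔ Submodule.span K
        {x | ∃ (ω : Ω[K⁄k]) (b' : Maps T.M₀ T.M₁) (hb' : b' ∈ Maps.cocycles T.M₀ T.M₁),
          PreMod.toHom T.M₀ T.M₁ ⟨b', hb'⟩ ∈ T.B ∧ x = Maps.omegaMul ω b'},
      ∃ hx : Maps.ctr θ x ∈ Maps.cocycles T.M₀ T.M₁, PreMod.toHom T.M₀ T.M₁ ⟨_, hx⟩ ∈ T.B := by
    intro x hx
    obtain ⟨_, ⟨c, hc, rfl⟩, y, hy, rfl⟩ := Submodule.mem_sup.1 hx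
    clear hx
    have h1 : Maps.ctr θ (Maps.d (-1) c) ∈ Maps.coboundaries T.M₀ T.M₁ :=
      ⟨Maps.ctr θ c, Maps.isHom_ctr θ hc, (Maps.ctr_d θ _ c).symm⟩
    have h1' := Maps.coboundaries_le_cocycles T.perfect₀.isFamily.toIsModule
      T.perfect₁.isFamily.toIsModule h1
    have h2 : ∃ hx : Maps.ctr θ y ∈ Maps.cocycles T.M₀ T.M₁,
        PreMod.toHom T.M₀ T.M₁ ⟨_, hx⟩ ∈ T.B := by
      induction hy using Submodule.span_induction with
      | mem x h =>
        obtain ⟨ω, b', hb', hB, rfl⟩ := h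
        exact ⟨Submodule.smul_mem _ (θ.liftKaehlerDifferential ω) hb', T.B.smul_mem (θ.liftKaehlerDifferential ω) hB⟩
      | zero =>
        have e : Maps.ctr θ (0 : Maps T.M₀ T.M₁.omega) = 0 := by
          simpa using Maps.ctr_smul θ (0 : K) (0 : Maps T.M₀ T.M₁.omega)
        rw [e]
        exact ⟨Submodule.zero_mem _, T.B.zero_mem⟩
      | add x y _ _ hx hy =>
        rw [Maps.ctr_add]
        obtain ⟨hx, hx'⟩ := hx
        obtain ⟨hy, hy'⟩ := hy
        exact ⟨Submodule.add_mem _ hx hy, T.B.add_mem hx' hy'⟩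
      | smul f x _ hx =>
        rw [Maps.ctr_smul]
        obtain ⟨hx, hx'⟩ := hx
        exact ⟨Submodule.smul_mem _ f hx, T.B.smul_mem f hx'⟩
    obtain ⟨hy, hB⟩ := h2
    rw [Maps.ctr_add]
    refine ⟨Submodule.add_mem _ h1' hy, ?_⟩
    have h0 : PreMod.toHom T.M₀ T.M₁ ⟨_, h1'⟩ = 0 := (Submodule.Quotient.mk_eq_zero _).2 h1
    have := T.B.add_mem (h0 ▸ T.B.zero_mem : PreMod.toHom T.M₀ T.M₁ ⟨_, h1'⟩ ∈ T.B) hB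
    exact this
  obtain ⟨hx, hB⟩ := hctr _ h
  convert hB using 1
  exact congrArg (PreMod.toHom T.M₀ T.M₁) (Subtype.ext (Maps.ctr_inducedConnection θ _ _ hb.1).symm)

end

/-! ### Words in a twisted complex -/

section

namespace PreTwisted
variable {k : Type u} [Field k] {A : AInfCat k} {K : Type u} [CommRing K] [Algebra k K]
variable (T : PreTwisted A K)

section words
variable {E : Type*} [AddCommMonoid E]

theorem fil_antitone (i : Fin T.num) : Antitone fun m => T.fil m i :=
  antitone_nat_of_succ_le fun m => T.fil_succ_le m i

/-- A word of length `r` raises the filtration by `r`. -/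
theorem wordSum_congr_fil (r : ℕ) (i : Fin T.num)
    (G G' : ∀ j : Fin T.num, (T.F i →ₗ[K] T.F j) → Chain A.hom (T.X i) (T.X j) → E)
    (h : ∀ j f w, w.deg = T.σ i - T.σ j → w.length = r →
      (∀ m, ∀ p ∈ T.fil m i, f p ∈ T.fil (m + r) j) → G j f w = G' j f w) :
    T.wordSum r i G = T.wordSum r i G' := by
  induction r generalizing G G' with
  | zero => exact h _ _ _ (by simp [Chain.deg]) rfl fun m p hp => hp
  | succ r ih =>
    refine ih _ _ fun j f w hw hl hf => ?_
    refine Finset.sum_congr rfl fun j' _ => Finset.sum_congr rfl fun s _ => h _ _ _ ?_ ?_ ?_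
    · simp only [Chain.deg, hw]
      ring
    · simp only [Chain.length, hl]
    · exact fun m p hp => T.strict s j j' (m + r) (hf m p hp)

/-- The ways of cutting a word into two words. -/
theorem wordSum_splitSum (r : ℕ) (i : Fin T.num)
    (G : ∀ j : Fin T.num, (T.F i →ₗ[K] T.F j) → ∀ Y, Chain A.hom Y (T.X j) →
      Chain A.hom (T.X i) Y → E) :
    (T.wordSum r i fun j f w => w.splitSum fun Y l q => G j f Y l q) =
      ∑ x ∈ Finset.HasAntidiagonal.antidiagonal r, T.wordSum x.1 i fun j₁ f₁ w₁ =>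
        T.wordSum x.2 j₁ fun j f₂ w₂ => G j (f₂ ∘ₗ f₁) (T.X j₁) w₂ w₁ := by
  induction r generalizing G with
  | zero => simp [wordSum, Chain.splitSum]
  | succ r ih =>
    rw [Finset.Nat.sum_antidiagonal_succ']
    have := ih fun j f Y l q => ∑ j', ∑ s, G j' (T.φ s j j' ∘ₗ f) Y (.cons (T.a s j j') l) q
    simp only [wordSum, LinearMap.comp_assoc, Chain.splitSum, Finset.sum_add_distrib, wordSum_add,
      LinearMap.id_comp] at this ⊢
    rw [← this]
    congr 1
    refine T.wordSum_congr _ _ _ _ fun j f w _ => ?_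
    have hsum : ∀ (I : Type) (t : Finset I) (H : I → ∀ Y, Chain A.hom Y (T.X j) →
        Chain A.hom (T.X i) Y → E), (w.splitSum fun Y l q => ∑ x ∈ t, H x Y l q) =
        ∑ x ∈ t, w.splitSum (H x) := by
      classical
      intro I t H
      induction t using Finset.induction_on with
      | empty => simpa using Chain.splitSum_zero w
      | insert x t hx ih => simp only [Finset.sum_insert hx, Chain.splitSum_add, ih]
    simp only [hsum]

/-- The sum over all words, as in `wordSum`, of length at most `len`; longer words involve a zero map
`f`, because of the filtration. -/
def words (i : Fin T.num)
    (G : ∀ j : Fin T.num, (T.F i →ₗ[K] T.F j) → Chain A.hom (T.X i) (T.X j) → E) : E :=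
  ∑ r ∈ Finset.range (T.len + 1), T.wordSum r i G

theorem words_congr (i : Fin T.num)
    (G G' : ∀ j : Fin T.num, (T.F i →ₗ[K] T.F j) → Chain A.hom (T.X i) (T.X j) → E)
    (h : ∀ j f w, w.deg = T.σ i - T.σ j → G j f w = G' j f w) : T.words i G = T.words i G' :=
  Finset.sum_congr rfl fun r _ => T.wordSum_congr r i G G' h

theorem words_zero (i : Fin T.num) : (T.words i fun _ _ _ => (0 : E)) = 0 := by
  simp only [words, wordSum_zero, Finset.sum_const_zero]

theorem words_add (i : Fin T.num)
    (G G' : ∀ j : Fin T.num, (T.F i →ₗ[K] T.F j) → Chain A.hom (T.X i) (T.X j) → E) :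
    (T.words i fun j f w => G j f w + G' j f w) = T.words i G + T.words i G' := by
  simp only [words, wordSum_add, Finset.sum_add_distrib]

theorem map_words {E' : Type*} [AddCommMonoid E'] (g : E →+ E') (i : Fin T.num)
    (G : ∀ j : Fin T.num, (T.F i →ₗ[K] T.F j) → Chain A.hom (T.X i) (T.X j) → E) :
    g (T.words i G) = T.words i fun j f w => g (G j f w) := by
  simp only [words, map_sum, map_wordSum]

theorem words_sum (i : Fin T.num) {I : Type*} (t : Finset I)
    (G : I → ∀ j : Fin T.num, (T.F i →ₗ[K] T.F j) → Chain A.hom (T.X i) (T.X j) → E) :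
    (T.words i fun j f w => ∑ x ∈ t, G x j f w) = ∑ x ∈ t, T.words i (G x) := by
  classical
  induction t using Finset.induction_on with
  | empty => simpa using T.words_zero i
  | insert x t hx ih => simp only [Finset.sum_insert hx, words_add, ih]

theorem words_comm (i : Fin T.num) {X Y : A.Ob} (c : Chain A.hom X Y)
    (G : ∀ j : Fin T.num, (T.F i →ₗ[K] T.F j) → Chain A.hom (T.X i) (T.X j) →
      ∀ Z, Chain A.hom Z Y → Chain A.hom X Z → E) :
    (T.words i fun j f w => c.splitSum (G j f w)) =
      c.splitSum fun Z l r => T.words i fun j f w => G j f w Z l r := by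
  induction c with
  | nil => rfl
  | cons a c ih => simp only [Chain.splitSum, words_add, ih]

/-- Cutting a word in two, summed over all words, gives the sum over all pairs of composable words; the
pairs of total length exceeding the length of the filtration contribute zero. -/
theorem words_splitSum (i : Fin T.num)
    (G : ∀ j : Fin T.num, (T.F i →ₗ[K] T.F j) → ∀ Y, Chain A.hom Y (T.X j) →
      Chain A.hom (T.X i) Y → E) (h : ∀ j Y l q, G j 0 Y l q = 0) :
    (T.words i fun j f w => w.splitSum fun Y l q => G j f Y l q) =
      T.words i fun j₁ f₁ w₁ => T.words j₁ fun j f₂ w₂ => G j (f₂ ∘ₗ f₁) (T.X j₁) w₂ w₁ := by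
  simp only [words, wordSum_splitSum, Finset.Nat.sum_antidiagonal_eq_sum_range_succ
    fun a b => T.wordSum a i fun j₁ f₁ w₁ => T.wordSum b j₁ fun j f₂ w₂ =>
      G j (f₂ ∘ₗ f₁) (T.X j₁) w₂ w₁, Nat.succ_eq_add_one]
  rw [Finset.sum_range_diag_flip (T.len + 1) fun a b => T.wordSum a i fun j₁ f₁ w₁ =>
    T.wordSum b j₁ fun j f₂ w₂ => G j (f₂ ∘ₗ f₁) (T.X j₁) w₂ w₁]
  refine Finset.sum_congr rfl fun a ha => ?_
  have hsum : ∀ t : Finset ℕ, (∑ b ∈ t, T.wordSum a i fun j₁ f₁ w₁ =>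
      T.wordSum b j₁ fun j f₂ w₂ => G j (f₂ ∘ₗ f₁) (T.X j₁) w₂ w₁) = T.wordSum a i fun j₁ f₁ w₁ =>
      ∑ b ∈ t, T.wordSum b j₁ fun j f₂ w₂ => G j (f₂ ∘ₗ f₁) (T.X j₁) w₂ w₁ := by
    intro t
    induction t using Finset.induction_on with
    | empty => simpa using (T.wordSum_zero a i).symm
    | insert x t hx ih => simp only [Finset.sum_insert hx, wordSum_add, ih]
  rw [← hsum]
  refine Finset.sum_subset (Finset.range_mono (by omega)) fun b hb hb' => ?_
  -- the total length exceeds the length of the filtration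
  refine (T.wordSum_congr_fil a i _ (fun _ _ _ => 0) fun j₁ f₁ w₁ _ _ h₁ => ?_).trans
    (T.wordSum_zero a i)
  refine (T.wordSum_congr_fil b j₁ _ (fun _ _ _ => 0) fun j f₂ w₂ _ _ h₂ => ?_).trans
    (T.wordSum_zero b j₁)
  have : f₂ ∘ₗ f₁ = 0 := LinearMap.ext fun p => by
    have := T.fil_antitone j (by simp at ha hb'; omega : T.len ≤ 0 + a + b)
      (h₂ _ _ (h₁ 0 p (T.fil_zero i ▸ trivial)))
    change _ ∈ T.fil T.len j at this
    rwa [T.fil_len, Submodule.mem_bot] at this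
  rw [this, h]

end words

/-- The element `p ⊗ b` of the `i`-th summand of `hom(X, T)`. -/
def inc {X : A.Ob} (n : ℤ) (i : Fin T.num) (p : T.F i) (b : A.hom X (T.X i) (n - T.σ i)) :
    T.yonedaObj X n :=
  Pi.single i (p ⊗ₜ[K] ((1 : K) ⊗ₜ[k] b))

theorem inc_zero_left {X : A.Ob} (n : ℤ) (i : Fin T.num) (b : A.hom X (T.X i) (n - T.σ i)) :
    T.inc n i 0 b = 0 := by
  rw [inc, TensorProduct.zero_tmul, Pi.single_zero]

/-- The map `p ↦ p ⊗ b`. -/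
def incₗ {X : A.Ob} (n : ℤ) (i : Fin T.num) (b : A.hom X (T.X i) (n - T.σ i)) :
    T.F i →ₗ[K] T.yonedaObj X n :=
  LinearMap.single K (fun j => T.F j ⊗[K] (K ⊗[k] A.hom X (T.X j) (n - T.σ j))) i ∘ₗ
    (TensorProduct.mk K _ _).flip ((1 : K) ⊗ₜ[k] b)

/-- The map `b ↦ p ⊗ b`. -/
def incᵣ {X : A.Ob} (n : ℤ) (i : Fin T.num) (p : T.F i) :
    A.hom X (T.X i) (n - T.σ i) →+ T.yonedaObj X n :=
  (LinearMap.single K (fun j => T.F j ⊗[K] (K ⊗[k] A.hom X (T.X j) (n - T.σ j))) i ∘ₗ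
    TensorProduct.mk K _ _ p).toAddMonoidHom.comp
      (TensorProduct.mk k K _ 1).toAddMonoidHom

theorem hom_ext {X : A.Ob} {n : ℤ} {E : Type*} [AddCommGroup E] {f g : T.yonedaObj X n →+ E}
    (h : ∀ i p b, f (T.inc n i p b) = g (T.inc n i p b)) : f = g := by
  ext i x
  change f (Pi.single i x) = g (Pi.single i x)
  induction x using TensorProduct.induction_on with
  | zero => simp
  | add x y hx hy => rw [Pi.single_add, map_add, map_add, hx, hy]
  | tmul p y =>
    induction y using TensorProduct.induction_on with
    | zero => simp
    | add x y hx hy => rw [TensorProduct.tmul_add, Pi.single_add, map_add, map_add, hx, hy]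
    | tmul κ b =>
      have : p ⊗ₜ[K] (κ ⊗ₜ[k] b) = (κ • p) ⊗ₜ[K] ((1 : K) ⊗ₜ[k] b) := by
        rw [TensorProduct.smul_tmul, TensorProduct.smul_tmul', smul_eq_mul, mul_one]
      rw [this]
      exact h i (κ • p) b

theorem yonedaTerm_inc {X Y : A.Ob} (c : Chain A.hom X Y) (n n' : ℤ) (i j : Fin T.num)
    (f : T.F i →ₗ[K] T.F j) (w : Chain A.hom (T.X i) (T.X j)) (p : T.F i)
    (b : A.hom Y (T.X i) (n - T.σ i)) :
    T.yonedaTerm c n n' i j f w (T.inc n i p b) =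
      T.inc n' j (f p) (A.μ (w.append (.cons b c)) (n' - T.σ j)) := by
  rw [yonedaTerm, LinearMap.comp_apply, LinearMap.comp_apply, LinearMap.proj_apply, inc,
    Pi.single_eq_same]
  rfl

theorem yonedaμ_inc {X Y : A.Ob} (c : Chain A.hom X Y) (n n' : ℤ) (i : Fin T.num) (p : T.F i)
    (b : A.hom Y (T.X i) (n - T.σ i)) :
    T.yonedaμ c n n' (T.inc n i p b) = T.words i fun j f w =>
      T.inc n' j (f p) (A.μ (w.append (.cons b c)) (n' - T.σ j)) := by
  rw [yonedaμ, LinearMap.sum_apply, Finset.sum_eq_single i]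
  · rw [LinearMap.sum_apply]
    refine Finset.sum_congr rfl fun r _ => ?_
    refine (T.map_wordSum (LinearMap.applyₗ (T.inc n i p b)).toAddMonoidHom r i _).trans ?_
    exact T.wordSum_congr r i _ _ fun j f w _ => T.yonedaTerm_inc c n n' i j f w p b
  · intro i' _ hi
    rw [LinearMap.sum_apply]
    refine Finset.sum_eq_zero fun r _ => ?_
    refine (T.map_wordSum (LinearMap.applyₗ (T.inc n i p b)).toAddMonoidHom r i' _).trans ?_
    refine (T.wordSum_congr r i' _ (fun _ _ _ => 0) fun j f w _ => ?_).trans (T.wordSum_zero r i')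
    change T.yonedaTerm c n n' i' j f w (T.inc n i p b) = 0
    rw [yonedaTerm, LinearMap.comp_apply, LinearMap.comp_apply, LinearMap.proj_apply, inc,
      Pi.single_eq_of_ne hi, map_zero, map_zero]
  · exact fun h => absurd (Finset.mem_univ i) h

end PreTwisted

end

/-! ### The Yoneda module of a twisted complex -/

section

theorem Chain.length_append {Ob : Type u} {H : Ob → Ob → ℤ → Type u} {X Y Z : Ob} (p : Chain H Y Z)
    (q : Chain H X Y) : (p.append q).length = p.length + q.length := by
  induction p with
  | nil => simp [append, length]
  | cons a p ih => simp only [append, length, ih]; omega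

namespace TwistedComplex
open PreTwisted
variable {k : Type u} [Field k] {A : AInfCat k} {K : Type u} [CommRing K] [Algebra k K]
variable (T : TwistedComplex A K)

/-- The Maurer-Cartan equation for `δ`, under an arbitrary additive map. -/
theorem words_maurerCartan (i : Fin T.num) {E : Type*} [AddCommGroup E]
    (Φ : ∀ j : Fin T.num, (T.F i →ₗ[K] T.F j) ⊗[K]
      (K ⊗[k] A.hom (T.X i) (T.X j) (T.σ i - T.σ j + 2)) →+ E) :
    (T.words i fun j f w => Φ j (f ⊗ₜ (1 ⊗ₜ A.μ w (T.σ i - T.σ j + 2)))) = 0 := by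
  have h : ∀ j₀ : Fin T.num, (T.words i fun j f w => Φ j₀ ((Pi.single j
      (f ⊗ₜ[K] ((1 : K) ⊗ₜ[k] A.μ w (T.σ i - T.σ j₀ + 2))) : ∀ j, (T.F i →ₗ[K] T.F j) ⊗[K]
        (K ⊗[k] A.hom (T.X i) (T.X j) (T.σ i - T.σ j₀ + 2))) j₀)) = 0 := by
    intro j₀
    have := congrArg ((Φ j₀).comp (Pi.evalAddMonoidHom (fun j => (T.F i →ₗ[K] T.F j) ⊗[K]
        (K ⊗[k] A.hom (T.X i) (T.X j) (T.σ i - T.σ j₀ + 2))) j₀))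
      (T.maurerCartan i (T.σ i - T.σ j₀ + 2))
    rw [map_zero, map_sum] at this
    simpa only [words, map_wordSum] using! this
  rw [← Finset.sum_eq_zero (s := Finset.univ) fun j₀ _ => h j₀, ← words_sum]
  refine T.words_congr _ _ _ fun j f w _ => ?_
  rw [Finset.sum_eq_single j]
  · rw [Pi.single_eq_same]
  · intro j' _ hj
    rw [Pi.single_eq_of_ne hj, map_zero]
  · exact fun h => absurd (Finset.mem_univ j) h

/-- The module equations at `p ⊗ b`: those terms of the `A_∞`-relations for `(δ, …, δ, b, c)` in which the
inner operation only involves `δ` add up to zero by the Maurer-Cartan equation. -/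
theorem yoneda_relation {X Y : A.Ob} (c : Chain A.hom X Y) (n n' : ℤ) (i : Fin T.num) (p : T.F i)
    (b : A.hom Y (T.X i) (n - T.σ i)) :
    (c.splitSum fun _ l r => sgn r.deg • T.yonedaμ r (n + l.deg + 1) n'
        (T.yonedaμ l n (n + l.deg + 1) (T.inc n i p b))) +
      (c.splitSum fun _ l w => w.splitSum fun _ q r =>
        sgn r.deg • T.yonedaμ (l.append (.cons (A.μ q (q.deg + 2)) r)) n n' (T.inc n i p b)) =
      0 := by
  -- the three kinds of terms of the `A_∞`-relation for the chain `w · b · c`, where `w` is a word in `δ`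
  let H : ∀ j : Fin T.num, (T.F i →ₗ[K] T.F j) → Chain A.hom X (T.X j) → T.yonedaObj X n' :=
    fun j f w => T.inc n' j (f p) (A.μ w (n' - T.σ j))
  have H0 : ∀ j w, H j 0 w = 0 := fun j w => T.inc_zero_left n' j _
  have h₁ : (c.splitSum fun _ l r => sgn r.deg • T.yonedaμ r (n + l.deg + 1) n'
        (T.yonedaμ l n (n + l.deg + 1) (T.inc n i p b))) =
      T.words i fun j f w => w.splitSum fun Z w₂ w₁ => c.splitSum fun _ l r => sgn r.deg •
        H j f (w₂.append (.cons (A.μ (w₁.append (.cons b l))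
          ((w₁.append (.cons b l)).deg + 2)) r)) := by
    rw [T.words_splitSum i (fun j f Z w₂ w₁ => c.splitSum fun _ l r => sgn r.deg •
        H j f (w₂.append (.cons (A.μ (w₁.append (.cons b l))
          ((w₁.append (.cons b l)).deg + 2)) r)))
      (fun j Y l q => by simp only [H0, smul_zero, Chain.splitSum_zero])]
    simp only [words_comm]
    refine Chain.splitSum_congr _ _ _ fun Z l r _ => ?_
    have hs : ∀ x : T.yonedaObj X n', sgn r.deg • x =
      DistribSMul.toAddMonoidHom (T.yonedaObj X n') (sgn r.deg) x := fun _ => rfl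
    have hμ : ∀ x, T.yonedaμ r (n + l.deg + 1) n' x =
      (T.yonedaμ r (n + l.deg + 1) n').toAddMonoidHom x := fun _ => rfl
    rw [yonedaμ_inc, hμ, map_words, hs, map_words]
    refine T.words_congr _ _ _ fun j₁ f₁ w₁ hw => ?_
    rw [← hμ, yonedaμ_inc, map_words]
    refine T.words_congr _ _ _ fun j f₂ w₂ _ => ?_
    rw [← hs]
    congr 1
    exact Maps.cons_congr (fun x => T.inc n' j (f₂ (f₁ p)) (A.μ x (n' - T.σ j))) w₂ _ r (by
      rw [Chain.deg_append, Chain.deg]; omega)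
  have h₂ : (c.splitSum fun _ l w => w.splitSum fun _ q r =>
        sgn r.deg • T.yonedaμ (l.append (.cons (A.μ q (q.deg + 2)) r)) n n' (T.inc n i p b)) =
      T.words i fun j f w => c.splitSum fun _ l w' => w'.splitSum fun _ q r => sgn r.deg •
        H j f ((w.append (.cons b l)).append (.cons (A.μ q (q.deg + 2)) r)) := by
    simp only [words_comm]
    refine Chain.splitSum_congr _ _ _ fun Z l w' _ => Chain.splitSum_congr _ _ _ fun Z' q r _ => ?_
    have hs : ∀ x : T.yonedaObj X n', sgn r.deg • x =
      DistribSMul.toAddMonoidHom (T.yonedaObj X n') (sgn r.deg) x := fun _ => rfl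
    rw [yonedaμ_inc, hs, map_words]
    refine T.words_congr _ _ _ fun j f w _ => ?_
    rw [← hs, ← Maps.append_cons_append]
  have h₃ : (T.words i fun j f w => w.splitSum fun _ l w' => w'.splitSum fun _ q r =>
      sgn (r.append (.cons b c)).deg •
        H j f (l.append (.cons (A.μ q (q.deg + 2)) (r.append (.cons b c))))) = 0 := by
    simp only [← Chain.splitSum_assoc _ fun U V l q r => sgn (r.append (.cons b c)).deg •
        H _ _ (l.append (.cons (A.μ q (q.deg + 2)) (r.append (.cons b c))))]
    rw [T.words_splitSum i (fun j f U w' r => w'.splitSum fun V l q =>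
        sgn (r.append (.cons b c)).deg •
          H j f (l.append (.cons (A.μ q (q.deg + 2)) (r.append (.cons b c)))))
      (fun j Y l q => by simp only [H0, smul_zero, Chain.splitSum_zero])]
    refine (T.words_congr i _ (fun _ _ _ => 0) fun j₁ f₁ r _ => ?_).trans (T.words_zero i)
    rw [T.words_splitSum j₁ (fun j f V l q => sgn (r.append (.cons b c)).deg •
          H j (f ∘ₗ f₁) (l.append (.cons (A.μ q (q.deg + 2)) (r.append (.cons b c)))))
      (fun j Y l q => by rw [LinearMap.zero_comp, H0, smul_zero])]
    let Φ : ∀ j₂ : Fin T.num, (T.F j₁ →ₗ[K] T.F j₂) ⊗[K]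
        (K ⊗[k] A.hom (T.X j₁) (T.X j₂) (T.σ j₁ - T.σ j₂ + 2)) →ₗ[K] T.yonedaObj X n' := fun j₂ =>
      T.words j₂ fun j f₃ l => sgn (r.append (.cons b c)).deg •
        (LinearMap.single K (fun j => T.F j ⊗[K] (K ⊗[k] A.hom X (T.X j) (n' - T.σ j))) j ∘ₗ
          TensorProduct.map (f₃ ∘ₗ LinearMap.applyₗ (f₁ p))
            ((A.slot l (r.append (.cons b c)) (T.σ j₁ - T.σ j₂ + 2) (n' - T.σ j)).baseChange K))
    rw [← T.words_maurerCartan j₁ fun j => (Φ j).toAddMonoidHom]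
    refine T.words_congr _ _ _ fun j₂ f₂ q hq => ?_
    have : ∀ x, (Φ j₂).toAddMonoidHom x =
      (LinearMap.applyₗ (R := K) x).toAddMonoidHom (Φ j₂) := fun _ => rfl
    rw [this, map_words]
    refine T.words_congr _ _ _ fun j f₃ l _ => ?_
    change _ = sgn (r.append (.cons b c)).deg • T.inc n' j (f₃ (f₂ (f₁ p))) (A.μ _ _)
    rw [← hq]
    rfl
  rw [h₁, h₂]
  refine (zero_add _).symm.trans ((congrArg (· + _) h₃.symm).trans ?_)
  rw [← words_add, ← words_add]
  refine (T.words_congr i _ (fun _ _ _ => 0) fun j f w _ => ?_).trans (T.words_zero i)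
  have hrel := A.relation (w.append (.cons b c)) (n' - T.σ j)
  rw [Chain.splitSum₃_append_cons] at hrel
  have hrel' := congrArg (T.incᵣ n' j (f p)) hrel
  simp only [map_add, map_zero, Chain.map_splitSum, map_zsmul] at hrel'
  rw [← hrel', ← add_assoc]
  rfl

theorem isModule_yoneda : T.yoneda.IsModule where
  relation {X Y} c n n' := by
    have : (c.splitSum fun _ l r => sgn r.deg • (T.yonedaμ r (n + l.deg + 1) n' ∘ₗ
          T.yonedaμ l n (n + l.deg + 1))) + (c.splitSum fun _ l w => w.splitSum fun _ q r =>
        sgn r.deg • T.yonedaμ (l.append (.cons (A.μ q (q.deg + 2)) r)) n n') = 0 := by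
      refine LinearMap.toAddMonoidHom_injective (T.hom_ext fun i p b => ?_)
      have ev : ∀ g : T.yonedaObj Y n →ₗ[K] T.yonedaObj X n', g.toAddMonoidHom (T.inc n i p b) =
        (LinearMap.applyₗ (R := K) (T.inc n i p b)).toAddMonoidHom g := fun _ => rfl
      rw [ev, map_add, Chain.map_splitSum, Chain.map_splitSum]
      simp only [Chain.map_splitSum]
      exact T.yoneda_relation c n n' i p b
    exact this
  μ_e X n := by
    refine LinearMap.toAddMonoidHom_injective (T.hom_ext fun i p b => ?_)
    change T.yonedaμ _ _ _ _ = T.inc n i p b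
    rw [yonedaμ_inc, words, Finset.sum_range_succ', Finset.sum_eq_zero, zero_add]
    · exact congrArg (T.inc n i p) (A.μ_right_e b)
    · intro r _
      refine (T.wordSum_congr_fil (r + 1) i _ (fun _ _ _ => 0) fun j f w _ hw _ => ?_).trans
        (T.wordSum_zero _ i)
      have := A.μ_higher_e (w.append (.cons b (.nil X))) (.nil X) (n - T.σ j) (by
        rw [Chain.length_append, hw]; simp only [Chain.length]; omega)
      have h2 : w.append (.cons b (.cons (A.e X) (.nil X))) =
        (w.append (.cons b (.nil X))).append (.cons (A.e X) (.nil X)) := by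
          rw [Chain.append_assoc]; rfl
      rw [h2, this]
      exact map_zero (T.incᵣ n j (f p))
  μ_higher_e {X Y Z} p q n n' h := by
    refine LinearMap.toAddMonoidHom_injective (T.hom_ext fun i x b => ?_)
    change T.yonedaμ _ _ _ _ = 0
    rw [yonedaμ_inc]
    refine (T.words_congr i _ (fun _ _ _ => 0) fun j f w _ => ?_).trans (T.words_zero i)
    have := A.μ_higher_e (w.append (.cons b p)) q (n' - T.σ j) (by
      rw [Chain.length_append, Chain.length]; omega)
    rw [Maps.append_cons_append, this]
    exact map_zero (T.incᵣ n' j (f x))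

end TwistedComplex

end

/-! ### Maps out of the Yoneda module -/

section

namespace AInfCat
variable {k : Type u} [Field k] (A : AInfCat k)

/-- The identity element of `X`, considered as an element of degree `n` when `n = 0` only
propositionally. -/
def eAt (X : A.Ob) (n : ℤ) : A.hom X X n := if h : n = 0 then h ▸ A.e X else 0

theorem cons_eAt {X Y : A.Ob} {n : ℤ} (h : n = 0) (c : Chain A.hom X Y) :
    (Chain.cons (A.eAt Y n) c : Chain A.hom X Y) = .cons (A.e Y) c := by
  subst h; rfl

end AInfCat

namespace PreTwisted
open Maps
variable {k : Type u} [Field k] {A : AInfCat k} {K : Type u} [CommRing K] [Algebra k K]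
variable (T : PreTwisted A K) {N : PreMod A K}

/-- The element `p ⊗ b` of the `i`-th summand of `hom(X, T)`, as an element of the Yoneda module. -/
def elt {X : A.Ob} (n : ℤ) (i : Fin T.num) (p : T.F i) (b : A.hom X (T.X i) (n - T.σ i)) :
    T.yoneda.obj X n :=
  T.inc n i p b

theorem yoneda_hom_ext {X : A.Ob} {n : ℤ} {E : Type*} [AddCommGroup E] {f g : T.yoneda.obj X n →+ E}
    (h : ∀ i p b, f (T.elt n i p b) = g (T.elt n i p b)) : f = g :=
  T.hom_ext h

/-- The element `p ⊗ e` of `hom(X_i, T)`. -/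
def unit (i : Fin T.num) : T.F i →ₗ[K] T.yoneda.obj (T.X i) (T.σ i) :=
  T.incₗ (T.σ i) i (A.eAt (T.X i) (T.σ i - T.σ i))

theorem map_yonedaμ_inc_of_fil {E : Type*} [AddCommGroup E] {X Y : A.Ob} {n' : ℤ}
    (g : T.yonedaObj X n' →+ E) {m : ℕ} (hg : ∀ j, ∀ q ∈ T.fil (m + 1) j, ∀ x,
      g (T.inc n' j q x) = 0) (c : Chain A.hom X Y) (n : ℤ) {i : Fin T.num} {p : T.F i}
    (hp : p ∈ T.fil m i) (b : A.hom Y (T.X i) (n - T.σ i)) :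
    g (T.yonedaμ c n n' (T.inc n i p b)) = g (T.inc n' i p (A.μ (.cons b c) (n' - T.σ i))) := by
  rw [yonedaμ_inc, words, Finset.sum_range_succ', map_add, map_sum, Finset.sum_eq_zero, zero_add]
  · rfl
  · intro r _
    rw [map_wordSum]
    refine (T.wordSum_congr_fil (r + 1) i _ (fun _ _ _ => 0) fun j f w _ _ hf => ?_).trans
      (T.wordSum_zero _ i)
    exact hg j _ (T.fil_antitone j (by omega) (hf m p hp)) _

/-- Up to higher order terms in the filtration, only the empty word contributes to the operations of
the Yoneda module. -/
theorem map_yoneda_elt_of_fil {E : Type*} [AddCommGroup E] {X Y : A.Ob} {n' : ℤ}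
    (g : T.yoneda.obj X n' →+ E) {m : ℕ} (hg : ∀ j, ∀ q ∈ T.fil (m + 1) j, ∀ x,
      g (T.elt n' j q x) = 0) (c : Chain A.hom X Y) (n : ℤ) {i : Fin T.num} {p : T.F i}
    (hp : p ∈ T.fil m i) (b : A.hom Y (T.X i) (n - T.σ i)) :
    g (T.yoneda.μ c n n' (T.elt n i p b)) = g (T.elt n' i p (A.μ (.cons b c) (n' - T.σ i))) :=
  T.map_yonedaμ_inc_of_fil g hg c n hp b

variable (N) in
/-- Families of linear maps `F_i ⊗ hom(X_{d-1}, X_i) ⊗ ⋯ ⊗ hom → N(X_0)`. -/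
abbrev Gen : Type u :=
  ∀ (i : Fin T.num) (X : A.Ob) (_ : Chain A.hom X (T.X i)) (j : ℤ), T.F i →ₗ[K] N.obj X j

/-- The linearity, degree and unitality conditions on an element of `Gen`. -/
structure IsGen (n : ℤ) (G : T.Gen N) : Prop where
  deg : ∀ (i : Fin T.num) (X : A.Ob) (c : Chain A.hom X (T.X i)) (j : ℤ),
    j ≠ T.σ i + c.deg + n → G i X c j = 0
  multilinear : ∀ (i : Fin T.num) (X : A.Ob) (j : ℤ),
    IsMultilinear k K fun c : Chain A.hom X (T.X i) => G i X c j
  unital : ∀ (i : Fin T.num) (X Y : A.Ob) (p : Chain A.hom Y (T.X i)) (q : Chain A.hom X Y) (j : ℤ),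
    0 < p.length → G i X (p.append (.cons (A.e Y) q)) j = 0

theorem IsGen.cons_zero {T : PreTwisted A K} {n : ℤ} {G : T.Gen N} (hG : T.IsGen n G)
    (i : Fin T.num) {X W : A.Ob} (a : ℤ) (c : Chain A.hom X W) (j : ℤ) (p : T.F i) :
    G i X (.cons (0 : A.hom W (T.X i) a) c) j p = 0 := by
  have := LinearMap.congr_fun ((hG.multilinear i X j).map_smul (.nil _) 0
    (0 : A.hom W (T.X i) a) c) p
  simpa [Chain.append] using this

/-- The map of modules `(p ⊗ b, c) ↦ ± G(p, b, c)` on the Yoneda module. -/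
def extend {n : ℤ} {G : T.Gen N} (hG : T.IsGen n G) : Maps T.yoneda N := fun X Y c a j =>
  (∑ i, sgn (T.σ i) • TensorProduct.lift (LinearMap.flip
    { plugK (hG.multilinear i X j) (.nil (T.X i)) c (a - T.σ i) with
      map_smul' := fun f x => by
        change plugK (hG.multilinear i X j) (.nil (T.X i)) c (a - T.σ i) (f • x) =
          f • plugK (hG.multilinear i X j) (.nil (T.X i)) c (a - T.σ i) x
        induction x using TensorProduct.induction_on with
        | zero => simp
        | tmul g b => rw [TensorProduct.smul_tmul', plugK_tmul, plugK_tmul, smul_assoc]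
        | add x y hx hy => rw [smul_add, map_add, map_add, hx, hy, smul_add] }) ∘ₗ
    LinearMap.proj (φ := fun i => T.F i ⊗[K] (K ⊗[k] A.hom Y (T.X i) (a - T.σ i))) i :
      T.yonedaObj Y a →ₗ[K] N.obj X j).toAddMonoidHom

theorem extend_elt {n : ℤ} {G : T.Gen N} (hG : T.IsGen n G) {X Y : A.Ob} (c : Chain A.hom X Y)
    (a j : ℤ) (i : Fin T.num) (p : T.F i) (b : A.hom Y (T.X i) (a - T.σ i)) :
    T.extend hG X Y c a j (T.elt a i p b) = sgn (T.σ i) • G i X (.cons b c) j p := by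
  change (∑ _, _ : T.yonedaObj Y a →ₗ[K] N.obj X j) (T.inc a i p b) = _
  rw [LinearMap.sum_apply, Finset.sum_eq_single i]
  · rw [LinearMap.smul_apply, LinearMap.comp_apply, LinearMap.proj_apply, inc, Pi.single_eq_same]
    change sgn (T.σ i) • ((1 : K) • G i X _ j) p = _
    rw [one_smul]
    rfl
  · intro i' _ hi
    rw [LinearMap.smul_apply, LinearMap.comp_apply, LinearMap.proj_apply, inc,
      Pi.single_eq_of_ne hi, map_zero, smul_zero]
  · exact fun h => absurd (Finset.mem_univ i) h

theorem isHom_extend {n : ℤ} {G : T.Gen N} (hG : T.IsGen n G) : IsHom (n - 1) (T.extend hG) where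
  smul X Y c a j f m := LinearMap.map_smul _ f m
  deg X Y c a j h := T.yoneda_hom_ext fun i p b => by
    rw [extend_elt, hG.deg i X _ j (by rw [Chain.deg]; omega)]
    simp
  multilinear X Y a j :=
    { map_add := fun l x y r => T.yoneda_hom_ext fun i p b => by
        rw [AddMonoidHom.add_apply, extend_elt, extend_elt, extend_elt, ← smul_add]
        congr 1
        exact LinearMap.congr_fun ((hG.multilinear i X j).map_add (.cons b l) x y r) p
      map_smul := fun l t x r => T.yoneda_hom_ext fun i p b => by
        rw [AddMonoidHom.smul_apply, extend_elt, extend_elt, smul_comm]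
        congr 1
        exact LinearMap.congr_fun ((hG.multilinear i X j).map_smul (.cons b l) t x r) p }
  unital X Y Z l r a j := T.yoneda_hom_ext fun i p b => by
    rw [extend_elt]
    have := LinearMap.congr_fun (hG.unital i X Y (.cons b l) r j (by simp [Chain.length])) p
    exact (congrArg _ this).trans (smul_zero _)

/-- The part of the differential which does not involve the operations of the Yoneda module. -/
def genD (n : ℤ) (G : T.Gen N) (i : Fin T.num) {X : A.Ob} (c : Chain A.hom X (T.X i)) (j : ℤ)
    (p : T.F i) : N.obj X j :=
  (c.splitSum fun Z l r => sgn (T.σ i + l.deg) • N.μ r (T.σ i + l.deg + n) j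
      (G i Z l (T.σ i + l.deg + n) p)) +
  (c.splitSum fun _ l w => w.splitSum fun _ q r =>
    sgn (T.σ i + l.deg + q.deg) • G i X (l.append (.cons (A.μ q (q.deg + 2)) r)) j p)

theorem Gen.mid (G : T.Gen N) {i : Fin T.num} {X Z : A.Ob} (l : Chain A.hom Z (T.X i))
    (r : Chain A.hom X Z) {j x y : ℤ} (h : x = y) (p : T.F i) :
    N.μ r x j (G i Z l x p) = N.μ r y j (G i Z l y p) := by
  subst h; rfl

/-- The differential of `extend G`, up to higher order terms in the filtration. -/
theorem d_extend {n : ℤ} {G : T.Gen N} (hG : T.IsGen n G) {m : ℕ}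
    (hm : ∀ j, ∀ q ∈ T.fil (m + 1) j, ∀ X c a, G j X c a q = 0) {X Y : A.Ob} (c : Chain A.hom X Y)
    (a j : ℤ) {i : Fin T.num} {p : T.F i} (hp : p ∈ T.fil m i)
    (b : A.hom Y (T.X i) (a - T.σ i)) :
    d (n - 1) (T.extend hG) X Y c a j (T.elt a i p b) =
      N.μ (.cons b c) (T.σ i + n) j (G i (T.X i) (.nil _) (T.σ i + n) p) -
        sgn (T.σ i) • T.genD n G i (.cons b c) j p := by
  have h1 : (c.splitSum fun Z l r => sgn (a + l.deg) • μMaps N X Z r (a + l.deg + (n - 1)) j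
        (T.extend hG Z Y l a (a + l.deg + (n - 1)) (T.elt a i p b))) =
      -(sgn (T.σ i) • c.splitSum fun Z l r => sgn (T.σ i + (Chain.cons b l).deg) •
        N.μ r (T.σ i + (Chain.cons b l).deg + n) j (G i Z (.cons b l)
          (T.σ i + (Chain.cons b l).deg + n) p)) := by
    rw [← neg_one_smul ℤ, smul_smul, zsmul_splitSum]
    refine Chain.splitSum_congr _ _ _ fun Z l r _ => ?_
    rw [extend_elt, map_zsmul, smul_smul, smul_smul]
    change _ • N.μ r _ j _ = _
    rw [Gen.mid T G (.cons b l) r (show a + l.deg + (n - 1) = T.σ i + (Chain.cons b l).deg + n by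
      rw [Chain.deg]; ring)]
    congr 1
    rw [← sgn_one, ← sgn_add, ← sgn_add, ← sgn_add, Chain.deg]
    exact sgn_congr ⟨0, by ring⟩
  have h2 : (c.splitSum fun Z l r => sgn (a + l.deg) • T.extend hG X Z r (a + l.deg + 1) j
        (μMaps T.yoneda Z Y l a (a + l.deg + 1) (T.elt a i p b))) =
      -(sgn (T.σ i) • c.splitSum fun Z q r => sgn (T.σ i + (Chain.cons b q).deg) •
        G i X (.cons (A.μ (.cons b q) ((Chain.cons b q).deg + 2)) r) j p) := by
    rw [← neg_one_smul ℤ, smul_smul, zsmul_splitSum]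
    refine Chain.splitSum_congr _ _ _ fun Z l r _ => ?_
    have e := T.map_yoneda_elt_of_fil (T.extend hG X Z r (a + l.deg + 1) j) (m := m)
      (fun j' q hq x => by rw [extend_elt, hm j' q hq, smul_zero]) l a hp b
    refine (congrArg (sgn (a + l.deg) • ·) e).trans ?_
    have e' : G i X (.cons (A.μ (.cons b l) (a + l.deg + 1 - T.σ i)) r) j p =
        G i X (.cons (A.μ (.cons b l) ((Chain.cons b l).deg + 2)) r) j p :=
      Maps.cons_congr (fun x => G i X x j p) (.nil _) (.cons b l) r (by rw [Chain.deg]; ring)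
    rw [extend_elt, smul_smul, smul_smul, e']
    congr 1
    rw [← sgn_one, ← sgn_add, ← sgn_add, ← sgn_add, Chain.deg]
    exact sgn_congr ⟨0, by ring⟩
  have h3 : (c.splitSum fun _ l w => w.splitSum fun _ q r =>
        sgn (a + l.deg + q.deg) • T.extend hG X Y
          (l.append (.cons (A.μ q (q.deg + 2)) r)) a j (T.elt a i p b)) =
      -(sgn (T.σ i) • c.splitSum fun _ l w => w.splitSum fun _ q r =>
        sgn (T.σ i + (Chain.cons b l).deg + q.deg) •
          G i X ((Chain.cons b l).append (.cons (A.μ q (q.deg + 2)) r)) j p) := by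
    rw [← neg_one_smul ℤ, smul_smul, zsmul_splitSum]
    refine Chain.splitSum_congr _ _ _ fun Z l w _ => ?_
    rw [zsmul_splitSum]
    refine Chain.splitSum_congr _ _ _ fun Z' q r _ => ?_
    rw [extend_elt, smul_smul, smul_smul]
    congr 1
    rw [← sgn_one, ← sgn_add, ← sgn_add, ← sgn_add, Chain.deg]
    exact sgn_congr ⟨0, by ring⟩
  rw [d_apply, h1, h2, h3, genD]
  simp only [Chain.splitSum, Chain.append, A.μ_nil]
  rw [hG.cons_zero, smul_zero, zero_add, Gen.mid T G (.nil _) (.cons b c)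
    (show T.σ i + (Chain.nil (H := A.hom) (T.X i)).deg + n = T.σ i + n by simp [Chain.deg])]
  simp only [smul_add, smul_smul, Chain.deg, add_zero, sgn_mul_self, one_smul]
  abel

end PreTwisted

end

/-! ### Cocycles and the filtration of the Yoneda module -/

section

namespace PreTwisted
open Maps
variable {k : Type u} [Field k] {A : AInfCat k} {K : Type u} [CommRing K] [Algebra k K]
variable (T : PreTwisted A K) {N : PreMod A K}

theorem exists_projection (m : ℕ) (i : Fin T.num) :
    ∃ π : T.F i →ₗ[K] T.F i, (∀ p, π p ∈ T.fil m i) ∧ ∀ p ∈ T.fil m i, π p = p := by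
  obtain ⟨C, hC⟩ := T.fil_compl m i
  exact ⟨(T.fil m i).subtype ∘ₗ Submodule.projectionOnto _ C hC, fun p => Subtype.prop _,
    fun p hp => congrArg Subtype.val (Submodule.projectionOnto_apply_left hC ⟨p, hp⟩)⟩

variable (N) in
/-- The maps on the Yoneda module which vanish on the `m`-th step of the filtration. -/
def vanishing (m : ℕ) : Submodule K (Maps T.yoneda N) where
  carrier := {t | ∀ i, ∀ p ∈ T.fil m i, ∀ (X Y : A.Ob) (c : Chain A.hom X Y) (a j : ℤ)
    (b : A.hom Y (T.X i) (a - T.σ i)), t X Y c a j (T.elt a i p b) = 0}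
  add_mem' {t t'} h h' i p hp X Y c a j b := by
    rw [add_apply', h i p hp, h' i p hp, add_zero]
  zero_mem' i p hp X Y c a j b := rfl
  smul_mem' f t h i p hp X Y c a j b := by
    rw [smul_apply', h i p hp, smul_zero]

/-- The values of a map at the elements `p ⊗ e`. -/
def restrict {n : ℤ} {t : Maps T.yoneda N} (ht : IsHom n t) : T.Gen N :=
  fun i _ c j => toLin ht c (T.σ i) j ∘ₗ T.unit i

theorem isGen_restrict {n : ℤ} {t : Maps T.yoneda N} (ht : IsHom n t) :
    T.IsGen n (T.restrict ht) where
  deg i X c j h := LinearMap.ext fun p => by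
    change t X (T.X i) c (T.σ i) j (T.unit i p) = 0
    rw [ht.deg X _ c _ j h]
    rfl
  multilinear i X j :=
    { map_add := fun p a b q => LinearMap.ext fun x =>
        DFunLike.congr_fun ((ht.multilinear X _ (T.σ i) j).map_add p a b q) (T.unit i x)
      map_smul := fun p f a q => LinearMap.ext fun x =>
        DFunLike.congr_fun ((ht.multilinear X _ (T.σ i) j).map_smul p f a q) (T.unit i x) }
  unital i X Y p q j _ := LinearMap.ext fun x =>
    DFunLike.congr_fun (ht.unital X Y _ p q (T.σ i) j) (T.unit i x)

/-- The value of `d t` at `p ⊗ e` followed by `b`: the operation `μ(e, b) = ± b` makes `t` itself appear,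
so that a cocycle `t` is determined by its values at the elements `p ⊗ e`. -/
theorem d_unit {n : ℤ} {t : Maps T.yoneda N} (ht : IsHom n t) {m : ℕ}
    (hm : t ∈ T.vanishing N (m + 1)) {X Y : A.Ob} (c : Chain A.hom X Y) (a j : ℤ)
    {i : Fin T.num} {p : T.F i} (hp : p ∈ T.fil m i) (b : A.hom Y (T.X i) (a - T.σ i)) :
    d n t X (T.X i) (.cons b c) (T.σ i) j (T.unit i p) =
      T.genD n (T.restrict ht) i (.cons b c) j p - sgn (T.σ i) • t X Y c a j (T.elt a i p b) := by
  have h2 : ((Chain.cons b c).splitSum fun Z l r => sgn (T.σ i + l.deg) •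
      t X Z r (T.σ i + l.deg + 1) j
        (μMaps T.yoneda Z _ l (T.σ i) (T.σ i + l.deg + 1) (T.unit i p))) =
      -(sgn (T.σ i) • t X Y c a j (T.elt a i p b)) := by
    have e : ∀ {Z : A.Ob} (l : Chain A.hom Z (T.X i)) (r : Chain A.hom X Z) (x : ℤ),
        t X Z r x j (μMaps T.yoneda Z _ l (T.σ i) x (T.unit i p)) =
          t X Z r x j (T.elt x i p (A.μ (.cons (A.e (T.X i)) l) (x - T.σ i))) := by
      intro Z l r x
      rw [← A.cons_eAt (sub_self (T.σ i))]
      exact T.map_yoneda_elt_of_fil (t X Z r x j) (fun j' q hq y => hm j' q hq _ _ r x j y) l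
        (T.σ i) hp (A.eAt (T.X i) (T.σ i - T.σ i))
    have e0 : ∀ {Z : A.Ob} (r : Chain A.hom X Z) (x : ℤ), t X Z r x j (T.elt x i p 0) = 0 := by
      intro Z r x
      have : T.elt (X := Z) x i p 0 = 0 := map_zero (T.incᵣ x i p)
      rw [this, map_zero]
    simp only [e, Chain.splitSum, A.μ_e, e0, smul_zero, zero_add]
    rw [Chain.splitSum_nil_left]
    · have e' : ∀ x, x = a → t X Y c x j (T.elt x i p
          (A.μ (.cons (A.e (T.X i)) (.cons b (.nil Y))) (x - T.σ i))) =
            sgn (a - T.σ i) • t X Y c a j (T.elt a i p b) := by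
        rintro x rfl
        rw [A.μ_left_e]
        have : T.elt x i p (sgn (x - T.σ i) • b) = sgn (x - T.σ i) • T.elt x i p b :=
          map_zsmul (T.incᵣ x i p) _ _
        rw [this, map_zsmul]
      rw [e' _ (by simp only [Chain.deg]; ring), smul_smul, ← neg_one_smul ℤ, smul_smul, ← sgn_add,
        ← sgn_one, ← sgn_add]
      congr 1
      exact sgn_congr ⟨a - 1 - T.σ i, by simp only [Chain.deg]; ring⟩
    · intro Z l r hl
      have := A.μ_higher_e (.nil _) (.cons b l) (T.σ i + (Chain.cons b l).deg + 1 - T.σ i)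
        (by simp only [Chain.length]; omega)
      rw [Chain.append] at this
      rw [this, e0, smul_zero]
  rw [d_apply, h2, genD]
  have hr : ∀ {Z : A.Ob} (l : Chain A.hom Z (T.X i)) (x : ℤ),
    T.restrict ht i Z l x p = t Z (T.X i) l (T.σ i) x (T.unit i p) := fun _ _ => rfl
  simp only [hr]
  change _ + _ + _ = _ + _ - _
  simp only [μMaps, LinearMap.toAddMonoidHom_coe]
  abel

/-- A cocycle takes `p ⊗ e` to a cocycle, for `p` in the last step of the filtration on which it is
nonzero. -/
theorem μ_unit {n : ℤ} {t : Maps T.yoneda N} (ht : IsHom n t) (hd : d n t = 0) {m : ℕ}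
    (hm : t ∈ T.vanishing N (m + 1)) {i : Fin T.num} {p : T.F i} (hp : p ∈ T.fil m i) (j : ℤ) :
    N.μ (.nil (T.X i)) (T.σ i + n) j (T.restrict ht i (T.X i) (.nil _) (T.σ i + n) p) = 0 := by
  have h := DFunLike.congr_fun (congrFun (congrFun (congrFun (congrFun (congrFun hd (T.X i)) (T.X i))
    (.nil _)) (T.σ i)) j) (T.unit i p)
  rw [d_apply] at h
  simp only [Chain.splitSum] at h
  have e := T.map_yoneda_elt_of_fil (t (T.X i) (T.X i) (.nil _)
    (T.σ i + (Chain.nil (H := A.hom) (T.X i)).deg + 1) j)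
    (fun j' q hq y => hm j' q hq _ _ _ _ j y) (.nil _)
        (T.σ i) hp (A.eAt (T.X i) (T.σ i - T.σ i))
  rw [A.cons_eAt (sub_self (T.σ i)), A.μ_e] at e
  have h0 : T.elt (X := T.X i) (T.σ i + (Chain.nil (H := A.hom) (T.X i)).deg + 1) i p 0 = 0 :=
    map_zero (T.incᵣ _ i p)
  rw [h0, map_zero] at e
  have e' : t (T.X i) (T.X i) (.nil _) (T.σ i + (Chain.nil (H := A.hom) (T.X i)).deg + 1) j
    (μMaps T.yoneda (T.X i) (T.X i) (.nil _) (T.σ i)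
      (T.σ i + (Chain.nil (H := A.hom) (T.X i)).deg + 1) (T.unit i p)) = 0 := e
  rw [e', smul_zero, add_zero, A.μ_nil] at h
  have h3 := (T.isGen_restrict ht).cons_zero i ((Chain.nil (H := A.hom) (T.X i)).deg + 2) (.nil (T.X i)) j p
  have h3' : t (T.X i) (T.X i) ((Chain.nil (T.X i)).append (.cons (0 : A.hom (T.X i) (T.X i)
    ((Chain.nil (H := A.hom) (T.X i)).deg + 2)) (.nil _))) (T.σ i) j (T.unit i p) = 0 := h3
  rw [h3', smul_zero, add_zero] at h
  have h4 := congrArg (sgn (T.σ i + (Chain.nil (H := A.hom) (T.X i)).deg) • ·) h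
  simp only [smul_smul, sgn_mul_self, one_smul] at h4
  have h5 : T.σ i + (Chain.nil (H := A.hom) (T.X i)).deg + n = T.σ i + n := by simp [Chain.deg]
  rw [← Gen.mid T (T.restrict ht) (.nil _) (.nil _) h5]
  exact h4.trans (smul_zero _)

/-- Insertion of the given elements `ν(p)` into the operations of `N`. -/
def insertInto {n : ℤ} (ν : ∀ i, T.F i →ₗ[K] N.obj (T.X i) (T.σ i + n - 1)) : T.Gen N :=
  fun i _ c j => N.μ c (T.σ i + n - 1) j ∘ₗ ν i

theorem isGen_insertInto (hN : N.IsModule) {n : ℤ}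
    (ν : ∀ i, T.F i →ₗ[K] N.obj (T.X i) (T.σ i + n - 1)) : T.IsGen n (T.insertInto ν) where
  deg i X c j h := by
    rw [insertInto, N.μ_deg c _ j (by omega), LinearMap.zero_comp]
  multilinear i X j :=
    { map_add := fun p a b q => by
        simp only [insertInto, (N.μ_multilinear X _ _ j).map_add, LinearMap.add_comp]
      map_smul := fun p f a q => by
        simp only [insertInto, (N.μ_multilinear X _ _ j).map_smul, LinearMap.smul_comp] }
  unital i X Y p q j hp := by
    rw [insertInto, hN.μ_higher_e p q _ j (by omega), LinearMap.zero_comp]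

/-- The module equations of `N`, for the elements `ν(p)`. -/
theorem genD_insertInto (hN : N.IsModule) {n : ℤ}
    (ν : ∀ i, T.F i →ₗ[K] N.obj (T.X i) (T.σ i + n - 1)) (i : Fin T.num) {X : A.Ob}
    (c : Chain A.hom X (T.X i)) (j : ℤ) (p : T.F i) : T.genD n (T.insertInto ν) i c j p = 0 := by
  have h := congrArg (sgn (T.σ i + c.deg) • ·) (LinearMap.congr_fun
    (hN.relation c (T.σ i + n - 1) j) (ν i p))
  have ev : ∀ g : N.obj (T.X i) (T.σ i + n - 1) →ₗ[K] N.obj X j, g (ν i p) =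
    (LinearMap.applyₗ (R := K) (ν i p)).toAddMonoidHom g := fun _ => rfl
  simp only [LinearMap.add_apply, smul_add, LinearMap.zero_apply, smul_zero] at h
  rw [← h, genD, ev, ev, Chain.map_splitSum, Chain.map_splitSum, zsmul_splitSum, zsmul_splitSum]
  congr 1
  · refine Chain.splitSum_congr _ _ _ fun Z l r hlr => ?_
    rw [map_zsmul, smul_smul]
    change _ = _ • N.μ r _ j (T.insertInto ν i Z l _ p)
    rw [Gen.mid T (T.insertInto ν) l r (show T.σ i + l.deg + n = T.σ i + n - 1 + l.deg + 1 by ring),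
      ← sgn_add]
    congr 1
    exact sgn_congr ⟨-r.deg, by omega⟩
  · refine Chain.splitSum_congr _ _ _ fun Z l w hlw => ?_
    rw [Chain.map_splitSum, zsmul_splitSum]
    refine Chain.splitSum_congr _ _ _ fun Z' q r hqr => ?_
    rw [map_zsmul, smul_smul, ← sgn_add]
    change _ = _ • (T.insertInto ν i X _ j p)
    congr 1
    exact sgn_congr ⟨-r.deg, by omega⟩

/-- A cocycle which vanishes on the `(m + 1)`-st step of the filtration, and is exact at the elements
`p ⊗ e` for `p` in the `m`-th step, is cohomologous to one which vanishes on the `m`-th step. -/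
theorem exists_sub_mem_vanishing (hN : N.IsModule) {n : ℤ} {t : Maps T.yoneda N} (ht : IsHom n t)
    (hd : d n t = 0) {m : ℕ} (hm : t ∈ T.vanishing N (m + 1))
    (h : ∀ i, ∀ p ∈ T.fil m i, T.restrict ht i (T.X i) (.nil _) (T.σ i + n) p ∈
      LinearMap.range (N.μ (.nil (T.X i)) (T.σ i + n - 1) (T.σ i + n))) :
    ∃ y, IsHom (n - 1) y ∧ t - d (n - 1) y ∈ T.vanishing N m := by
  have hu : ∀ i, ∀ p ∈ T.fil (m + 1) i, ∀ X c a, T.restrict ht i X c a p = 0 :=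
    fun i p hp X c a => hm i p hp _ _ c _ a _
  have hν : ∀ i, ∃ ν : T.F i →ₗ[K] N.obj (T.X i) (T.σ i + n - 1),
      (∀ p ∈ T.fil m i, N.μ (.nil (T.X i)) _ (T.σ i + n) (ν p) =
        T.restrict ht i (T.X i) (.nil _) (T.σ i + n) p) ∧ ∀ p ∈ T.fil (m + 1) i, ν p = 0 := by
    intro i
    obtain ⟨π, hπ, hπ'⟩ := T.exists_projection m i
    obtain ⟨ρ, hρ, hρ'⟩ := T.exists_projection (m + 1) i
    obtain ⟨ν, hν⟩ := Module.projective_lifting_property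
      (N.μ (.nil (T.X i)) (T.σ i + n - 1) (T.σ i + n)).rangeRestrict
      (LinearMap.codRestrict _ (T.restrict ht i (T.X i) (.nil _) (T.σ i + n) ∘ₗ π)
        fun p => h i _ (hπ p)) (LinearMap.surjective_rangeRestrict _)
    have hν' : ∀ p, N.μ (.nil (T.X i)) _ (T.σ i + n) (ν p) =
        T.restrict ht i (T.X i) (.nil _) (T.σ i + n) (π p) := fun p =>
      congrArg Subtype.val (LinearMap.congr_fun hν p)
    refine ⟨ν ∘ₗ (LinearMap.id - ρ), fun p hp => ?_, fun p hp => ?_⟩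
    · rw [LinearMap.comp_apply, hν', LinearMap.sub_apply, LinearMap.id_apply,
        hπ' _ (sub_mem hp (T.fil_succ_le m i (hρ p))), map_sub, hu i _ (hρ p), sub_zero]
    · rw [LinearMap.comp_apply, LinearMap.sub_apply, hρ' p hp, LinearMap.id_apply, sub_self,
        map_zero]
  choose ν hν hν0 using hν
  have hG := T.isGen_restrict ht
  have hG' := T.isGen_insertInto hN ν
  refine ⟨T.extend hG' - T.extend hG, (homDeg T.yoneda N (n - 1)).sub_mem (T.isHom_extend hG')
    (T.isHom_extend hG), fun i p hp X Y c a j b => ?_⟩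
  have h1 := T.d_extend hG hu c a j hp b
  have h2 := T.d_extend hG' (fun i p hp X c a => by
    rw [insertInto, LinearMap.comp_apply, hν0 i p hp, map_zero]) c a j hp b
  have h3 := T.d_unit ht hm c a j hp b
  rw [hd] at h3
  have h4 : T.genD n (T.restrict ht) i (.cons b c) j p =
      sgn (T.σ i) • t X Y c a j (T.elt a i p b) := (sub_eq_zero.1 h3.symm)
  rw [T.genD_insertInto hN, smul_zero, sub_zero] at h2
  have h5 : T.insertInto ν i (T.X i) (.nil _) (T.σ i + n) p =
    T.restrict ht i (T.X i) (.nil _) (T.σ i + n) p := hν i p hp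
  rw [h4, smul_smul, sgn_mul_self, one_smul] at h1
  rw [h5] at h2
  rw [map_sub, sub_apply', sub_apply', h1, h2]
  abel

end PreTwisted

end

/-! ### Finiteness of the morphism spaces out of a perfect family -/

section

section
variable {K : Type u} [CommRing K] {V : Type*} [AddCommGroup V] [Module K V]

theorem finite_quotient_of_le_sup [IsNoetherianRing K] (Z G B : Submodule K V) (hG : G.FG)
    (h : Z ≤ G ⊔ B) : Module.Finite K (Z ⧸ B.submoduleOf Z) := by
  have : Module.Finite K (G.map B.mkQ) := Module.Finite.iff_fg.2 (hG.map _)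
  let f : (Z ⧸ B.submoduleOf Z) →ₗ[K] (V ⧸ B) := Submodule.mapQ _ _ Z.subtype le_rfl
  have hf : Function.Injective f := by
    rw [← LinearMap.ker_eq_bot, LinearMap.ker_eq_bot']
    intro x hx
    induction x using Submodule.Quotient.induction_on with
    | H x =>
      have hx' : B.mkQ x.1 = 0 := hx
      exact (Submodule.Quotient.mk_eq_zero _).2 ((Submodule.Quotient.mk_eq_zero B).1 hx')
  have hr : ∀ x, f x ∈ G.map B.mkQ := by
    intro x
    induction x using Submodule.Quotient.induction_on with
    | H x =>
      obtain ⟨g, hg, b, hb, e⟩ := Submodule.mem_sup.1 (h x.2)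
      refine ⟨g, hg, ?_⟩
      change B.mkQ g = B.mkQ x.1
      rw [← e, map_add, (Submodule.Quotient.mk_eq_zero B).2 hb |> (show B.mkQ b = 0 from ·),
        add_zero]
  exact Module.Finite.of_injective (f.codRestrict (G.map B.mkQ) hr) fun x y hxy =>
    hf (congrArg Subtype.val hxy)

theorem exists_fg_sup_ker {W : Type*} [AddCommGroup W] [Module K W] [IsNoetherian K W]
    (f : V →ₗ[K] W) : ∃ G : Submodule K V, G.FG ∧ G ⊔ LinearMap.ker f = ⊤ := by
  obtain ⟨S, hS⟩ := (IsNoetherian.noetherian (LinearMap.range f) : (LinearMap.range f).FG)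
  have hS' : ∀ x : S, ∃ v, f v = x := fun x => by
    have : x.1 ∈ LinearMap.range f := hS ▸ Submodule.subset_span x.2
    exact this
  choose g hg using hS'
  refine ⟨Submodule.span K (Set.range g), Submodule.fg_span (Set.finite_range g), ?_⟩
  rw [← Submodule.comap_map_eq, Submodule.map_span, ← Set.range_comp]
  have : Set.range (f ∘ g) = S := by
    ext x
    simp [hg]
  rw [this, hS, eq_top_iff]
  exact fun v _ => ⟨v, rfl⟩

end

namespace TwistedComplex
open Maps PreTwisted
variable {k : Type u} [Field k] {A : AInfCat k} {K : Type u} [CommRing K] [Algebra k K]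
variable (T : TwistedComplex A K) {N : PreMod A K}

/-- The cocycles of degree `n` which vanish on the `m`-th step of the filtration are, up to
coboundaries, contained in a finitely generated module. -/
theorem exists_fg_cocyclesIn_le [IsNoetherianRing K] (hN : N.IsFamily) (n : ℤ) (m : ℕ) :
    ∃ G : Submodule K (Maps T.yoneda N), G.FG ∧
      cocyclesIn T.yoneda N n ⊓ T.vanishing N m ≤ G ⊔ coboundariesFrom T.yoneda N (n - 1) := by
  induction m with
  | zero =>
    refine ⟨⊥, Submodule.fg_bot, fun t ht => ?_⟩
    have : t = 0 := by
      funext X Y c i j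
      exact T.yoneda_hom_ext fun i' p b => ht.2 i' p (T.fil_zero i' ▸ trivial) _ _ c _ _ b
    exact this ▸ Submodule.zero_mem _
  | succ m ih =>
    obtain ⟨G, hG, hle⟩ := ih
    set L := cocyclesIn T.yoneda N n ⊓ T.vanishing N (m + 1)
    -- evaluation at the elements `p ⊗ e`, with values in the cohomology of `N`
    let ev : L →ₗ[K] (∀ i, T.fil m i →ₗ[K] Cohomology (N.μ (.nil (T.X i))) (T.σ i + n)) :=
      { toFun := fun t i => Submodule.mkQ _ ∘ₗ LinearMap.codRestrict
          (LinearMap.ker (N.μ (.nil (T.X i)) (T.σ i + n) (T.σ i + n + 1)))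
          (T.restrict t.2.1.1 i (T.X i) (.nil _) (T.σ i + n) ∘ₗ (T.fil m i).subtype)
          fun p => LinearMap.mem_ker.2 (T.μ_unit t.2.1.1 t.2.1.2 t.2.2 p.2 _)
        map_add' := fun t t' => rfl
        map_smul' := fun f t => rfl }
    have := hN.finite
    obtain ⟨G', hG', hker⟩ := exists_fg_sup_ker (K := K) (V := L)
      (W := ∀ i, T.fil m i →ₗ[K] Cohomology (N.μ (.nil (T.X i))) (T.σ i + n)) ev
    refine ⟨G'.map L.subtype ⊔ G, (hG'.map _).sup hG, fun t ht => ?_⟩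
    obtain ⟨g, hg, t', ht', e⟩ := Submodule.mem_sup.1
      (hker ▸ Submodule.mem_top : (⟨t, ht⟩ : L) ∈ G' ⊔ LinearMap.ker ev)
    obtain ⟨y, hy, hty⟩ := T.exists_sub_mem_vanishing hN.toIsModule t'.2.1.1 t'.2.1.2 t'.2.2
      fun i p hp => by
        have := LinearMap.congr_fun (congrFun (LinearMap.mem_ker.1 ht') i) ⟨p, hp⟩
        exact (Submodule.Quotient.mk_eq_zero ((LinearMap.range (N.μ (.nil (T.X i))
          (T.σ i + n - 1) (T.σ i + n))).submoduleOf (LinearMap.ker (N.μ (.nil (T.X i))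
            (T.σ i + n) (T.σ i + n + 1))))).1 this
    have hyB : d (n - 1) y ∈ coboundariesFrom T.yoneda N (n - 1) := ⟨y, hy, rfl⟩
    have hyZ := coboundariesFrom_le_cocyclesIn T.isModule_yoneda hN.toIsModule
      (sub_add_cancel n 1) hyB
    have h1 : t = (g : Maps T.yoneda N) + ((t'.1 - d (n - 1) y) + d (n - 1) y) := by
      rw [sub_add_cancel]
      exact (congrArg Subtype.val e).symm
    rw [h1, sup_assoc]
    refine Submodule.add_mem _ (Submodule.mem_sup_left ⟨g, hg, rfl⟩)
      (Submodule.mem_sup_right (Submodule.add_mem _ (hle ⟨Submodule.sub_mem _ t'.2.1 hyZ, hty⟩)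
        (Submodule.mem_sup_right hyB)))

end TwistedComplex

namespace Maps
variable {k : Type u} [Field k] {A : AInfCat k} {K : Type u} [CommRing K] [Algebra k K]
variable {M N P : PreMod A K}

/-- Composition with a fixed map on the right. -/
def compRight (b : Maps M P) : Maps P N →ₗ[K] Maps M N where
  toFun t := comp 0 t b
  map_add' t t' := add_comp 0 t t' b
  map_smul' f t := smul_comp 0 f t b

/-- The cohomology of the morphism complex, for a perfect family, is finitely generated in each
degree. -/
theorem finite_HomH [IsNoetherianRing K] (hM : M.IsPerfect) (hN : N.IsFamily) (n : ℤ) :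
    Module.Finite K (HomH M N (n - 1) n) := by
  obtain ⟨T, ⟨⟨f, g, hfg⟩⟩⟩ := hM.retract
  obtain ⟨G, hG, hle⟩ := T.exists_fg_cocyclesIn_le hN n T.len
  induction f using Submodule.Quotient.induction_on with
  | H f =>
  induction g using Submodule.Quotient.induction_on with
  | H g =>
  obtain ⟨c, hc, hdc⟩ : comp 0 g.1 f.1 - one M ∈ coboundaries M M :=
    (Submodule.Quotient.eq ((coboundaries M M).submoduleOf (cocycles M M))).1 hfg
  refine finite_quotient_of_le_sup _ (G.map (compRight f.1)) _ (hG.map _) fun t ht => ?_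
  have htg : comp 0 t g.1 ∈ cocyclesIn T.yoneda N n ⊓ T.vanishing N T.len := by
    refine ⟨⟨by simpa using! IsHom.comp ht.1 g.2.1, LinearMap.mem_ker.2 ?_⟩,
      fun i p hp X Y c a j b => ?_⟩
    · have h := d_comp 0 n t g.1
      rwa [LinearMap.mem_ker.1 ht.2, LinearMap.mem_ker.1 g.2.2, comp_zero, zero_comp, smul_zero,
        sub_zero, zero_add] at h
    · rw [T.fil_len, Submodule.mem_bot] at hp
      subst hp
      exact (congrArg _ (T.inc_zero_left a i b)).trans (map_zero _)
  have h1 : t = compRight f.1 (comp 0 t g.1) + d (n - 1) (comp (-1) t c) := by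
    have h := d_comp (-1) n t c
    rw [LinearMap.mem_ker.1 ht.2, zero_comp, smul_zero, zero_sub, show (-1 : ℤ) + n = n - 1 by ring,
      hdc, neg_add_cancel, sub_eq_add_neg (comp 0 _ _), comp_add, comp_neg, comp_one,
      ← comp_assoc] at h
    rw [h, compRight]
    simp
  obtain ⟨x, hx, _, ⟨y, hy, rfl⟩, e⟩ := Submodule.mem_sup.1 (hle htg)
  rw [h1, ← e, map_add, add_assoc]
  refine Submodule.add_mem _ (Submodule.mem_sup_left ⟨x, hx, rfl⟩) (Submodule.mem_sup_right
    (Submodule.add_mem _ ⟨comp 0 y f.1, by simpa using! IsHom.comp hy f.2.1, ?_⟩ ⟨comp (-1) t c, ?_, rfl⟩))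
  · have h := d_comp 0 (n - 1) y f.1
    rwa [LinearMap.mem_ker.1 f.2.2, comp_zero, sgn_zero, one_smul, sub_zero, zero_add] at h
  · have := IsHom.comp ht.1 hc
    rwa [neg_add_eq_sub] at this

end Maps

end

/-! ### Restriction to a fibre on the cochain level -/

section

variable {k : Type u} [Field k] {A : AInfCat k} {K : Type u} [CommRing K] [Algebra k K]

namespace PreMod
variable (s : K →ₐ[k] k) (M : PreMod A K)

/-- Restriction of elements to the fibre at `s`. -/
def red (X : A.Ob) (i : ℤ) : M.obj X i →+ (M.fibre s).obj X i :=
  letI : Algebra K k := s.toRingHom.toAlgebra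
  (TensorProduct.mk K k (M.obj X i) 1).toAddMonoidHom

variable {X : A.Ob} {i : ℤ}

theorem red_smul (f : K) (m : M.obj X i) : M.red s X i (f • m) = s f • M.red s X i m := by
  letI : Algebra K k := s.toRingHom.toAlgebra
  change (1 : k) ⊗ₜ[K] (f • m) = s f • ((1 : k) ⊗ₜ[K] m)
  rw [← TensorProduct.smul_tmul, TensorProduct.smul_tmul']
  rfl

theorem red_algebraMap_smul (t : k) (m : M.obj X i) :
    M.red s X i (algebraMap k K t • m) = t • M.red s X i m := by
  rw [red_smul, s.commutes]
  rfl

theorem red_surjective : Function.Surjective (M.red s X i) := by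
  letI : Algebra K k := s.toRingHom.toAlgebra
  intro (x : k ⊗[K] M.obj X i)
  induction x using TensorProduct.induction_on with
  | zero => exact ⟨0, map_zero _⟩
  | tmul t m =>
    refine ⟨algebraMap k K t • m, (M.red_algebraMap_smul s t m).trans ?_⟩
    change t • ((1 : k) ⊗ₜ[K] m) = _
    rw [TensorProduct.smul_tmul', smul_eq_mul, mul_one]
  | add x y hx hy =>
    obtain ⟨a, rfl⟩ := hx
    obtain ⟨b, rfl⟩ := hy
    exact ⟨a + b, map_add _ _ _⟩

theorem mem_smul_of_red_eq_zero {m : M.obj X i} (h : M.red s X i m = 0) :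
    m ∈ (RingHom.ker s : Ideal K) • (⊤ : Submodule K (M.obj X i)) := by
  letI : Algebra K k := s.toRingHom.toAlgebra
  let I : Submodule K (M.obj X i) := (RingHom.ker s : Ideal K) • ⊤
  have hI : ∀ (f : K) (m : M.obj X i), s f = 0 → I.mkQ (f • m) = 0 := fun f m hf =>
    (Submodule.Quotient.mk_eq_zero I).2 (Submodule.smul_mem_smul hf trivial)
  let φ : k ⊗[K] M.obj X i →+ M.obj X i ⧸ I := TensorProduct.liftAddHom
    (AddMonoidHom.mk' (fun t => I.mkQ.toAddMonoidHom.comp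
      (DistribSMul.toAddMonoidHom _ (algebraMap k K t))) fun t t' => by
        ext m
        change I.mkQ _ = I.mkQ _ + I.mkQ _
        rw [← map_add]
        congr 1
        exact (congrArg (· • m) (map_add (algebraMap k K) t t')).trans (add_smul _ _ m))
    fun f t m => by
      change I.mkQ (algebraMap k K (s f * t) • m) = I.mkQ (algebraMap k K t • f • m)
      rw [← sub_eq_zero, ← map_sub, smul_smul, ← sub_smul]
      exact hI _ _ (by simp [mul_comm])
  have h1 : φ ((1 : k) ⊗ₜ[K] m) = 0 := (congrArg φ h).trans (map_zero φ)
  have h2 : φ ((1 : k) ⊗ₜ[K] m) = I.mkQ m := by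
    change I.mkQ (algebraMap k K 1 • m) = _
    rw [map_one, one_smul]
  exact (Submodule.Quotient.mk_eq_zero I).1 (h2.symm.trans h1)

/-- The restriction to the fibre has a `k`-linear section. -/
theorem exists_section (X : A.Ob) (i : ℤ) : ∃ σ : (M.fibre s).obj X i →+ M.obj X i,
    (∀ y, M.red s X i (σ y) = y) ∧ ∀ (t : k) (y), σ (t • y) = algebraMap k K t • σ y := by
  letI : Module k (M.obj X i) := Module.compHom _ (algebraMap k K)
  let φ : M.obj X i →ₗ[k] (M.fibre s).obj X i :=
    { M.red s X i with map_smul' := fun t m => M.red_algebraMap_smul s t m }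
  obtain ⟨σ, hσ⟩ := φ.exists_rightInverse_of_surjective
    (LinearMap.range_eq_top.2 (M.red_surjective s))
  exact ⟨σ.toAddMonoidHom, fun y => LinearMap.congr_fun hσ y, fun t y => σ.map_smul t y⟩

end PreMod

namespace Maps
variable (s : K →ₐ[k] k) {M N P : PreMod A K}

theorem fibre_red {n : ℤ} {b : Maps M N} (hb : IsHom n b) {X Y : A.Ob} (c : Chain A.hom X Y)
    (i j : ℤ) (m : M.obj Y i) :
    fibre s hb X Y c i j (M.red s Y i m) = N.red s X j (b X Y c i j m) := rfl

theorem fibre_ext {N : PreMod A k} {b b' : Maps (M.fibre s) N}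
    (h : ∀ (X Y : A.Ob) (c : Chain A.hom X Y) (i j : ℤ) (m : M.obj Y i),
      b X Y c i j (M.red s Y i m) = b' X Y c i j (M.red s Y i m)) : b = b' := by
  funext X Y c i j
  ext x
  obtain ⟨m, rfl⟩ := M.red_surjective s x
  exact h X Y c i j m

theorem fibre_comp {n₁ n₂ n : ℤ} {b₂ : Maps N P} {b₁ : Maps M N} (h₂ : IsHom n₂ b₂)
    (h₁ : IsHom n₁ b₁) (h : IsHom n (comp n₁ b₂ b₁)) :
    fibre s h = comp n₁ (fibre s h₂) (fibre s h₁) := by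
  refine fibre_ext s fun X Y c i j m => ?_
  rw [fibre_red, comp_apply, comp_apply, Chain.map_splitSum]
  refine Chain.splitSum_congr _ _ _ fun Z l r _ => ?_
  rw [map_zsmul]
  rfl

theorem fibre_one : fibre s (isHom_one M) = one (M.fibre s) := by
  refine fibre_ext s fun X Y c i j m => ?_
  rw [fibre_red]
  cases c with
  | cons a c => exact map_zero _
  | nil =>
    by_cases h : i = j
    · subst h
      rw [one_nil, one_nil, map_zsmul]
    · rw [one_nil_ne _ _ h, one_nil_ne _ _ h]
      exact map_zero _

theorem fibre_d {n n' : ℤ} {b : Maps M N} (hb : IsHom n b) (h : IsHom n' (d n b)) :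
    fibre s h = d n (fibre s hb) := by
  letI : Algebra K k := s.toRingHom.toAlgebra
  haveI : IsScalarTower k K k := IsScalarTower.of_algebraMap_eq fun x => (s.commutes x).symm
  exact tensor_ext k k fun X Y c i j p m => (d_tensorMap_tmul k k hb c i j p m).symm

/-- Every morphism of the fibres lifts to a morphism of the families, on the cochain level. -/
theorem exists_fibre_eq (hM : M.IsFamily) {n : ℤ} {β : Maps (M.fibre s) (N.fibre s)}
    (hβ : IsHom n β) : ∃ (b : Maps M N) (hb : IsHom n b), fibre s hb = β := by
  choose σ hσ hσ' using fun X i => N.exists_section s X i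
  choose ι hι using fun X i => Module.projective_def'.1 (hM.projective X i)
  let b : Maps M N := fun X Y c i j => (Finsupp.linearCombination K
    (fun p => σ X j (β X Y c i j (M.red s Y i p))) ∘ₗ ι Y i).toAddMonoidHom
  have hb : ∀ {X Y : A.Ob} (c : Chain A.hom X Y) (i j : ℤ) (m : M.obj Y i), b X Y c i j m =
      Finsupp.linearCombination K (fun p => σ X j (β X Y c i j (M.red s Y i p))) (ι Y i m) :=
    fun _ _ _ _ => rfl
  have h : IsHom n b :=
    { smul := fun X Y c i j f m => by rw [hb, hb, map_smul, map_smul]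
      deg := fun X Y c i j hj => by
        ext m
        rw [hb, hβ.deg X Y c i j hj]
        simp [Finsupp.linearCombination_apply]
      multilinear := fun X Y i j =>
        { map_add := fun p x y q => by
            ext m
            simp only [hb, (hβ.multilinear X Y i j).map_add, AddMonoidHom.add_apply, map_add,
              Finsupp.linearCombination_apply, Finsupp.sum, smul_add, Finset.sum_add_distrib]
          map_smul := fun p t x q => by
            ext m
            simp only [hb, (hβ.multilinear X Y i j).map_smul, AddMonoidHom.smul_apply,
              Algebra.algebraMap_self, RingHom.id_apply, hσ',
              Finsupp.linearCombination_apply, Finsupp.sum, Finset.smul_sum,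
              smul_comm (algebraMap k K t)] }
      unital := fun X Y Z p q i j => by
        ext m
        rw [hb, hβ.unital]
        simp [Finsupp.linearCombination_apply] }
  refine ⟨b, h, fibre_ext s fun X Y c i j m => ?_⟩
  have hm : m = Finsupp.linearCombination K id (ι Y i m) :=
    (LinearMap.congr_fun (hι Y i) m).symm
  rw [fibre_red, hb]
  conv_rhs => rw [hm]
  simp only [Finsupp.linearCombination_apply, Finsupp.sum, map_sum, PreMod.red_smul, hσ, hβ.smul, id]

/-- A morphism which vanishes in the fibre at `s` is divisible by a local parameter. -/
theorem exists_smul_eq_smul [IsDomain K] (hN : N.IsFamily) {a g : K} (ha : a ≠ 0)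
    (hag : ∀ x, s x = 0 → ∃ y, g * x = a * y) {n : ℤ} {b : Maps M N} (hb : IsHom n b)
    (h : fibre s hb = 0) : ∃ b' : Maps M N, IsHom n b' ∧ g • b = a • b' := by
  have hinj : ∀ (X : A.Ob) (j : ℤ), Function.Injective fun x : N.obj X j => a • x := by
    intro X j
    have := hN.projective X j
    exact smul_right_injective _ ha
  have hdiv : ∀ (X Y : A.Ob) (c : Chain A.hom X Y) (i j : ℤ) (m : M.obj Y i),
      ∃ y, a • y = g • b X Y c i j m := by
    intro X Y c i j m
    have h0 : N.red s X j (b X Y c i j m) = 0 := by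
      rw [← fibre_red s hb, h]
      rfl
    have hmem := N.mem_smul_of_red_eq_zero s h0
    generalize b X Y c i j m = v at hmem
    induction hmem using Submodule.smul_induction_on' with
    | smul x hx n _ =>
      obtain ⟨y, hy⟩ := hag x hx
      exact ⟨y • n, by rw [smul_smul, smul_smul, hy]⟩
    | add x _ y _ hx hy =>
      obtain ⟨x', hx⟩ := hx
      obtain ⟨y', hy⟩ := hy
      exact ⟨x' + y', by rw [smul_add, smul_add, hx, hy]⟩
  choose b' hb' using hdiv
  let B : Maps M N := fun X Y c i j => AddMonoidHom.mk' (b' X Y c i j) fun m m' => hinj X j (by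
    simp only [smul_add, hb', map_add])
  have hB : ∀ X Y c i j m, a • B X Y c i j m = g • b X Y c i j m := hb'
  refine ⟨B, ?_, ?_⟩
  · exact
    { smul := fun X Y c i j f m => hinj X j (by
        simp only [smul_comm a f, hB, hb.smul, smul_comm g f])
      deg := fun X Y c i j hj => by
        ext m
        refine hinj X j ?_
        simp [hB, hb.deg X Y c i j hj]
      multilinear := fun X Y i j =>
        { map_add := fun p x y q => by
            ext m
            refine hinj X j ?_
            simp only [hB, (hb.multilinear X Y i j).map_add, AddMonoidHom.add_apply, smul_add]
          map_smul := fun p t x q => by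
            ext m
            refine hinj X j ?_
            simp only [hB, (hb.multilinear X Y i j).map_smul, AddMonoidHom.smul_apply,
              smul_comm _ (algebraMap k K t)] }
      unital := fun X Y Z p q i j => by
        ext m
        refine hinj X j ?_
        simp [hB, hb.unital] }
  · funext X Y c i j
    ext m
    exact (hB X Y c i j m).symm

end Maps

end

/-! ### Restriction to a fibre in cohomology -/

section

namespace PreMod
open CategoryTheory Maps
variable {k : Type u} [Field k] {A : AInfCat k} {K : Type u} [CommRing K] [Algebra k K]
variable (s : K →ₐ[k] k) {M N P : PreMod A K}

theorem fibreMap_id : fibreMap s M M (𝟙 M) = 𝟙 (M.fibre s) :=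
  congrArg (toHom (M.fibre s) (M.fibre s)) (a₁ := fibreCocycles s M M ⟨one M, isHom_one M, d_one M⟩)
    (a₂ := ⟨one (M.fibre s), isHom_one _, d_one _⟩) (Subtype.ext (fibre_one s))

theorem fibreMap_comp (f : M ⟶ N) (g : N ⟶ P) :
    fibreMap s M P (f ≫ g) = fibreMap s M N f ≫ fibreMap s N P g := by
  induction f using Submodule.Quotient.induction_on with
  | H f =>
  induction g using Submodule.Quotient.induction_on with
  | H g =>
  exact congrArg (toHom (M.fibre s) (P.fibre s)) (a₁ := fibreCocycles s M P (compCocycles M N P g f))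
    (a₂ := compCocycles _ _ _ (fibreCocycles s N P g) (fibreCocycles s M N f))
    (Subtype.ext (fibre_comp s g.2.1 f.2.1 (compCocycles M N P g f).2.1))

theorem fibreMap_smul (f : K) (x : M ⟶ N) : fibreMap s M N (f • x) = s f • fibreMap s M N x :=
  (fibreMap s M N).map_smulₛₗ f x

variable [IsDomain K] [Algebra.Smooth k K] (hK : ringKrullDim K = 1)
include hK

/-- A morphism in `H⁰` whose restriction to the fibre at `s` is zero is a combination of morphisms with
coefficients vanishing at `s`: after subtracting the coboundary of a lifted null-homotopy, a representing
cocycle vanishes at `s`, hence is divisible by a local parameter. -/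
theorem mem_smul_of_fibreMap_eq_zero [IsAlgClosed k] [CharZero k] (hM : M.IsFamily)
    (hN : N.IsFamily) {x : M ⟶ N} (h : fibreMap s M N x = 0) :
    x ∈ (RingHom.ker s : Ideal K) • (⊤ : Submodule K (M ⟶ N)) := by
  obtain ⟨a, g, ha, hsa, hsg, hag⟩ := exists_local_parameter hK s
  induction x using Submodule.Quotient.induction_on with
  | H b =>
  obtain ⟨β, hβ, hdβ⟩ : Maps.fibre s b.2.1 ∈ coboundaries (M.fibre s) (N.fibre s) :=
    (Submodule.Quotient.mk_eq_zero ((coboundaries (M.fibre s) (N.fibre s)).submoduleOf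
      (cocycles (M.fibre s) (N.fibre s)))).1 h
  obtain ⟨y, hy, rfl⟩ := exists_fibre_eq s hM hβ
  have hdy := isHom_d hM.toIsModule hN.toIsModule hy
  have hsub : IsHom 0 (b.1 - d (-1) y) := (homDeg M N 0).sub_mem b.2.1 hdy
  have h0 : Maps.fibre s hsub = 0 := by
    refine fibre_ext s fun X Y c i j m => ?_
    rw [fibre_red, sub_apply', map_sub, ← fibre_red s b.2.1, ← fibre_red s hdy,
      fibre_d s hy hdy, hdβ, sub_self]
    rfl
  obtain ⟨b', hb', e⟩ := exists_smul_eq_smul s hN ha hag hsub h0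
  have hdb' : b' ∈ cocycles M N := by
    refine ⟨hb', LinearMap.mem_ker.2 ?_⟩
    have hdd : d 0 (d (-1) y) = 0 := LinearMap.mem_ker.1
      (coboundaries_le_cocycles hM.toIsModule hN.toIsModule ⟨y, hy, rfl⟩).2
    have h1 : a • d 0 b' = 0 := by
      rw [← map_smul, ← e, map_smul, map_sub, LinearMap.mem_ker.1 b.2.2, hdd, sub_zero, smul_zero]
    funext X Y c i j
    ext m
    have := hN.projective X j
    exact (smul_eq_zero.1 (DFunLike.congr_fun (congrFun (congrFun (congrFun (congrFun (congrFun h1 X)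
      Y) c) i) j) m)).resolve_left ha
  have key : toHom M N b = a • toHom M N ⟨b', hdb'⟩ + (1 - g) • toHom M N b := by
    have h2 : g • toHom M N b = a • toHom M N ⟨b', hdb'⟩ := by
      rw [← map_smul, ← map_smul]
      refine (Submodule.Quotient.eq _).2 ⟨g • y, (homDeg M N (-1)).smul_mem g hy, ?_⟩
      rw [map_smul]
      change g • d (-1) y = g • b.1 - a • b'
      rw [← e, smul_sub, sub_sub_cancel]
    rw [← h2, sub_smul, one_smul, add_sub_cancel]
  change toHom M N b ∈ _
  rw [key]
  exact add_mem (Submodule.smul_mem_smul hsa trivial)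
    (Submodule.smul_mem_smul (show s (1 - g) = 0 by simp [hsg]) trivial)

/-- Morphisms in `H⁰` between the fibres at `s` lift to the families. If `b` lifts a cocycle of the fibre,
then `g • d b = a • b'` for a local parameter `a`, and the class of the cocycle `b'` is torsion in `H¹`,
which is torsion-free because of the connection that it carries. -/
theorem fibreMap_surjective [IsAlgClosed k] [CharZero k] (hM : M.IsPerfect) (hN : N.IsFamily)
    {γ : DeformationCocycle A K} {D₀ : Maps M M.omega} {D₁ : Maps N N.omega}
    (h₀ : IsRelativeConnection γ D₀) (h₁ : IsRelativeConnection γ D₁) :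
    Function.Surjective (fibreMap s M N) := by
  have : IsNoetherianRing K := Algebra.FiniteType.isNoetherianRing k K
  obtain ⟨a, g, ha, hsa, hsg, hag⟩ := exists_local_parameter hK s
  have hM' := hM.isFamily.toIsModule
  intro β
  induction β using Submodule.Quotient.induction_on with
  | H β =>
  obtain ⟨b, hb, hbβ⟩ := exists_fibre_eq s hM.isFamily β.2.1
  have hdb := isHom_d hM' hN.toIsModule hb
  obtain ⟨b', hb', e⟩ := exists_smul_eq_smul s hN ha hag hdb (by
    rw [fibre_d s hb hdb, hbβ]
    exact β.2.2)
  have hdb' : b' ∈ cocyclesIn M N 1 := by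
    refine ⟨hb', LinearMap.mem_ker.2 ?_⟩
    have h1 : a • d 1 b' = 0 := by
      rw [← map_smul, ← e, map_smul]
      exact (congrArg (g • ·) (d_d hM' hN.toIsModule hb.isPre)).trans (smul_zero _)
    funext X Y c i j
    ext m
    have := hN.projective X j
    exact (smul_eq_zero.1 (DFunLike.congr_fun (congrFun (congrFun (congrFun (congrFun (congrFun h1 X)
      Y) c) i) j) m)).resolve_left ha
  -- the obstruction class is torsion in `H¹`, hence zero
  have hfin : Module.Finite K (HomH M N 0 1) := finite_HomH hM hN 1
  let Q : Submodule K (cocyclesIn M N 1) :=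
    (coboundariesFrom M N 0).submoduleOf (cocyclesIn M N 1)
  have h2 : a • (Submodule.Quotient.mk ⟨b', hdb'⟩ : HomH M N 0 1) = 0 := by
    refine (Submodule.Quotient.mk_eq_zero Q).2 ⟨g • b, (homDeg M N 0).smul_mem g hb, ?_⟩
    rw [map_smul]
    exact e
  obtain ⟨y, hy, hdy⟩ : b' ∈ coboundariesFrom M N 0 := (Submodule.Quotient.mk_eq_zero Q).1
    ((connH h₀ h₁ (n' := 0) (n := 1) rfl).torsionFree ha h2)
  have hz' : IsHom 0 (g • b - a • y) :=
    (homDeg M N 0).sub_mem ((homDeg M N 0).smul_mem g hb) ((homDeg M N 0).smul_mem a hy)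
  have hz : g • b - a • y ∈ cocycles M N := by
    refine ⟨hz', LinearMap.mem_ker.2 ?_⟩
    rw [map_sub, map_smul, map_smul, hdy, sub_eq_zero]
    exact e
  refine ⟨toHom M N ⟨_, hz⟩, congrArg (toHom (M.fibre s) (N.fibre s))
    (a₁ := fibreCocycles s M N ⟨_, hz⟩) (a₂ := β) (Subtype.ext (fibre_ext s fun X Y c i j m => ?_))⟩
  change Maps.fibre s hz' X Y c i j _ = _
  rw [fibre_red, sub_apply', map_sub, smul_apply', smul_apply', red_smul, red_smul, hsa, hsg,
    one_smul, zero_smul, sub_zero, ← hbβ, fibre_red]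

end PreMod

end

/-! ### Local endomorphism rings in linear categories -/

section

section LinearCategory
open CategoryTheory
variable {C : Type*} [Category C] [Preadditive C] {R : Type*} [CommRing R] [Linear R C]
  {X Y Z W : C}

/-- The submodule spanned by the composites `f ≫ g` with `f ∈ p` and `g ∈ q`. -/
abbrev compSpan (p : Submodule R (X ⟶ Y)) (q : Submodule R (Y ⟶ Z)) : Submodule R (X ⟶ Z) :=
  Submodule.map₂ (Linear.comp (S := R) X Y Z) p q

theorem comp_mem_compSpan {p : Submodule R (X ⟶ Y)} {q : Submodule R (Y ⟶ Z)} {f : X ⟶ Y}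
    {g : Y ⟶ Z} (hf : f ∈ p) (hg : g ∈ q) : f ≫ g ∈ compSpan p q :=
  Submodule.apply_mem_map₂ (Linear.comp X Y Z) hf hg

/-- The endomorphism ring of `X` is commutative, and each of its elements is invertible or
nilpotent. (The zero ring is allowed.) -/
structure UnitOrNilpotentEnd (X : C) : Prop where
  comm : ∀ x y : X ⟶ X, x ≫ y = y ≫ x
  isUnit_or_isNilpotent : ∀ x : End X, IsUnit x ∨ IsNilpotent x

/-- If all composites `X ⟶ Y ⟶ X` were nilpotent, then so would be their linear combination `𝟙 X`.
Otherwise `X` is a direct summand of `Y`, given by an idempotent of `Y`, which is invertible or zero. -/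
theorem UnitOrNilpotentEnd.id_eq_zero_or_nonempty_iso (hX : UnitOrNilpotentEnd X)
    (hY : UnitOrNilpotentEnd Y)
    (h : compSpan (R := R) (⊤ : Submodule R (X ⟶ Y)) (⊤ : Submodule R (Y ⟶ X)) = ⊤) :
    𝟙 X = 0 ∨ Nonempty (X ≅ Y) := by
  by_cases hu : ∃ (f : X ⟶ Y) (g : Y ⟶ X), IsUnit (M := End X) (f ≫ g)
  · obtain ⟨f, g, u, hu⟩ := hu
    have hv : f ≫ (g ≫ (↑u⁻¹ : End X)) = 𝟙 X := by
      rw [← Category.assoc, ← hu]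
      exact u.inv_mul
    generalize g ≫ (↑u⁻¹ : End X) = g' at hv
    have he : IsIdempotentElem (M := End Y) (g' ≫ f) := by
      change (g' ≫ f) ≫ (g' ≫ f) = g' ≫ f
      rw [Category.assoc, ← Category.assoc f, hv, Category.id_comp]
    rcases hY.isUnit_or_isNilpotent (g' ≫ f) with h1 | h1
    · exact .inr ⟨⟨f, g', hv, (IsIdempotentElem.iff_eq_one_of_isUnit h1).1 he⟩⟩
    · left
      have h0 : g' ≫ f = 0 := he.eq_zero_of_isNilpotent h1
      rw [← Category.comp_id (𝟙 X), ← hv, Category.assoc, reassoc_of% h0, Limits.zero_comp,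
        Limits.comp_zero]
  · left
    push Not at hu
    have hnil : ∀ x : End X, IsNilpotent x := by
      intro x
      have hx : (x : X ⟶ X) ∈ compSpan (R := R) (⊤ : Submodule R (X ⟶ Y)) (⊤ : Submodule R (Y ⟶ X)) :=
        h ▸ trivial
      rw [compSpan, Submodule.map₂_eq_span_image2] at hx
      induction hx using Submodule.span_induction with
      | mem x hx =>
        obtain ⟨f, -, g, -, rfl⟩ := hx
        exact (hX.isUnit_or_isNilpotent (f ≫ g)).resolve_left (hu f g)
      | zero => exact IsNilpotent.zero (R := End X)
      | add x y _ _ hx hy => exact Commute.isNilpotent_add (R := End X) (hX.comm y x) hx hy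
      | smul r x _ hx => exact IsNilpotent.smul (S := End X) hx r
    obtain ⟨n, hn⟩ := hnil (1 : End X)
    rwa [one_pow] at hn

/-- Two objects with local endomorphism rings (or zero ones) are isomorphic if the identity of each of
them is a linear combination of endomorphisms which factor through the other one. -/
theorem UnitOrNilpotentEnd.nonempty_iso (hX : UnitOrNilpotentEnd X) (hY : UnitOrNilpotentEnd Y)
    (h : compSpan (R := R) (⊤ : Submodule R (X ⟶ Y)) (⊤ : Submodule R (Y ⟶ X)) = ⊤)
    (h' : compSpan (R := R) (⊤ : Submodule R (Y ⟶ X)) (⊤ : Submodule R (X ⟶ Y)) = ⊤) :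
    Nonempty (X ≅ Y) := by
  rcases hX.id_eq_zero_or_nonempty_iso hY h with h0 | h0
  · rcases hY.id_eq_zero_or_nonempty_iso hX h' with h1 | ⟨⟨e⟩⟩
    · exact ⟨⟨0, 0, by rw [h0, Limits.zero_comp], by rw [h1, Limits.zero_comp]⟩⟩
    · exact ⟨e.symm⟩
  · exact h0

theorem compSpan_top_eq_top_of_iso (e : X ≅ Y) :
    compSpan (R := R) (⊤ : Submodule R (X ⟶ Y)) (⊤ : Submodule R (Y ⟶ X)) = ⊤ := by
  refine eq_top_iff.2 fun x _ => ?_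
  have := comp_mem_compSpan (R := R) (p := ⊤) (q := ⊤) (f := e.hom) (g := e.inv ≫ x) trivial trivial
  rwa [e.hom_inv_id_assoc] at this

/-- If `b` and `c` generate the same morphisms `X₀ ⟶ Y₁`, then isomorphisms `X₀ ≅ Y₀` and `X₁ ≅ Y₁`
can be chosen so that they carry `b` to `c`. -/
theorem exists_iso_of_compSpan_eq {X₀ X₁ Y₀ Y₁ : C} (e₀ : X₀ ≅ Y₀) (e₁ : X₁ ≅ Y₁)
    (h₁ : UnitOrNilpotentEnd X₁) (b : X₀ ⟶ X₁) (c : Y₀ ⟶ Y₁)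
    (h : compSpan (R := R) (⊤ : Submodule R (X₀ ⟶ Y₀)) (Submodule.span R {c}) =
      compSpan (R := R) (Submodule.span R {b}) (⊤ : Submodule R (X₁ ⟶ Y₁))) :
    ∃ e₁' : X₁ ≅ Y₁, ∀ x, x ∈ Submodule.span R {b} ↔
      e₀.inv ≫ x ≫ e₁'.hom ∈ Submodule.span R {c} := by
  suffices h : ∃ e₁' : X₁ ≅ Y₁, e₀.inv ≫ b ≫ e₁'.hom = c by
    obtain ⟨e₁', he⟩ := h
    refine ⟨e₁', fun x => ?_⟩
    rw [← Category.assoc, ← Linear.homCongr_apply R] at he ⊢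
    simp only [Submodule.mem_span_singleton, ← he, ← map_smul, EmbeddingLike.apply_eq_iff_eq]
  rw [compSpan, compSpan, Submodule.map₂_span_singleton_eq_map,
    Submodule.map₂_span_singleton_eq_map_flip] at h
  obtain ⟨y, -, hy⟩ : e₀.hom ≫ c ∈ Submodule.map (Linear.comp X₀ X₁ Y₁ b) (⊤ : Submodule R _) :=
    h ▸ ⟨e₀.hom, trivial, rfl⟩
  obtain ⟨x, -, hx⟩ : b ≫ e₁.hom ∈ Submodule.map ((Linear.comp X₀ Y₀ Y₁).flip c)
      (⊤ : Submodule R _) :=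
    h ▸ ⟨e₁.hom, trivial, rfl⟩
  replace hy : b ≫ y = e₀.hom ≫ c := hy
  replace hx : x ≫ c = b ≫ e₁.hom := hx
  let ν : End X₁ := y ≫ e₁.inv
  let μ : End X₀ := x ≫ e₀.inv
  have hc : c = e₀.inv ≫ b ≫ ν ≫ e₁.hom := by
    simp [ν, hy]
  have hb : b = μ ≫ b ≫ ν := by
    rw [← cancel_mono e₁.hom, ← hx]
    conv_lhs => rw [hc]
    simp [μ]
  rcases h₁.isUnit_or_isNilpotent ν with ⟨u, hu⟩ | ⟨n, hn⟩
  · have h1 : ν ≫ (↑u⁻¹ : End X₁) = 𝟙 X₁ := by rw [← hu]; exact u.inv_mul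
    have h2 : (↑u⁻¹ : End X₁) ≫ ν = 𝟙 X₁ := by rw [← hu]; exact u.mul_inv
    exact ⟨⟨ν, (↑u⁻¹ : End X₁), h1, h2⟩ ≪≫ e₁, hc.symm⟩
  · -- here `b = μⁿ b νⁿ` vanishes, and so does `c`
    have hpow : ∀ n : ℕ, ∃ z : X₀ ⟶ X₀, b = z ≫ b ≫ (ν ^ n : End X₁) := by
      intro n
      induction n with
      | zero => exact ⟨𝟙 _, by rw [Category.id_comp]; exact (Category.comp_id b).symm⟩
      | succ n ih =>
        obtain ⟨z, hz⟩ := ih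
        refine ⟨μ ≫ z, ?_⟩
        conv_lhs => rw [hb, hz]
        rw [pow_succ', End.mul_def]
        simp
    obtain ⟨z, hz⟩ := hpow n
    rw [hn] at hz
    have hb0 : b = 0 := by
      rw [hz]
      change z ≫ b ≫ (0 : X₁ ⟶ X₁) = 0
      simp
    exact ⟨e₁, by rw [hc, hb0]; simp⟩

/-- If `p` and `q` are both isomorphic to a subspace `r` for which the two multiplication maps have the same
image, then so do the multiplications of `p` and `q` with the morphisms between the respective objects. -/
theorem compSpan_eq_of_iso {P₀ P₁ X₀ X₁ Y₀ Y₁ : C} (f₀ : X₀ ≅ P₀) (f₁ : X₁ ≅ P₁) (g₀ : Y₀ ≅ P₀)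
    (g₁ : Y₁ ≅ P₁) {p : Submodule R (X₀ ⟶ X₁)} {q : Submodule R (Y₀ ⟶ Y₁)}
    {r : Submodule R (P₀ ⟶ P₁)} (hp : ∀ b, b ∈ p ↔ f₀.inv ≫ b ≫ f₁.hom ∈ r)
    (hq : ∀ c, c ∈ q ↔ g₀.inv ≫ c ≫ g₁.hom ∈ r)
    (hr : compSpan (⊤ : Submodule R (P₀ ⟶ P₀)) r = compSpan r (⊤ : Submodule R (P₁ ⟶ P₁))) :
    compSpan (⊤ : Submodule R (X₀ ⟶ Y₀)) q = compSpan p (⊤ : Submodule R (X₁ ⟶ Y₁)) := by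
  let φ : (P₀ ⟶ P₁) →ₗ[R] (X₀ ⟶ Y₁) := Linear.leftComp R Y₁ f₀.hom ∘ₗ Linear.rightComp R P₀ g₁.inv
  have hφ : ∀ z, φ z = f₀.hom ≫ z ≫ g₁.inv := fun z => rfl
  refine le_antisymm (Submodule.map₂_le.2 fun x _ c hc => ?_) (Submodule.map₂_le.2 fun b hb y _ => ?_)
  · have h1 : compSpan r (⊤ : Submodule R (P₁ ⟶ P₁)) ≤
        (compSpan p (⊤ : Submodule R (X₁ ⟶ Y₁))).comap φ := by
      refine Submodule.map₂_le.2 fun l hl y _ => ?_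
      have := comp_mem_compSpan (R := R) (p := p) (q := ⊤) (f := f₀.hom ≫ l ≫ f₁.inv)
        (g := f₁.hom ≫ y ≫ g₁.inv) ((hp _).2 (by simpa using hl)) trivial
      simpa [hφ] using this
    have h2 := h1 (hr ▸ comp_mem_compSpan (f := f₀.inv ≫ x ≫ g₀.hom) Submodule.mem_top ((hq c).1 hc))
    simpa [hφ] using h2
  · have h1 : compSpan (⊤ : Submodule R (P₀ ⟶ P₀)) r ≤
        (compSpan (⊤ : Submodule R (X₀ ⟶ Y₀)) q).comap φ := by
      refine Submodule.map₂_le.2 fun x _ l hl => ?_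
      have := comp_mem_compSpan (R := R) (p := ⊤) (q := q) (f := f₀.hom ≫ x ≫ g₀.inv)
        (g := g₀.hom ≫ l ≫ g₁.inv) trivial ((hq _).2 (by simpa using hl))
      simpa [hφ] using this
    have h2 := h1 (hr ▸ comp_mem_compSpan (g := f₁.inv ≫ y ≫ g₁.hom) ((hp b).1 hb) Submodule.mem_top)
    simpa [hφ] using h2

end LinearCategory

end

/-! ### Transport of invariant submodules and of local endomorphism rings -/

section

theorem Conn.stable_span {k : Type u} [Field k] {K : Type u} [CommRing K] [Algebra k K] {Q : Type u}
    [AddCommGroup Q] [Module K Q] (c : Conn k K Q) {S : Set Q}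
    (h : ∀ θ, ∀ q ∈ S, c.nabla θ q ∈ Submodule.span K S) : c.Stable (Submodule.span K S) := by
  intro θ q hq
  induction hq using Submodule.span_induction with
  | mem q hq => exact h θ q hq
  | zero => rw [map_zero]; exact Submodule.zero_mem _
  | add x y _ _ hx hy => rw [map_add]; exact add_mem hx hy
  | smul f x hx' hx =>
    rw [c.leibniz]
    exact add_mem (Submodule.smul_mem _ _ hx') (Submodule.smul_mem _ _ hx)

namespace PreMod
open CategoryTheory Maps

section LocalEnd
variable {k : Type u} [Field k] {A : AInfCat k} {M : PreMod A k}

/-- Every endomorphism differs from a multiple of the identity by a nilpotent one. -/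
theorem HasLocalEnd.exists_isNilpotent_sub (h : M.HasLocalEnd) (x : End M) :
    ∃ t : k, IsNilpotent (x - t • (1 : End M)) := by
  let S : Submodule k (M ⟶ M) := Submodule.span k {x : M ⟶ M | IsNilpotent (R := End M) x}
  have hS : ∀ x ∈ S, IsNilpotent (R := End M) x := by
    intro x hx
    induction hx using Submodule.span_induction with
    | mem x hx => exact hx
    | zero => exact IsNilpotent.zero (R := End M)
    | add x y _ _ hx hy => exact Commute.isNilpotent_add (R := End M) (h.comm y x) hx hy
    | smul r x _ hx => exact IsNilpotent.smul (S := End M) hx r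
  by_cases h1 : IsNilpotent (1 : End M)
  · obtain ⟨n, hn⟩ := h1
    rw [one_pow] at hn
    refine ⟨0, 1, ?_⟩
    rw [pow_one, zero_smul, sub_zero, ← mul_one x, hn, mul_zero]
  · have h2 : (Submodule.Quotient.mk (𝟙 M) : (M ⟶ M) ⧸ S) ≠ 0 := fun h0 =>
      h1 (hS _ ((Submodule.Quotient.mk_eq_zero S).1 h0))
    obtain ⟨t, ht⟩ := (finrank_eq_one_iff_of_nonzero' _ h2).1 h.codim (Submodule.Quotient.mk x)
    refine ⟨t, hS _ ((Submodule.Quotient.eq S).1 ?_)⟩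
    exact ht.symm

end LocalEnd

variable {k : Type u} [Field k] {A : AInfCat k} {K : Type u} [CommRing K] [Algebra k K]
  {M N P : PreMod A K}

section Stable
variable {γ : DeformationCocycle A K} {D₀ : Maps M M.omega} {D₁ : Maps N N.omega}
  {D₂ : Maps P P.omega} (h₀ : IsRelativeConnection γ D₀) (h₁ : IsRelativeConnection γ D₁)
  (h₂ : IsRelativeConnection γ D₂)

theorem stable_compSpan {p : Submodule K (M ⟶ N)} {q : Submodule K (N ⟶ P)}
    (hp : (connHom h₀ h₁).Stable p) (hq : (connHom h₁ h₂).Stable q) :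
    (connHom h₀ h₂).Stable (compSpan p q) := by
  rw [compSpan, Submodule.map₂_eq_span_image2]
  refine Conn.stable_span _ fun θ x hx => ?_
  obtain ⟨f, hf, g, hg, rfl⟩ := hx
  rw [← Submodule.map₂_eq_span_image2]
  have := add_mem (comp_mem_compSpan (hp θ f hf) hg) (comp_mem_compSpan hf (hq θ g hg))
  rwa [← connHom_comp h₀ h₁ h₂] at this

end Stable

variable (s : K →ₐ[k] k)

instance : RingHomSurjective s.toRingHom := ⟨fun t => ⟨algebraMap k K t, s.commutes t⟩⟩

/-- Restriction to a fibre commutes with taking the span of composites. -/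
theorem map_fibreMap_compSpan (p : Submodule K (M ⟶ N)) (q : Submodule K (N ⟶ P)) :
    (compSpan p q).map (fibreMap s M P) =
      compSpan (p.map (fibreMap s M N)) (q.map (fibreMap s N P)) := by
  refine le_antisymm (Submodule.map_le_iff_le_comap.2 (Submodule.map₂_le.2 fun f hf g hg => ?_))
    (Submodule.map₂_le.2 ?_)
  · have := comp_mem_compSpan (Submodule.mem_map_of_mem (f := fibreMap s M N) hf)
      (Submodule.mem_map_of_mem (f := fibreMap s N P) hg)
    rwa [← fibreMap_comp] at this
  · rintro _ ⟨f, hf, rfl⟩ _ ⟨g, hg, rfl⟩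
    exact ⟨f ≫ g, comp_mem_compSpan hf hg, fibreMap_comp s f g⟩

/-- Restriction of endomorphisms to the fibre at `s`, as a ring homomorphism. -/
def fibreRingHom (M : PreMod A K) : End M →+* End (M.fibre s) where
  toFun := fibreMap s M M
  map_one' := fibreMap_id s
  map_mul' f g := fibreMap_comp s g f
  map_zero' := (fibreMap s M M).map_zero
  map_add' := (fibreMap s M M).map_add

theorem fibreRingHom_algebraMap (f : K) :
    fibreRingHom s M (algebraMap K (End M) f) = algebraMap k (End (M.fibre s)) (s f) := by
  rw [Algebra.algebraMap_eq_smul_one, Algebra.algebraMap_eq_smul_one]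
  exact (fibreMap_smul s f (𝟙 M)).trans (congrArg (s f • ·) (fibreMap_id s))

variable [IsAlgClosed k] [CharZero k] [IsDomain K] [Algebra.Smooth k K] (hK : ringKrullDim K = 1)
  {γ : DeformationCocycle A K} {D₀ : Maps M M.omega} {D₁ : Maps N N.omega}
  (h₀ : IsRelativeConnection γ D₀) (h₁ : IsRelativeConnection γ D₁)
include hK

theorem le_of_map_fibreMap_le (hM : M.IsPerfect) (hN : N.IsPerfect) {p q : Submodule K (M ⟶ N)}
    (hp : (connHom h₀ h₁).Stable p) (hq : (connHom h₀ h₁).Stable q)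
    (h : p.map (fibreMap s M N) ≤ q.map (fibreMap s M N)) : p ≤ q := by
  have : IsNoetherianRing K := Algebra.FiniteType.isNoetherianRing k K
  have : Module.Finite K (M ⟶ N) := finite_HomH hM hN.isFamily 0
  refine (connHom h₀ h₁).le_of_le_sup_smul s p q hp hq fun x hx => ?_
  obtain ⟨y, hy, hxy⟩ := h (Submodule.mem_map_of_mem hx)
  rw [← add_sub_cancel y x]
  refine Submodule.add_mem_sup hy (mem_smul_of_fibreMap_eq_zero s hK hM.isFamily hN.isFamily ?_)
  rw [map_sub, hxy, sub_self]

/-- Two submodules of the morphisms between perfect families which are invariant under the induced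
connection agree if their restrictions to one fibre agree. -/
theorem eq_of_map_fibreMap_eq (hM : M.IsPerfect) (hN : N.IsPerfect) {p q : Submodule K (M ⟶ N)}
    (hp : (connHom h₀ h₁).Stable p) (hq : (connHom h₀ h₁).Stable q)
    (h : p.map (fibreMap s M N) = q.map (fibreMap s M N)) : p = q :=
  le_antisymm (le_of_map_fibreMap_le s hK h₀ h₁ hM hN hp hq h.le)
    (le_of_map_fibreMap_le s hK h₀ h₁ hM hN hq hp h.ge)

include h₀ in
/-- Local endomorphism rings are transported from one fibre to another one. -/
theorem unitOrNilpotentEnd_fibre (s' : K →ₐ[k] k) (hM : M.IsPerfect)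
    (hcomm : ∀ x y : M.fibre s ⟶ M.fibre s, x ≫ y = y ≫ x)
    (hnil : ∀ x : End (M.fibre s), ∃ t : k, IsNilpotent (x - t • (1 : End (M.fibre s)))) :
    UnitOrNilpotentEnd (M.fibre s') := by
  have : IsNoetherianRing K := Algebra.FiniteType.isNoetherianRing k K
  have hfin : Module.Finite K (M ⟶ M) := finite_HomH hM hM.isFamily 0
  have hsurj := fibreMap_surjective s' hK hM hM.isFamily h₀ h₀
  -- commutators form an invariant submodule which vanishes at `s`
  have hc : ∀ x y : M ⟶ M, x ≫ y = y ≫ x := by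
    let J : Submodule K (M ⟶ M) := Submodule.span K {z | ∃ x y : M ⟶ M, z = x ≫ y - y ≫ x}
    have hJ : (connHom h₀ h₀).Stable J := by
      refine Conn.stable_span _ ?_
      rintro θ _ ⟨x, y, rfl⟩
      have h1 : (connHom h₀ h₀).nabla θ x ≫ y - y ≫ (connHom h₀ h₀).nabla θ x ∈ J :=
        Submodule.subset_span ⟨_, _, rfl⟩
      have h2 : x ≫ (connHom h₀ h₀).nabla θ y - (connHom h₀ h₀).nabla θ y ≫ x ∈ J :=
        Submodule.subset_span ⟨_, _, rfl⟩
      convert add_mem h1 h2 using 1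
      rw [map_sub, connHom_comp h₀ h₀ h₀, connHom_comp h₀ h₀ h₀]
      abel
    have hJs : J ≤ (RingHom.ker s : Ideal K) • ⊤ := by
      refine Submodule.span_le.2 ?_
      rintro _ ⟨x, y, rfl⟩
      refine mem_smul_of_fibreMap_eq_zero s hK hM.isFamily hM.isFamily ?_
      rw [map_sub, fibreMap_comp, fibreMap_comp, hcomm, sub_self]
    intro x y
    have h1 : x ≫ y - y ≫ x ∈ J := Submodule.subset_span ⟨_, _, rfl⟩
    rw [(connHom h₀ h₀).eq_bot_of_le_smul s J hJ hJs] at h1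
    exact sub_eq_zero.1 h1
  letI : CommRing (End M) := { (inferInstance : Ring (End M)) with mul_comm := fun x y => hc y x }
  refine ⟨fun x y => ?_, fun x => ?_⟩
  · obtain ⟨x, rfl⟩ := hsurj x
    obtain ⟨y, rfl⟩ := hsurj y
    rw [← fibreMap_comp, ← fibreMap_comp, hc]
  letI : Algebra K (End M) := (inferInstance : Algebra K (End M))
  have : Module.Finite K (End M) := hfin
  refine isUnit_or_isNilpotent_of_conn (k := k) (K := K) (H := End M) (connHom h₀ h₀)
    (fun θ x y => ?_) s s' (fun x => ?_) (fibreRingHom s' M) hsurj (fun f hf => ?_) x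
  · exact (connHom_comp h₀ h₀ h₀ θ y x).trans (add_comm _ _)
  · obtain ⟨t, n, hn⟩ := hnil (fibreRingHom s M x)
    refine ⟨algebraMap k K t, n, mem_smul_of_fibreMap_eq_zero s hK hM.isFamily hM.isFamily ?_⟩
    change fibreRingHom s M _ = 0
    rw [map_pow, map_sub, ← hn, ← Algebra.algebraMap_eq_smul_one]
    congr 2
    exact (fibreRingHom_algebraMap s _).trans (by rw [s.commutes]; rfl)
  · exact (fibreRingHom_algebraMap s' f).trans (by rw [hf, map_zero])

end PreMod

end

/-! ### Parallel transport of triples -/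

section

open CategoryTheory

/-- The image of a line bundle under a map to a vector space, which is linear over the restriction to a
point, is spanned by one element. -/
theorem exists_span_range_eq_span_singleton {k K B E : Type*} [Field k] [CommRing K] (σ : K →+* k)
    [AddCommGroup B] [Module K B] [Module.Invertible K B] [AddCommGroup E] [Module k E]
    (φ : B →ₛₗ[σ] E) : ∃ e, Submodule.span k (Set.range φ) = Submodule.span k {e} := by
  letI : Algebra K k := σ.toAlgebra
  obtain ⟨v, -, hv⟩ := finrank_eq_one_iff'.1
    (Module.Invertible.finrank_eq_one k (M := k ⊗[K] B))
  letI : Module K E := Module.compHom _ σ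
  have : IsScalarTower K k E := ⟨fun f t x => mul_smul (σ f) t x⟩
  let ψ : B →ₗ[K] E := { φ with map_smul' := φ.map_smul' }
  refine ⟨ψ.liftBaseChange k v, le_antisymm (Submodule.span_le.2 ?_) ?_⟩
  · rintro _ ⟨x, rfl⟩
    obtain ⟨t, ht⟩ := hv ((1 : k) ⊗ₜ x)
    refine Submodule.mem_span_singleton.2 ⟨t, ?_⟩
    rw [← map_smul, ht, LinearMap.liftBaseChange_tmul, one_smul]
    rfl
  · refine (Submodule.span_singleton_le_iff_mem _ _).2 ?_
    clear hv
    induction v using TensorProduct.induction_on with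
    | zero => rw [map_zero]; exact Submodule.zero_mem _
    | tmul t x =>
      rw [LinearMap.liftBaseChange_tmul]
      exact Submodule.smul_mem _ t (Submodule.subset_span ⟨x, rfl⟩)
    | add x y hx hy => rw [map_add]; exact Submodule.add_mem _ hx hy

theorem TransportFamily.exists_fibre_B_eq_span_singleton {k : Type u} [Field k] {A : AInfCat k}
    {K : Type u} [CommRing K] [Algebra k K] {γ : DeformationCocycle A K} (T : TransportFamily γ)
    (s : K →ₐ[k] k) : ∃ b, (T.fibre s).B = Submodule.span k {b} := by
  have := T.lineBundle
  obtain ⟨b, hb⟩ := exists_span_range_eq_span_singleton s.toRingHom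
    ((PreMod.fibreMap s T.M₀ T.M₁).comp T.B.subtype)
  refine ⟨b, Eq.trans ?_ hb⟩
  change Submodule.span k (PreMod.fibreMap s T.M₀ T.M₁ '' T.B) = _
  congr 1
  ext x
  exact ⟨fun ⟨y, hy, e⟩ => ⟨⟨y, hy⟩, e⟩, fun ⟨y, e⟩ => ⟨y, y.2, e⟩⟩

theorem TransportFamily.fibre_B_eq_map {k : Type u} [Field k] {A : AInfCat k}
    {K : Type u} [CommRing K] [Algebra k K] {γ : DeformationCocycle A K} (T : TransportFamily γ)
    (s : K →ₐ[k] k) : (T.fibre s).B = T.B.map (PreMod.fibreMap s T.M₀ T.M₁) := by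
  change Submodule.span k (PreMod.fibreMap s T.M₀ T.M₁ '' T.B) = _
  rw [← Submodule.map_coe, Submodule.span_eq]

namespace PreMod
variable {k : Type u} [Field k] {A : AInfCat k}

theorem HasLocalEnd.comm_of_iso {M M' : PreMod A k} (h : M.HasLocalEnd) (e : M' ≅ M)
    (x y : M' ⟶ M') : x ≫ y = y ≫ x := by
  have := h.comm (e.inv ≫ x ≫ e.hom) (e.inv ≫ y ≫ e.hom)
  simpa using this

theorem HasLocalEnd.exists_isNilpotent_sub_of_iso {M M' : PreMod A k} (h : M.HasLocalEnd) (e : M' ≅ M)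
    (x : End M') : ∃ t : k, IsNilpotent (x - t • (1 : End M')) := by
  obtain ⟨t, n, hn⟩ := h.exists_isNilpotent_sub (e.conj x)
  refine ⟨t, n, e.conj.injective ?_⟩
  have h0 : e.conj (0 : End M') = 0 := by
    change e.inv ≫ (0 : M' ⟶ M') ≫ e.hom = 0
    simp
  have h1 : e.conj (x - t • (1 : End M')) = e.conj x - t • 1 := by
    change e.inv ≫ ((show M' ⟶ M' from x) - t • 𝟙 M') ≫ e.hom = e.inv ≫ x ≫ e.hom - t • 𝟙 M
    simp
  rw [map_pow, h1, hn, h0]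

variable {K : Type u} [CommRing K] [Algebra k K] (s s' : K →ₐ[k] k)
  [IsAlgClosed k] [CharZero k] [IsDomain K] [Algebra.Smooth k K] (hK : ringKrullDim K = 1)
  {M N : PreMod A K} {γ : DeformationCocycle A K} {D₀ : Maps M M.omega} {D₁ : Maps N N.omega}
  (h₀ : Maps.IsRelativeConnection γ D₀) (h₁ : Maps.IsRelativeConnection γ D₁)
include hK h₀ h₁

theorem map_fibreMap_top (hM : M.IsPerfect) (hN : N.IsPerfect) :
    (⊤ : Submodule K (M ⟶ N)).map (fibreMap s M N) = ⊤ := by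
  rw [Submodule.map_top, LinearMap.range_eq_top]
  exact fibreMap_surjective s hK hM hN.isFamily h₀ h₁

/-- If the fibres of `M` and `N` at `s` are isomorphic, then the endomorphisms of `M` which factor through
`N` span all endomorphisms at `s`, and hence also at every other point `s'`. -/
theorem compSpan_top_fibre_eq_top (hM : M.IsPerfect) (hN : N.IsPerfect)
    (e : M.fibre s ≅ N.fibre s) :
    compSpan (⊤ : Submodule k (M.fibre s' ⟶ N.fibre s')) (⊤ : Submodule k (N.fibre s' ⟶ M.fibre s'))
      = ⊤ := by
  have hMN := fun s => map_fibreMap_top s hK h₀ h₁ hM hN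
  have hNM := fun s => map_fibreMap_top s hK h₁ h₀ hN hM
  have hMM := fun s => map_fibreMap_top s hK h₀ h₀ hM hM
  have key : compSpan (⊤ : Submodule K (M ⟶ N)) (⊤ : Submodule K (N ⟶ M)) = ⊤ := by
    refine eq_of_map_fibreMap_eq s hK h₀ h₀ hM hM
      (stable_compSpan h₀ h₁ h₀ (fun _ _ _ => trivial) fun _ _ _ => trivial)
      (fun _ _ _ => trivial) ?_
    rw [map_fibreMap_compSpan, hMN, hNM, hMM, compSpan_top_eq_top_of_iso e]
  rw [← hMN, ← hNM, ← map_fibreMap_compSpan, key, hMM]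

end PreMod

/-- Parallel transport of balanced triples is well-defined. -/
theorem TransportFamily.iso_of_iso {k : Type u} [Field k] [IsAlgClosed k] [CharZero k] {A : AInfCat k}
    {K : Type u} [CommRing K] [IsDomain K] [Algebra k K] [Algebra.Smooth k K]
    (hK : ringKrullDim K = 1) {γ : DeformationCocycle A K} (s s' : K →ₐ[k] k)
    {t : Triple A} (ht : t.IsBalanced) (T T' : TransportFamily γ) (h : (T.fibre s).Iso t)
    (h' : (T'.fibre s).Iso t) : (T.fibre s').Iso (T'.fibre s') := by
  obtain ⟨f₀, f₁, hf⟩ := h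
  obtain ⟨g₀, g₁, hg⟩ := h'
  have hX₀ : UnitOrNilpotentEnd (T.M₀.fibre s') := PreMod.unitOrNilpotentEnd_fibre s hK T.relative₀ s'
    T.perfect₀ (ht.local₀.comm_of_iso f₀) (ht.local₀.exists_isNilpotent_sub_of_iso f₀)
  have hX₁ : UnitOrNilpotentEnd (T.M₁.fibre s') := PreMod.unitOrNilpotentEnd_fibre s hK T.relative₁ s'
    T.perfect₁ (ht.local₁.comm_of_iso f₁) (ht.local₁.exists_isNilpotent_sub_of_iso f₁)
  have hY₀ : UnitOrNilpotentEnd (T'.M₀.fibre s') := PreMod.unitOrNilpotentEnd_fibre s hK T'.relative₀ s'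
    T'.perfect₀ (ht.local₀.comm_of_iso g₀) (ht.local₀.exists_isNilpotent_sub_of_iso g₀)
  have hY₁ : UnitOrNilpotentEnd (T'.M₁.fibre s') := PreMod.unitOrNilpotentEnd_fibre s hK T'.relative₁ s'
    T'.perfect₁ (ht.local₁.comm_of_iso g₁) (ht.local₁.exists_isNilpotent_sub_of_iso g₁)
  obtain ⟨e₀⟩ := hX₀.nonempty_iso hY₀
    (PreMod.compSpan_top_fibre_eq_top s s' hK T.relative₀ T'.relative₀ T.perfect₀ T'.perfect₀
      (f₀ ≪≫ g₀.symm))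
    (PreMod.compSpan_top_fibre_eq_top s s' hK T'.relative₀ T.relative₀ T'.perfect₀ T.perfect₀
      (g₀ ≪≫ f₀.symm))
  obtain ⟨e₁⟩ := hX₁.nonempty_iso hY₁
    (PreMod.compSpan_top_fibre_eq_top s s' hK T.relative₁ T'.relative₁ T.perfect₁ T'.perfect₁
      (f₁ ≪≫ g₁.symm))
    (PreMod.compSpan_top_fibre_eq_top s s' hK T'.relative₁ T.relative₁ T'.perfect₁ T.perfect₁
      (g₁ ≪≫ f₁.symm))
  have h0 := fun s => PreMod.map_fibreMap_top s hK T.relative₀ T'.relative₀ T.perfect₀ T'.perfect₀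
  have h1 := fun s => PreMod.map_fibreMap_top s hK T.relative₁ T'.relative₁ T.perfect₁ T'.perfect₁
  have hb : compSpan (⊤ : Submodule k (t.M₀ ⟶ t.M₀)) t.B =
      compSpan t.B (⊤ : Submodule k (t.M₁ ⟶ t.M₁)) := by
    refine Eq.trans ?_ (ht.image_eq.trans ?_)
    · rw [compSpan, Submodule.map₂_eq_span_image2]
      refine congrArg (Submodule.span k) (Set.ext fun z => ?_)
      exact ⟨fun ⟨x, _, b, hb, e⟩ => ⟨x, b, hb, e.symm⟩,
        fun ⟨x, b, hb, e⟩ => ⟨x, trivial, b, hb, e.symm⟩⟩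
    · rw [compSpan, Submodule.map₂_eq_span_image2]
      refine congrArg (Submodule.span k) (Set.ext fun z => ?_)
      exact ⟨fun ⟨x, b, hb, e⟩ => ⟨b, hb, x, trivial, e.symm⟩,
        fun ⟨b, hb, x, _, e⟩ => ⟨x, b, hb, e.symm⟩⟩
  -- the two families of morphisms agree at `s`, hence everywhere
  have key : compSpan (⊤ : Submodule K (T.M₀ ⟶ T'.M₀)) T'.B =
      compSpan T.B (⊤ : Submodule K (T.M₁ ⟶ T'.M₁)) := by
    refine PreMod.eq_of_map_fibreMap_eq s hK T.relative₀ T'.relative₁ T.perfect₀ T'.perfect₁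
      (PreMod.stable_compSpan T.relative₀ T'.relative₀ T'.relative₁ (fun _ _ _ => trivial) T'.stable)
      (PreMod.stable_compSpan T.relative₀ T.relative₁ T'.relative₁ T.stable fun _ _ _ => trivial) ?_
    rw [PreMod.map_fibreMap_compSpan, PreMod.map_fibreMap_compSpan, h0, h1, ← T.fibre_B_eq_map,
      ← T'.fibre_B_eq_map]
    exact compSpan_eq_of_iso f₀ f₁ g₀ g₁ hf hg hb
  have key' := congrArg (Submodule.map (PreMod.fibreMap s' T.M₀ T'.M₁)) key
  rw [PreMod.map_fibreMap_compSpan, PreMod.map_fibreMap_compSpan, h0, h1, ← T.fibre_B_eq_map,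
      ← T'.fibre_B_eq_map] at key'
  obtain ⟨b, hb⟩ := T.exists_fibre_B_eq_span_singleton s'
  obtain ⟨c, hc⟩ := T'.exists_fibre_B_eq_span_singleton s'
  rw [hb, hc] at key'
  obtain ⟨e₁', he⟩ := exists_iso_of_compSpan_eq e₀ e₁ hX₁ b c key'
  exact ⟨e₀, e₁', fun x => by rw [hb, hc]; exact he x⟩

theorem Triple.Iso.symm {k : Type u} [Field k] {A : AInfCat k} {t t' : Triple A} (h : t.Iso t') :
    t'.Iso t := by
  obtain ⟨f₀, f₁, hf⟩ := h
  refine ⟨f₀.symm, f₁.symm, fun b => ?_⟩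
  rw [hf]
  simp

theorem Triple.Iso.trans {k : Type u} [Field k] {A : AInfCat k} {t t' t'' : Triple A} (h : t.Iso t')
    (h' : t'.Iso t'') : t.Iso t'' := by
  obtain ⟨f₀, f₁, hf⟩ := h
  obtain ⟨g₀, g₁, hg⟩ := h'
  refine ⟨f₀ ≪≫ g₀, f₁ ≪≫ g₁, fun b => ?_⟩
  rw [hf, hg]
  simp

end

end AInf

end

theorem proposition1p24 {k : Type u} [Field k] [IsAlgClosed k] [CharZero k]
    (A : AInf.AInfCat k) (hA : A.IsProper)
    (K : Type u) [CommRing K] [IsDomain K] [Algebra k K] [Algebra.Smooth k K]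
    (hK : ringKrullDim K = 1)
    (γ : AInf.DeformationCocycle A K) (s s' : K →ₐ[k] k)
    (t t₁ t₂ : AInf.Triple A) (ht : t.IsBalanced)
    (h₁ : AInf.Triple.IsParallelTransport γ s s' t t₁)
    (h₂ : AInf.Triple.IsParallelTransport γ s s' t t₂) :
    t₁.Iso t₂ := by
  obtain ⟨T, hT, hT₁⟩ := h₁
  obtain ⟨T', hT', hT₂⟩ := h₂
  exact hT₁.symm.trans ((T.iso_of_iso hK s s' ht T' hT hT').trans hT₂)
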